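/- Let $D_\Theta$ be a planar diagram of a $\theta$-curve with vertices $v_1,v_2$ and edges $e_1,e_2,e_3$, the edges appearing counterclockwise in the cyclic order $(e_3,e_2,e_1)$ at $v_1$ and $(e_1,e_2,e_3)$ at $v_2$. Orient every edge from $v_1$ to $v_2$, let $\omega_{ii}$ be the sum of the signs of the self-crossings of $e_i$ and, for $i\neq j$, $\omega_{ij}$ the sum of the signs of the crossings between $e_i$ and $e_j$, and put $$n_i=-\omega_{ii}+\tfrac12(\omega_{ij}+\omega_{ik}-\omega_{jk}),\qquad \{i,j,k\}=\{1,2,3\}.$$ Let $L=l_1\cup l_2\cup l_3$ be the link diagram formed by the boundary of the band diagram obtained by thickening $D_\Theta$ in the plane, where $l_i$ is the component that runs along the two edges $e_j,e_k$ with $\{i,j,k\}=\{1,2,3\}$, and let $l_i^{(2)}$ be the 2-parallel of the knot diagram $l_i$. Let $\langle\,\cdot\,\rangle$ be the Kauffman bracket in the variable $A$, normalized to be $1$ on the simple circle, and $\varphi=A^2+A^{-2}$. The Jaeger polynomial $\mathfrak J(D_\Theta)\in\mathbb Q(A)$ is defined as follows. The bar diagram $B$ of $D_\Theta$ is the thickened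 diagram with one bar across the band of each strand between consecutive crossings or vertices, and $\mathfrak J(D_\Theta)=R(B)$ with $a=-A^3$, $t=A$, where $R$ is determined by the relation $$R(\text{bar})=\frac1{t+t^{-1}}\Big(R(\text{half twist})+t^{-1}R(\text{no bar})+\frac{t-t^{-1}}{1-at}R(\text{cut})\Big)$$ (the barred piece of band is replaced by a piece with a half twist whose crossing satisfies $\langle\text{half twist}\rangle=A\langle\text{no bar}\rangle+A^{-1}\langle\text{cut}\rangle$, by the same piece without the bar, and by the smoothing that cuts the band) and, for band diagrams without bars, by the value of the Dubrovnik polynomial of the boundary link at $a=-A^3$, $z=t-t^{-1}=A-A^{-1}$, which is the Kauffman bracket of the boundary link. The normalized Jaeger polynomial is $\widetilde{\mathfrak J}(D_\Theta)=(-A^4)^{2(n_1+n_2+n_3)}\,\mathfrak J(D_\Theta)$. Then $$\widetilde{\mathfrak J}(D_\Theta)=(-A^4)^{2(n_1+n_2+n_3)}\Big\{\langle L\rangle+\frac1\varphi\sum_{i=1}^3\langle l_i^{(2)}\rangle+\frac2{\varphi^2}\Big\}.$$ -/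

import Mathlib

namespace ThetaCurve

/-! ### Link diagrams

A diagram in the plane is put in general position with respect to the height function and is
read from bottom to top as a word of slices. A slice contains exactly one elementary piece
(local minimum, local maximum, crossing, vertex) and vertical strands to its left and right. -/

/-- The elementary pieces of an unoriented link diagram: a local minimum, a local maximum, and a
crossing; in `cross ov` the strand that runs from the bottom left to the top right is the upper
strand if and only if `ov = true`. -/
inductive Piece
  | cup
  | cap
  | cross (ov : Bool)

/-- A slice of a link diagram: `piece` occurs with exactly `pos` strands to its left. -/
structure Slice where
  pos : ℕ
  piece : Piece

/-- Bookkeeping of the arcs that lie below a given height: `ends` lists, from left to right, the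
names of the arcs to which the strands at that height belong, `fresh` is the next unused name and
`loops` is the number of components that have been closed so far. -/
structure ArcState where
  ends : List ℕ
  fresh : ℕ
  loops : ℕ

namespace ArcState

/-- The empty state. -/
def empty : ArcState := ⟨[], 0, 0⟩

/-- A local minimum: a new arc with two ends. -/
def cup (s : ArcState) (p : ℕ) : ArcState :=
  ⟨s.ends.take p ++ [s.fresh, s.fresh] ++ s.ends.drop p, s.fresh + 1, s.loops⟩

/-- A local maximum: it joins two different arcs or closes one arc to a loop. -/
def cap (s : ArcState) (p : ℕ) : ArcState :=
  match s.ends.drop p with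
  | a :: b :: r =>
    if a = b then ⟨s.ends.take p ++ r, s.fresh, s.loops + 1⟩
    else ⟨(s.ends.take p ++ r).map (fun c => if c = b then a else c), s.fresh, s.loops⟩
  | _ => s

/-- A crossing, passed straight. -/
def swap (s : ArcState) (p : ℕ) : ArcState :=
  match s.ends.drop p with
  | a :: b :: r => ⟨s.ends.take p ++ b :: a :: r, s.fresh, s.loops⟩
  | _ => s

/-- A vertex: `b` arcs end at it from below, and `m` new arcs start from it upwards. -/
def vertex (s : ArcState) (p b m : ℕ) : ArcState :=
  ⟨s.ends.take p ++ (List.range m).map (fun j => s.fresh + j) ++ s.ends.drop (p + b),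
    s.fresh + m, s.loops⟩

end ArcState

section Evaluation

variable {K : Type*} [Field K]

/-- The state sum of the Kauffman bracket: each crossing is smoothed in both ways, with weight `A`
for the smoothing that joins the two regions swept out by turning the upper strand
counterclockwise and weight `A⁻¹` for the other one, and a state with `c` loops contributes
`(-A² - A⁻²) ^ (c - 1)`. -/
def bracketFrom (A : K) : ArcState → List Slice → K
  | s, [] => (-A ^ 2 - (A ^ 2)⁻¹) ^ ((s.loops : ℤ) - 1)
  | s, ⟨p, .cup⟩ :: w => bracketFrom A (s.cup p) w
  | s, ⟨p, .cap⟩ :: w => bracketFrom A (s.cap p) w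
  | s, ⟨p, .cross true⟩ :: w =>
      A * bracketFrom A s w + A⁻¹ * bracketFrom A ((s.cap p).cup p) w
  | s, ⟨p, .cross false⟩ :: w =>
      A⁻¹ * bracketFrom A s w + A * bracketFrom A ((s.cap p).cup p) w

/-- The Kauffman bracket polynomial of a link diagram, with value `1` on the simple circle. -/
def bracket (A : K) (w : List Slice) : K := bracketFrom A ArcState.empty w

/-- The bracket satisfies the exchange relation of the Dubrovnik polynomial for `z = A - A⁻¹`. -/
theorem bracket_exchange (A : K) (u v : List Slice) (p : ℕ) :
    bracket A (u ++ ⟨p, .cross true⟩ :: v) - bracket A (u ++ ⟨p, .cross false⟩ :: v) =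
      (A - A⁻¹) * (bracket A (u ++ v) - bracket A (u ++ ⟨p, .cap⟩ :: ⟨p, .cup⟩ :: v)) := by
  suffices h : ∀ s : ArcState,
      bracketFrom A s (u ++ ⟨p, .cross true⟩ :: v)
        - bracketFrom A s (u ++ ⟨p, .cross false⟩ :: v) =
      (A - A⁻¹) * (bracketFrom A s (u ++ v)
        - bracketFrom A s (u ++ ⟨p, .cap⟩ :: ⟨p, .cup⟩ :: v)) from h _
  induction u with
  | nil => intro s; simp only [List.nil_append, bracketFrom]; ring
  | cons x u ih =>
    intro s
    obtain ⟨n, _ | _ | _ | _⟩ := x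
    · simpa only [List.cons_append, bracketFrom] using ih _
    · simpa only [List.cons_append, bracketFrom] using ih _
    · simp only [List.cons_append, bracketFrom]
      linear_combination A⁻¹ * ih s + A * ih ((s.cap n).cup n)
    · simp only [List.cons_append, bracketFrom]
      linear_combination A * ih s + A⁻¹ * ih ((s.cap n).cup n)

end Evaluation

/-- The 2-parallel of a link diagram: every strand is replaced by two parallel strands. -/
def parallel (w : List Slice) : List Slice :=
  w.flatMap fun s =>
    match s with
    | ⟨p, .cup⟩ => [⟨2 * p, .cup⟩, ⟨2 * p + 1, .cup⟩]
    | ⟨p, .cap⟩ => [⟨2 * p + 1, .cap⟩, ⟨2 * p, .cap⟩]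
    | ⟨p, .cross o⟩ =>
      [⟨2 * p + 1, .cross o⟩, ⟨2 * p, .cross o⟩, ⟨2 * p + 2, .cross o⟩, ⟨2 * p + 1, .cross o⟩]

/-! ### Band diagrams with bars -/

/-- A slice of a band diagram with bars, the bands being given by their boundary strands:
an elementary piece of the boundary, or a bar across the band whose two boundary strands
have exactly `pos` strands to their left. -/
inductive BarSlice
  | piece (s : Slice)
  | bar (pos : ℕ)

section Evaluation

variable {K : Type*} [Field K]

/-- The expression `R` in `a` and `t` of a band diagram with bars, with a prescribed evaluation
`ev` of the boundary links of the band diagrams without bars. A bar is replaced by a half twist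
of the band, by no bar, and by the smoothing that cuts the band:
`R(bar) = (R(half twist) + t⁻¹ R(no bar) + (t - t⁻¹) / (1 - a t) R(cut)) / (t + t⁻¹)`.
The first list is the part of the diagram (read from the bottom) whose bars have been replaced. -/
def barExpand (ev : List Slice → K) (a t : K) : List Slice → List BarSlice → K
  | w, [] => ev w
  | w, .piece s :: b => barExpand ev a t (w ++ [s]) b
  | w, .bar p :: b =>
      1 / (t + t⁻¹) *
        (barExpand ev a t (w ++ [⟨p, .cross true⟩]) b
          + t⁻¹ * barExpand ev a t w b
          + (t - t⁻¹) / (1 - a * t) * barExpand ev a t (w ++ [⟨p, .cap⟩, ⟨p, .cup⟩]) b)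

/-- `R` at `a = -A³`, `t = A`. There the Dubrovnik polynomial `𝔇(a, z = t - t⁻¹)`, which evaluates
the bar-free diagrams, is the bracket polynomial in `A`. -/
def R (A : K) (b : List BarSlice) : K := barExpand (bracket A) (-A ^ 3) A [] b

end Evaluation

/-! ### Diagrams of theta-curves -/

/-- A strand of a diagram of a theta-curve: a piece of the edge `edge` that runs upwards or
downwards. The edges are indexed by `Fin 3` (cyclically) and are oriented from `v₁` to `v₂`. -/
structure Strand where
  edge : Fin 3
  up : Bool

/-- The elementary pieces of a diagram of a theta-curve. -/
inductive ThetaPiece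
  /-- a local minimum of the edge `i`; the left end runs upwards iff `leftUp` -/
  | cup (i : Fin 3) (leftUp : Bool)
  /-- a local maximum of the edge `i`; the left end runs upwards iff `leftUp` -/
  | cap (i : Fin 3) (leftUp : Bool)
  /-- a crossing of `x`, which comes from the bottom left, with `y`, which comes from the bottom
  right; `x` is the upper strand iff `ov` -/
  | cross (ov : Bool) (x y : Strand)
  /-- the vertex `v₁`, with `m` legs above and `3 - m` legs below; the edges around it, clockwise
  from the leftmost upper leg, are `k, k + 1, k + 2` -/
  | source (m : Fin 4) (k : Fin 3)
  /-- the vertex `v₂`, with `m` legs above and `3 - m` legs below; the edges around it, clockwise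
  from the leftmost upper leg, are `k + 2, k + 1, k` -/
  | sink (m : Fin 4) (k : Fin 3)

namespace ThetaPiece

/-- The strands that enter the piece from below, from left to right. -/
def bot : ThetaPiece → List Strand
  | cup _ _ => []
  | cap i u => [⟨i, u⟩, ⟨i, !u⟩]
  | cross _ x y => [x, y]
  | source m k => (([k, k + 1, k + 2] : List (Fin 3)).drop m).reverse.map fun i => ⟨i, false⟩
  | sink m k => (([k + 2, k + 1, k] : List (Fin 3)).drop m).reverse.map fun i => ⟨i, true⟩

/-- The strands that leave the piece upwards, from left to right. -/
def top : ThetaPiece → List Strand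
  | cup i u => [⟨i, u⟩, ⟨i, !u⟩]
  | cap _ _ => []
  | cross _ x y => [y, x]
  | source m k => (([k, k + 1, k + 2] : List (Fin 3)).take m).map fun i => ⟨i, true⟩
  | sink m k => (([k + 2, k + 1, k] : List (Fin 3)).take m).map fun i => ⟨i, false⟩

/-- The piece is the vertex `v₁`. -/
def isSource : ThetaPiece → Bool
  | source _ _ => true
  | _ => false

/-- The piece is the vertex `v₂`. -/
def isSink : ThetaPiece → Bool
  | sink _ _ => true
  | _ => false

end ThetaPiece

/-- A slice of a diagram of a theta-curve: a piece with the strands to its left and right. -/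
structure ThetaSlice where
  left : List Strand
  piece : ThetaPiece
  right : List Strand

/-- The consecutive slices of `w` fit together, from the strands `s` to the strands `t`. -/
def Fits : List Strand → List ThetaSlice → List Strand → Prop
  | s, [], t => s = t
  | s, x :: w, t => s = x.left ++ x.piece.bot ++ x.right ∧
      Fits (x.left ++ x.piece.top ++ x.right) w t

/-- Follow the edges through a slice. -/
def ThetaSlice.trace (s : ArcState) (x : ThetaSlice) : ArcState :=
  match x.piece with
  | .cup _ _ => s.cup x.left.length
  | .cap _ _ => s.cap x.left.length
  | .cross _ _ _ => s.swap x.left.length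
  | .source m _ => s.vertex x.left.length (3 - m) m
  | .sink m _ => s.vertex x.left.length (3 - m) m

/-- A diagram `D` of a theta-curve with vertices `v₁`, `v₂` and edges `e₁`, `e₂`, `e₃` (here
indexed by `Fin 3`), the edges appearing counterclockwise in the cyclic order `(e₃, e₂, e₁)` at
`v₁` and `(e₁, e₂, e₃)` at `v₂`. Since there is no closed component, each edge is one arc
from `v₁` to `v₂`. -/
structure ThetaDiagram where
  slices : List ThetaSlice
  fits : Fits [] slices []
  one_source : slices.countP (fun x => x.piece.isSource) = 1
  one_sink : slices.countP (fun x => x.piece.isSink) = 1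
  no_loop : (slices.foldl ThetaSlice.trace ArcState.empty).loops = 0

/-! ### The boundary link of the thickened diagram -/

/-- The index of the boundary component on the left-hand side of a strand in the plane. Seen
along the orientation, the edge `i` has the component `i + 1` on its left and the component
`i + 2` on its right, so that the component `l i` runs along the edges `i + 1` and `i + 2`. -/
def Strand.lft (x : Strand) : Fin 3 := if x.up then x.edge + 1 else x.edge + 2

/-- The index of the boundary component on the right-hand side of a strand in the plane. -/
def Strand.rgt (x : Strand) : Fin 3 := if x.up then x.edge + 2 else x.edge + 1

/-- The labels of the boundary strands of the bands along a row of strands. -/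
def sides (s : List Strand) : List (Fin 3) := s.flatMap fun x => [x.lft, x.rgt]

/-- A slice of a diagram of a 3-component link with the component of every strand recorded; `left`
contains the components of the strands to the left of the piece. -/
inductive LabelledSlice
  | cup (left : List (Fin 3)) (x : Fin 3)
  | cap (left : List (Fin 3)) (x : Fin 3)
  | cross (left : List (Fin 3)) (ov : Bool) (x y : Fin 3)

namespace LabelledSlice

/-- Forget the components. -/
def forget : LabelledSlice → Slice
  | cup l _ => ⟨l.length, .cup⟩
  | cap l _ => ⟨l.length, .cap⟩
  | cross l o _ _ => ⟨l.length, .cross o⟩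

/-- The part of the slice that belongs to the component `i` alone, if it contains a piece. -/
def restrict (i : Fin 3) : LabelledSlice → Option Slice
  | cup l x => if x = i then some ⟨l.count i, .cup⟩ else none
  | cap l x => if x = i then some ⟨l.count i, .cap⟩ else none
  | cross l o x y => if x = i ∧ y = i then some ⟨l.count i, .cross o⟩ else none

end LabelledSlice

/-- The boundary of the disk at a vertex and of its three bands, with the strands `b` (to the left
of the vertex), and with given lower and upper legs. -/
def vertexBand (b : List (Fin 3)) : List Strand → List Strand → List LabelledSlice
  | [], [x, y, _] => [.cup b x.lft, .cup (b ++ [x.lft]) x.rgt,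
      .cup (b ++ [x.lft, x.rgt, y.lft]) y.rgt]
  | [_], [x, _] => [.cup (b ++ [x.lft]) x.rgt]
  | [x, _], [_] => [.cap (b ++ [x.lft]) x.rgt]
  | [x, y, _], [] => [.cap (b ++ [x.lft]) x.rgt, .cap (b ++ [x.lft]) y.rgt, .cap b x.lft]
  | _, _ => []

/-- The boundary of the band obtained by thickening a slice in the plane. -/
def ThetaSlice.band (x : ThetaSlice) : List LabelledSlice :=
  let b := sides x.left
  match x.piece with
  | .cup i u => let s : Strand := ⟨i, u⟩; [.cup b s.lft, .cup (b ++ [s.lft]) s.rgt]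
  | .cap i u => let s : Strand := ⟨i, u⟩; [.cap (b ++ [s.lft]) s.rgt, .cap b s.lft]
  | .cross o y z =>
      [.cross (b ++ [y.lft]) o y.rgt z.lft, .cross b o y.lft z.lft,
        .cross (b ++ [z.lft, y.lft]) o y.rgt z.rgt, .cross (b ++ [z.lft]) o y.lft z.rgt]
  | .source m k => vertexBand b (ThetaPiece.source m k).bot (ThetaPiece.source m k).top
  | .sink m k => vertexBand b (ThetaPiece.sink m k).bot (ThetaPiece.sink m k).top

/-- The places, counted in boundary strands, of the legs in `s` with direction `d`, the first leg
having `n` bands to its left. -/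
def barPlaces (d : Bool) (n : ℕ) : List Strand → List ℕ
  | [] => []
  | x :: s => if x.up = d then 2 * n :: barPlaces d (n + 1) s else barPlaces d (n + 1) s

/-- The slice is a crossing or a vertex. -/
def ThetaSlice.isNode (x : ThetaSlice) : Bool :=
  match x.piece with
  | .cup _ _ => false
  | .cap _ _ => false
  | _ => true

/-- The band of a slice with bars: at each crossing and each vertex the outgoing legs carry a bar
(the lower legs that run downwards and the upper legs that run upwards). -/
def ThetaSlice.barBand (x : ThetaSlice) : List BarSlice :=
  let band := x.band.map fun s => BarSlice.piece s.forget
  if x.isNode then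
    (barPlaces false x.left.length x.piece.bot).map BarSlice.bar ++ band ++
      (barPlaces true x.left.length x.piece.top).map BarSlice.bar
  else band

namespace ThetaDiagram

variable (D : ThetaDiagram)

/-- The boundary of the thickened diagram as a 3-component link diagram. -/
def boundary : List LabelledSlice := D.slices.flatMap ThetaSlice.band

/-- The link diagram `L`. -/
def L : List Slice := D.boundary.map LabelledSlice.forget

/-- The component `l i` of `L`, as a knot diagram. -/
def l (i : Fin 3) : List Slice := D.boundary.filterMap (LabelledSlice.restrict i)

/-- The bar diagram `B_D`: each strand of `D` between two consecutive crossings or vertices becomes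
a band with exactly one bar, placed at the beginning of the strand with respect to the orientation
of the edge. -/
def barDiagram : List BarSlice := D.slices.flatMap ThetaSlice.barBand

/-- The contribution of a slice to the sum of the signs of the crossings between the edges
`i` and `j` (of the self-crossings if `i = j`). -/
def sliceSign (i j : Fin 3) (x : ThetaSlice) : ℤ :=
  match x.piece with
  | .cross o y z =>
    if (y.edge = i ∧ z.edge = j) ∨ (y.edge = j ∧ z.edge = i) then
      (if o then 1 else -1) * (if y.up = z.up then 1 else -1)
    else 0
  | _ => 0

/-- The sum `ω i j` of the signs of the crossings between the edges `i` and `j`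
(of the self-crossings if `i = j`). -/
def ω (i j : Fin 3) : ℤ := (D.slices.map (sliceSign i j)).sum

/-- The integer `2 nᵢ = -2 ωᵢᵢ + ωᵢⱼ + ωᵢₖ - ωⱼₖ`, where `{i, j, k}` is the set of all edges. -/
def twiceN (i : Fin 3) : ℤ :=
  -2 * D.ω i i + D.ω i (i + 1) + D.ω i (i + 2) - D.ω (i + 1) (i + 2)

section Evaluation

variable {K : Type*} [Field K] (A : K)

/-- The Jaeger polynomial `𝔍(D; A)`. -/
def jaeger : K := R A D.barDiagram

/-- The normalized Jaeger polynomial `(-A⁴) ^ (2 (n₁ + n₂ + n₃)) 𝔍(D; A)`. -/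
def normalizedJaeger : K := (-A ^ 4) ^ (∑ i, D.twiceN i) * D.jaeger A

end Evaluation

end ThetaDiagram

end ThetaCurve

/-! ### Temperley–Lieb calculus of cups and caps, and operators supported on consecutive strands. -/

namespace ThetaCurve

/-! A band is a pair of parallel strands in the Temperley–Lieb calculus with loop value `d = -A² -
A⁻² = -φ`. Let `h` be the diagram that cuts the band (`hook`). At `a = -A³`, `t = A` the three terms
that replace a bar add up to `1 - d⁻¹ h`. Since `h² = d h`, this is an idempotent, the Jones–Wenzl
projection on two strands, with complement `g = d⁻¹ h`. So the Jaeger polynomial is the bracket of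
`L` with this idempotent inserted at every bar (`barExpand_eq`).

A cut of a band, and hence both idempotents, can be slid along the band: around minima and maxima by
planar isotopy (`bandCup_hook`, `hook_bandCap`), through a crossing of two bands by the second
Reidemeister move (`hook_bandCrossing`). All bars of an edge therefore merge into one at `v₁`, and
it remains to expand `(1 - g₁)(1 - g₂)(1 - g₃)` there. Cutting two bands at a vertex has the same
effect as cutting all three: the three double products and the triple product agree, and the
expansion becomes `1 - ∑ gᵢ + 2 g₁g₂g₃` (`resolve_source`). The term `1` is `L`. In the term `gᵢ`
the band of the edge `i` is cut and its ends retract; the bands of the two other edges remain, and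
they form the 2-parallel of `l i`, with a factor `d⁻¹` (`fullyMarked_cutEdge`). With all edges cut
only `d⁻¹` times the empty diagram remains (`fullyMarked_false`), whose normalized value is `d⁻¹` as
well. Substituting `d = -φ` gives the formula; the power of `-A⁴` is common to both sides.

Two points need care when a diagram is a word of slices. First, sliding along an edge is a global
operation. It is replaced by a colouring argument (`marked_absorb`): colour the places of a fixed
edge where one more mark would change the value. The local sliding rules make this a colouring that
is constant along the edge, and idempotence makes it vanish at `v₁`. Counting coloured strands with
their directions shows that it vanishes at `v₂` too (`ColouredBy.strict`), so a coloured arc would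
have to close up to a loop, and there is none (`ColouredBy.not_mem`). Second, retracting a cut band
is done row by row: `insertCut` fills in the cut bands of a row, and it can be pushed upwards
through every slice (`insertCut_fullyMarked`).

These computations take place in any algebra that satisfies the relations `CupCap`. The bracket is a
matrix coefficient of one such algebra, acting on functions of the connection patterns of the
strands (`patternCupCap`, `bracketFrom_eq`). -/

/-- Planar cups and caps on infinitely many strands: elements of a `K`-algebra subject to the
relations of planar isotopy, with loop value `d`. Products are read from bottom to top. -/
structure CupCap (K : Type*) (E : Type*) [Field K] [Ring E] [Algebra K E] (d : K) where
  cup : ℕ → E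
  cap : ℕ → E
  loop : ∀ p, cup p * cap p = d • (1 : E)
  zig : ∀ p, cup p * cap (p + 1) = 1
  zag : ∀ p, cup (p + 1) * cap p = 1
  cup_cup : ∀ p q, p ≤ q → cup q * cup p = cup p * cup (q + 2)
  cap_cap : ∀ p q, p ≤ q → cap (q + 2) * cap p = cap p * cap q
  cup_cap_right : ∀ p q, p ≤ q → cup p * cap (q + 2) = cap q * cup p
  cup_cap_left : ∀ p q, p ≤ q → cup (q + 2) * cap p = cap p * cup q

namespace CupCap

variable {K : Type*} {E : Type*} [Field K] [Ring E] [Algebra K E] {d : K} (T : CupCap K E d)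

/-- `X b` is an operator on the `n` strands from `b` on, with `m` strands above it. -/
structure Loc (n m : ℕ) (X : ℕ → E) : Prop where
  cup_left : ∀ p b, p ≤ b → T.cup p * X (b + 2) = X b * T.cup p
  cap_left : ∀ p b, p ≤ b → X (b + 2) * T.cap p = T.cap p * X b
  cup_right : ∀ b q, T.cup (b + n + q) * X b = X b * T.cup (b + m + q)
  cap_right : ∀ b q, X b * T.cap (b + m + q) = T.cap (b + n + q) * X b

variable {T}

theorem Loc.mul {n m l : ℕ} {X Y : ℕ → E} (hX : T.Loc n m X) (hY : T.Loc m l Y) :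
    T.Loc n l (fun b => X b * Y b) where
  cup_left p b h := by
    rw [← mul_assoc, hX.cup_left p b h, mul_assoc, hY.cup_left p b h, mul_assoc]
  cap_left p b h := by
    rw [mul_assoc, hY.cap_left p b h, ← mul_assoc, hX.cap_left p b h, mul_assoc]
  cup_right b q := by rw [← mul_assoc, hX.cup_right, mul_assoc, hY.cup_right, mul_assoc]
  cap_right b q := by rw [mul_assoc, hY.cap_right, ← mul_assoc, hX.cap_right, mul_assoc]

theorem Loc.one (n : ℕ) : T.Loc n n (fun _ => 1) := by
  constructor <;> simp

theorem Loc.add {n m : ℕ} {X Y : ℕ → E} (hX : T.Loc n m X) (hY : T.Loc n m Y) :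
    T.Loc n m (fun b => X b + Y b) where
  cup_left p b h := by rw [mul_add, hX.cup_left p b h, hY.cup_left p b h, add_mul]
  cap_left p b h := by rw [add_mul, hX.cap_left p b h, hY.cap_left p b h, mul_add]
  cup_right b q := by rw [mul_add, hX.cup_right, hY.cup_right, add_mul]
  cap_right b q := by rw [add_mul, hX.cap_right, hY.cap_right, mul_add]

theorem Loc.smul {n m : ℕ} {X : ℕ → E} (c : K) (hX : T.Loc n m X) :
    T.Loc n m (fun b => c • X b) where
  cup_left p b h := by rw [mul_smul_comm, hX.cup_left p b h, smul_mul_assoc]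
  cap_left p b h := by rw [smul_mul_assoc, hX.cap_left p b h, mul_smul_comm]
  cup_right b q := by rw [mul_smul_comm, hX.cup_right, smul_mul_assoc]
  cap_right b q := by rw [smul_mul_assoc, hX.cap_right, mul_smul_comm]

theorem Loc.pad_right {n m : ℕ} {X : ℕ → E} (hX : T.Loc n m X) (j : ℕ) :
    T.Loc (n + j) (m + j) X where
  cup_left := hX.cup_left
  cap_left := hX.cap_left
  cup_right b q := by simpa only [add_assoc] using hX.cup_right b (j + q)
  cap_right b q := by simpa only [add_assoc] using hX.cap_right b (j + q)

theorem Loc.pad_left {n m : ℕ} {X : ℕ → E} (hX : T.Loc n m X) (j : ℕ) :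
    T.Loc (j + n) (j + m) (fun b => X (b + j)) where
  cup_left p b h := by
    have := hX.cup_left p (b + j) (by omega)
    rwa [show b + j + 2 = b + 2 + j by omega] at this
  cap_left p b h := by
    have := hX.cap_left p (b + j) (by omega)
    rwa [show b + j + 2 = b + 2 + j by omega] at this
  cup_right b q := by simpa only [add_assoc] using hX.cup_right (b + j) q
  cap_right b q := by simpa only [add_assoc] using hX.cap_right (b + j) q

variable (T)

theorem Loc.cup : T.Loc 0 2 T.cup where
  cup_left p b h := (T.cup_cup p b h).symm
  cap_left p b h := T.cup_cap_left p b h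
  cup_right b q := by
    rw [T.cup_cup b (b + 0 + q) (by omega)]; congr 2; omega
  cap_right b q := by
    rw [show b + 2 + q = b + 0 + q + 2 by omega, T.cup_cap_right b _ (by omega)]

theorem Loc.cap : T.Loc 2 0 T.cap where
  cup_left p b h := T.cup_cap_right p b h
  cap_left p b h := T.cap_cap p b h
  cup_right b q := by
    rw [show b + 2 + q = b + 0 + q + 2 by omega, T.cup_cap_left b _ (by omega)]
  cap_right b q := by
    rw [show b + 2 + q = b + 0 + q + 2 by omega, T.cap_cap b _ (by omega)]

/-- Cap off two strands and open them again. -/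
def hook (p : ℕ) : E := T.cap p * T.cup p

theorem Loc.hook : T.Loc 2 2 T.hook := (Loc.cap T).mul (Loc.cup T)

/-- A crossing with weights `α` and `α⁻¹` of the two smoothings. -/
def crossing (α : K) (p : ℕ) : E := α • (1 : E) + α⁻¹ • T.hook p

theorem Loc.crossing (α : K) : T.Loc 2 2 (T.crossing α) :=
  ((Loc.one 2).smul α).add ((Loc.hook T).smul α⁻¹)

/-- The band of a local minimum. -/
def bandCup (b : ℕ) : E := T.cup b * T.cup (b + 1)

/-- The band of a local maximum. -/
def bandCap (b : ℕ) : E := T.cap (b + 1) * T.cap b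

/-- The crossing of two bands. -/
def bandCrossing (α : K) (b : ℕ) : E :=
  T.crossing α (b + 1) * (T.crossing α b * (T.crossing α (b + 2) * T.crossing α (b + 1)))

theorem Loc.bandCup : T.Loc 0 4 T.bandCup :=
  (Loc.cup T).mul (((Loc.cup T).pad_left 1).pad_right 1)

theorem Loc.bandCap : T.Loc 4 0 T.bandCap :=
  (((Loc.cap T).pad_left 1).pad_right 1).mul (Loc.cap T)

theorem Loc.bandCrossing (α : K) : T.Loc 4 4 (T.bandCrossing α) :=
  have h0 : T.Loc 4 4 (T.crossing α) := (Loc.crossing T α).pad_right 2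
  have h1 := ((Loc.crossing T α).pad_left 1).pad_right 1
  have h2 := ((Loc.crossing T α).pad_left 2)
  h1.mul (h0.mul (h2.mul h1))

theorem zig_assoc (p : ℕ) (x : E) : T.cup p * (T.cap (p + 1) * x) = x := by
  rw [← mul_assoc, T.zig, one_mul]

theorem zag_assoc (p : ℕ) (x : E) : T.cup (p + 1) * (T.cap p * x) = x := by
  rw [← mul_assoc, T.zag, one_mul]

theorem loop_assoc (p : ℕ) (x : E) : T.cup p * (T.cap p * x) = d • x := by
  rw [← mul_assoc, T.loop, smul_mul_assoc, one_mul]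

/-! ### Sliding strands and cuts through crossings. -/

section Slide

variable {α : K}

/-- This is the cancellation behind the second Reidemeister move; it is where the value of `d` is
needed. -/
theorem slide_coeff (hα : α ≠ 0) (hd : d = -α ^ 2 - (α ^ 2)⁻¹) :
    α * α + d + α⁻¹ * α⁻¹ = 0 := by
  subst hd; field_simp; ring

variable (hα : α ≠ 0) (hd : d = -α ^ 2 - (α ^ 2)⁻¹)
include hα hd

/-- Of the four smoothings of the two crossings, three are multiples of `cup p` whose coefficients
cancel by `slide_coeff`; the fourth is straightened to `cup (p + 1)`. This and the next three
statements pull a bent arc off a strand. -/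
theorem cup_slide_right (p : ℕ) :
    T.cup p * (T.crossing α (p + 1) * T.crossing α p) = T.cup (p + 1) := by
  have h : T.cup p * (T.crossing α (p + 1) * T.crossing α p) =
      (α * α + d + α⁻¹ * α⁻¹) • T.cup p + T.cup (p + 1) := by
    simp only [crossing, hook, mul_add, add_mul, smul_mul_assoc, mul_smul_comm, smul_smul,
      mul_one, one_mul, mul_assoc, T.zig_assoc, T.zag_assoc, T.loop_assoc, add_smul,
      mul_inv_cancel₀ hα, inv_mul_cancel_left₀ hα, inv_mul_cancel₀ hα, one_smul, smul_add]
    abel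
  rw [h, slide_coeff hα hd, zero_smul, zero_add]

theorem cup_slide_left (p : ℕ) :
    T.cup (p + 1) * (T.crossing α p * T.crossing α (p + 1)) = T.cup p := by
  have h : T.cup (p + 1) * (T.crossing α p * T.crossing α (p + 1)) =
      (α * α + d + α⁻¹ * α⁻¹) • T.cup (p + 1) + T.cup p := by
    simp only [crossing, hook, mul_add, add_mul, smul_mul_assoc, mul_smul_comm, smul_smul,
      mul_one, one_mul, mul_assoc, T.zig_assoc, T.zag_assoc, T.loop_assoc, add_smul,
      mul_inv_cancel₀ hα, inv_mul_cancel_left₀ hα, inv_mul_cancel₀ hα, one_smul, smul_add]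
    abel
  rw [h, slide_coeff hα hd, zero_smul, zero_add]

theorem slide_cap_right (p : ℕ) :
    T.crossing α p * (T.crossing α (p + 1) * T.cap p) = T.cap (p + 1) := by
  have h : T.crossing α p * (T.crossing α (p + 1) * T.cap p) =
      (α * α + d + α⁻¹ * α⁻¹) • T.cap p + T.cap (p + 1) := by
    simp only [crossing, hook, mul_add, add_mul, smul_mul_assoc, mul_smul_comm, smul_smul,
      mul_one, one_mul, mul_assoc, T.zig, T.zag, T.loop, add_smul, mul_inv_cancel_left₀ hα,
      inv_mul_cancel₀ hα, one_smul, smul_add]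
    abel
  rw [h, slide_coeff hα hd, zero_smul, zero_add]

theorem slide_cap_left (p : ℕ) :
    T.crossing α (p + 1) * (T.crossing α p * T.cap (p + 1)) = T.cap p := by
  have h : T.crossing α (p + 1) * (T.crossing α p * T.cap (p + 1)) =
      (α * α + d + α⁻¹ * α⁻¹) • T.cap (p + 1) + T.cap p := by
    simp only [crossing, hook, mul_add, add_mul, smul_mul_assoc, mul_smul_comm, smul_smul,
      mul_one, one_mul, mul_assoc, T.zig, T.zag, T.loop, add_smul, mul_inv_cancel_left₀ hα,
      inv_mul_cancel₀ hα, one_smul, smul_add]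
    abel
  rw [h, slide_coeff hα hd, zero_smul, zero_add]

end Slide

section Commute

variable {T}

theorem Loc.hook_left {n m : ℕ} {X : ℕ → E} (hX : T.Loc n m X) {p b : ℕ} (h : p + 2 ≤ b) :
    T.hook p * X b = X b * T.hook p := by
  obtain ⟨b, rfl⟩ : ∃ c, b = c + 2 := ⟨b - 2, by omega⟩
  rw [CupCap.hook, mul_assoc, hX.cup_left p b (by omega), ← mul_assoc,
    ← hX.cap_left p b (by omega), mul_assoc]

theorem Loc.hook_right {n m : ℕ} {X : ℕ → E} (hX : T.Loc n m X) (b q : ℕ) :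
    T.hook (b + n + q) * X b = X b * T.hook (b + m + q) := by
  rw [CupCap.hook, mul_assoc, hX.cup_right, ← mul_assoc, ← hX.cap_right, mul_assoc]
  rfl

variable (T)

theorem hook_comm {p q : ℕ} (h : p + 2 ≤ q) : T.hook p * T.hook q = T.hook q * T.hook p :=
  (Loc.hook T).hook_left h

theorem crossing_comm (α : K) {p q : ℕ} (h : p + 2 ≤ q) :
    T.crossing α p * T.crossing α q = T.crossing α q * T.crossing α p := by
  have := (Loc.crossing T α).hook_left h
  rw [crossing, add_mul, mul_add]
  simp only [smul_mul_assoc, mul_smul_comm, one_mul, mul_one, this]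

end Commute

section BandCrossing

variable {α : K} (hα : α ≠ 0) (hd : d = -α ^ 2 - (α ^ 2)⁻¹)

/-- The two middle crossings are disjoint. Each order exposes one of the two pairs of crossings that
an arc can be slid through. -/
theorem bandCrossing_eq (b : ℕ) : T.bandCrossing α b =
    T.crossing α (b + 1) * (T.crossing α (b + 2) * (T.crossing α b * T.crossing α (b + 1))) := by
  rw [bandCrossing, ← mul_assoc (T.crossing α b), T.crossing_comm α le_rfl, mul_assoc]

include hα hd

/-- The cut end of one band is an arc, and it slides past the two strands of the other band one
after the other. -/
theorem cup_bandCrossing (b : ℕ) : T.cup b * T.bandCrossing α b = T.cup (b + 2) := by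
  rw [bandCrossing, ← mul_assoc (T.crossing α (b + 1)), ← mul_assoc,
    T.cup_slide_right hα hd, T.cup_slide_right hα hd (b + 1)]

theorem cup_bandCrossing' (b : ℕ) : T.cup (b + 2) * T.bandCrossing α b = T.cup b := by
  rw [bandCrossing_eq, ← mul_assoc (T.crossing α (b + 1)), ← mul_assoc,
    T.cup_slide_left hα hd (b + 1), T.cup_slide_left hα hd]

theorem bandCrossing_cap (b : ℕ) : T.bandCrossing α b * T.cap b = T.cap (b + 2) := by
  rw [bandCrossing_eq, mul_assoc, mul_assoc, mul_assoc, T.slide_cap_right hα hd,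
    T.slide_cap_right hα hd (b + 1)]

theorem bandCrossing_cap' (b : ℕ) : T.bandCrossing α b * T.cap (b + 2) = T.cap b := by
  rw [bandCrossing, mul_assoc, mul_assoc, mul_assoc, T.slide_cap_left hα hd (b + 1),
    T.slide_cap_left hα hd]

/-- A cut follows its own band through the crossing: both halves of the cut retract across the other
band. -/
theorem hook_bandCrossing (b : ℕ) :
    T.hook b * T.bandCrossing α b = T.bandCrossing α b * T.hook (b + 2) := by
  rw [hook, hook, mul_assoc, T.cup_bandCrossing hα hd, ← mul_assoc,
    T.bandCrossing_cap' hα hd]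

theorem hook_bandCrossing' (b : ℕ) :
    T.hook (b + 2) * T.bandCrossing α b = T.bandCrossing α b * T.hook b := by
  rw [hook, hook, mul_assoc, T.cup_bandCrossing' hα hd, ← mul_assoc,
    T.bandCrossing_cap hα hd]

end BandCrossing

/-- With `bandCup_hook'`: cutting either leg of the band at a minimum leaves the same two arcs, so a
cut slides around the turn. -/
theorem bandCup_hook (b : ℕ) : T.bandCup b * T.hook b = T.cup b * T.cup b := by
  rw [bandCup, hook, mul_assoc, ← mul_assoc (T.cup (b + 1)), T.zag, one_mul]

theorem bandCup_hook' (b : ℕ) : T.bandCup b * T.hook (b + 2) = T.cup b * T.cup b := by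
  rw [bandCup, hook, mul_assoc, ← mul_assoc (T.cup (b + 1)), T.zig (b + 1), one_mul,
    ← T.cup_cup b b le_rfl]

theorem hook_bandCap (b : ℕ) : T.hook b * T.bandCap b = T.cap b * T.cap b := by
  rw [bandCap, hook, mul_assoc, ← mul_assoc (T.cup b), T.zig, one_mul]

theorem hook_bandCap' (b : ℕ) : T.hook (b + 2) * T.bandCap b = T.cap b * T.cap b := by
  rw [bandCap, hook, mul_assoc, ← mul_assoc (T.cup (b + 2)), T.zag (b + 1), one_mul,
    T.cap_cap b b le_rfl]

/-- The projection of the band of the strand `j` to its nontrivial part (`true`) or to its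
trivial part (`false`). -/
def proj (c : Bool) (j : ℕ) : E :=
  if c then 1 - d⁻¹ • T.hook (2 * j) else d⁻¹ • T.hook (2 * j)

theorem hook_sq (p : ℕ) : T.hook p * T.hook p = d • T.hook p := by
  rw [hook, mul_assoc, T.loop_assoc, mul_smul_comm]

theorem proj_sq (hd : d ≠ 0) (c : Bool) (j : ℕ) : T.proj c j * T.proj c j = T.proj c j := by
  have h : (d⁻¹ • T.hook (2 * j)) * (d⁻¹ • T.hook (2 * j)) = d⁻¹ • T.hook (2 * j) := by
    rw [smul_mul_assoc, mul_smul_comm, hook_sq, inv_smul_smul₀ hd]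
  cases c
  · simpa [proj] using h
  · simp only [proj, if_true, mul_sub, sub_mul, h, mul_one, one_mul]
    abel

theorem proj_intertwine {X : E} {c : Bool} {i j : ℕ}
    (h : T.hook (2 * i) * X = X * T.hook (2 * j)) :
    T.proj c i * X = X * T.proj c j := by
  cases c <;> simp [proj, sub_mul, mul_sub, h]

theorem proj_comm (c c' : Bool) (i j : ℕ) :
    T.proj c i * T.proj c' j = T.proj c' j * T.proj c i := by
  have h : T.hook (2 * i) * T.hook (2 * j) = T.hook (2 * j) * T.hook (2 * i) := by
    rcases lt_trichotomy i j with h | h | h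
    · exact T.hook_comm (by omega)
    · rw [h]
    · exact (T.hook_comm (by omega)).symm
  cases c <;> cases c' <;>
    simp [proj, sub_mul, mul_sub, h, smul_sub]
  abel

end CupCap
end ThetaCurve

namespace ThetaCurve

/-! ### Connection patterns -/

namespace Pattern

/-- Open two new strands at the place `p`. -/
def lift (p i : ℕ) : ℕ := if i < p then i else i + 2

/-- Forget the two strands at the place `p`. -/
def lower (p i : ℕ) : ℕ := if i < p then i else i - 2

/-- The connection pattern of infinitely many strands after a local minimum. -/
def cup (p : ℕ) (r : Setoid ℕ) : Setoid ℕ where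
  r i j := ((i = p ∨ i = p + 1) ∧ (j = p ∨ j = p + 1)) ∨
    (¬ (i = p ∨ i = p + 1) ∧ ¬ (j = p ∨ j = p + 1) ∧ r (lower p i) (lower p j))
  iseqv :=
    { refl := fun i => by
        by_cases h : i = p ∨ i = p + 1
        · exact Or.inl ⟨h, h⟩
        · exact Or.inr ⟨h, h, r.refl _⟩
      symm := by
        rintro i j (⟨h, h'⟩ | ⟨h, h', h''⟩)
        · exact Or.inl ⟨h', h⟩
        · exact Or.inr ⟨h', h, r.symm h''⟩
      trans := by
        rintro i j k (⟨h, h'⟩ | ⟨h, h', h''⟩) (⟨g, g'⟩ | ⟨g, g', g''⟩)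
        · exact Or.inl ⟨h, g'⟩
        · exact absurd h' g
        · exact absurd g h'
        · exact Or.inr ⟨h, g', r.trans h'' g''⟩ }

/-- The connection pattern of infinitely many strands after a local maximum. -/
def cap (p : ℕ) (r : Setoid ℕ) : Setoid ℕ where
  r i j := r (lift p i) (lift p j) ∨ (r (lift p i) p ∧ r (lift p j) (p + 1)) ∨
    (r (lift p i) (p + 1) ∧ r (lift p j) p)
  iseqv :=
    { refl := fun i => Or.inl (r.refl _)
      symm := by
        rintro i j (h | ⟨h, h'⟩ | ⟨h, h'⟩)
        · exact Or.inl (r.symm h)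
        · exact Or.inr (Or.inr ⟨h', h⟩)
        · exact Or.inr (Or.inl ⟨h', h⟩)
      trans := by
        have s := fun {a b : ℕ} => @Setoid.symm' ℕ r a b
        have t := fun {a b c : ℕ} => @Setoid.trans' ℕ r a b c
        rintro i j k (h | ⟨h, h'⟩ | ⟨h, h'⟩) (g | ⟨g, g'⟩ | ⟨g, g'⟩)
        · exact Or.inl (t h g)
        · exact Or.inr (Or.inl ⟨t h g, g'⟩)
        · exact Or.inr (Or.inr ⟨t h g, g'⟩)
        · exact Or.inr (Or.inl ⟨h, t (s g) h'⟩)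
        · exact Or.inl (t h (t (s g) (t h' (s g'))))
        · exact Or.inl (t h (s g'))
        · exact Or.inr (Or.inr ⟨h, t (s g) h'⟩)
        · exact Or.inl (t h (s g'))
        · exact Or.inl (t h (t (s g) (t h' (s g')))) }

theorem cup_apply (p : ℕ) (r : Setoid ℕ) (i j : ℕ) : cup p r i j ↔
    ((i = p ∨ i = p + 1) ∧ (j = p ∨ j = p + 1)) ∨
    (¬ (i = p ∨ i = p + 1) ∧ ¬ (j = p ∨ j = p + 1) ∧ r (lower p i) (lower p j)) := Iff.rfl

theorem cap_apply (p : ℕ) (r : Setoid ℕ) (i j : ℕ) : cap p r i j ↔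
    r (lift p i) (lift p j) ∨ (r (lift p i) p ∧ r (lift p j) (p + 1)) ∨
    (r (lift p i) (p + 1) ∧ r (lift p j) p) := Iff.rfl

theorem cap_cup (p : ℕ) (r : Setoid ℕ) : cap p (cup p r) = r := by
  ext i j
  simp only [cap_apply, cup_apply, lift, lower]
  grind

theorem cap_succ_cup (p : ℕ) (r : Setoid ℕ) : cap (p + 1) (cup p r) = r := by
  ext i j
  have h : r p p := r.refl p
  have s := fun {a b : ℕ} => @Setoid.symm' ℕ r a b
  simp only [cap_apply, cup_apply, lift, lower]
  rcases lt_trichotomy i p with hi | hi | hi <;> rcases lt_trichotomy j p with hj | hj | hj <;>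
    grind

theorem cap_cup_succ (p : ℕ) (r : Setoid ℕ) : cap p (cup (p + 1) r) = r := by
  ext i j
  have h : r p p := r.refl p
  have s := fun {a b : ℕ} => @Setoid.symm' ℕ r a b
  simp only [cap_apply, cup_apply, lift, lower]
  rcases lt_trichotomy i p with hi | hi | hi <;> rcases lt_trichotomy j p with hj | hj | hj <;>
    grind

theorem cup_cup {p q : ℕ} (h : p ≤ q) (r : Setoid ℕ) :
    cup p (cup q r) = cup (q + 2) (cup p r) := by
  ext i j
  simp only [cup_apply, lower]
  grind (splits := 30)

/-- Both sides restrict the equivalence relation generated by `r` and the pairs `(p, p + 1)`, `(q +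
2, q + 3)`; the order of joining does not matter. -/
theorem cap_cap {p q : ℕ} (h : p ≤ q) (r : Setoid ℕ) :
    cap p (cap (q + 2) r) = cap q (cap p r) := by
  ext i j
  have s := fun {a b : ℕ} => @Setoid.symm' ℕ r a b
  have t := fun {a b c : ℕ} => @Setoid.trans' ℕ r a b c
  have h1 : lift p q = q + 2 := by grind [lift]
  have h2 : lift p (q + 1) = q + 1 + 2 := by grind [lift]
  have h3 : lift (q + 2) p = p := by grind [lift]
  have h4 : lift (q + 2) (p + 1) = p + 1 := by grind [lift]
  have h5 : ∀ i, lift (q + 2) (lift p i) = lift p (lift q i) := by grind [lift]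
  simp only [cap_apply, h1, h2, h3, h4, h5]
  generalize lift p (lift q i) = x
  generalize lift p (lift q j) = y
  grind

/-- Two maxima close the same number of loops in either order. -/
theorem cap_cap_loop {p q : ℕ} (h : p ≤ q) (r : Setoid ℕ) :
    (r (q + 2) (q + 3) ∧ cap (q + 2) r p (p + 1) ∧ r p (p + 1) ∧ cap p r q (q + 1)) ∨
    (r (q + 2) (q + 3) ∧ ¬ cap (q + 2) r p (p + 1) ∧ ¬ r p (p + 1) ∧ cap p r q (q + 1)) ∨
    (¬ r (q + 2) (q + 3) ∧ cap (q + 2) r p (p + 1) ∧ r p (p + 1) ∧ ¬ cap p r q (q + 1)) ∨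
    (¬ r (q + 2) (q + 3) ∧ cap (q + 2) r p (p + 1) ∧ ¬ r p (p + 1) ∧ cap p r q (q + 1)) ∨
    (¬ r (q + 2) (q + 3) ∧ ¬ cap (q + 2) r p (p + 1) ∧ ¬ r p (p + 1) ∧ ¬ cap p r q (q + 1)) := by
  have s := fun {a b : ℕ} => @Setoid.symm' ℕ r a b
  have t := fun {a b c : ℕ} => @Setoid.trans' ℕ r a b c
  have h1 : lift p q = q + 2 := by grind [lift]
  have h2 : lift p (q + 1) = q + 3 := by grind [lift]
  have h3 : lift (q + 2) p = p := by grind [lift]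
  have h4 : lift (q + 2) (p + 1) = p + 1 := by grind [lift]
  simp only [cap_apply, h1, h2, h3, h4]
  have : q + 2 + 1 = q + 3 := rfl
  rw [this]
  generalize q + 3 = a at *
  generalize q + 2 = b at *
  generalize p + 1 = c at *
  grind

theorem cap_cup_right {p q : ℕ} (h : p ≤ q) (r : Setoid ℕ) :
    cap (q + 2) (cup p r) = cup p (cap q r) := by
  ext i j
  have h1 : ∀ i, (lift (q + 2) i = p ∨ lift (q + 2) i = p + 1) ↔ (i = p ∨ i = p + 1) := by
    grind [lift]
  have h2 : ∀ i, ¬ (i = p ∨ i = p + 1) → lower p (lift (q + 2) i) = lift q (lower p i) := by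
    grind [lift, lower]
  have h3 : ¬ (q + 2 = p ∨ q + 2 = p + 1) := by omega
  have h4 : ¬ (q + 2 + 1 = p ∨ q + 2 + 1 = p + 1) := by omega
  have h5 : lower p (q + 2) = q := by grind [lower]
  have h6 : lower p (q + 2 + 1) = q + 1 := by grind [lower]
  simp only [cap_apply, cup_apply, h1, h3, h4, h5, h6, not_false_eq_true, true_and, false_and,
    and_false, false_or]
  by_cases hi : i = p ∨ i = p + 1 <;> by_cases hj : j = p ∨ j = p + 1 <;>
    simp only [hi, hj, not_true_eq_false, not_false_eq_true, true_and, false_and,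
      and_false, false_or, or_false, h2, and_true]

theorem cap_cup_left {p q : ℕ} (h : p ≤ q) (r : Setoid ℕ) :
    cap p (cup (q + 2) r) = cup q (cap p r) := by
  ext i j
  have h1 : ∀ i, (lift p i = q + 2 ∨ lift p i = q + 2 + 1) ↔ (i = q ∨ i = q + 1) := by
    grind [lift]
  have h2 : ∀ i, ¬ (i = q ∨ i = q + 1) → lower (q + 2) (lift p i) = lift p (lower q i) := by
    grind [lift, lower]
  have h3 : ¬ (p = q + 2 ∨ p = q + 2 + 1) := by omega
  have h4 : ¬ (p + 1 = q + 2 ∨ p + 1 = q + 2 + 1) := by omega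
  have h5 : lower (q + 2) p = p := by grind [lower]
  have h6 : lower (q + 2) (p + 1) = p + 1 := by grind [lower]
  simp only [cap_apply, cup_apply, h1, h3, h4, h5, h6, not_false_eq_true, true_and, false_and,
    and_false, false_or]
  by_cases hi : i = q ∨ i = q + 1 <;> by_cases hj : j = q ∨ j = q + 1 <;>
    simp only [hi, hj, not_true_eq_false, not_false_eq_true, true_and, false_and,
      and_false, false_or, or_false, h2, and_true]

end Pattern

open Classical in
/-- Cups and caps as operators on the functions of a connection pattern; a closed loop counts as
the factor `d`. -/
noncomputable def patternCupCap {K : Type*} [Field K] (d : K) :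
    CupCap K (Module.End K (Setoid ℕ → K)) d where
  -- Operators act on functions by precomposition with the change of pattern. This reverses
  -- composition, so that the leftmost factor of a product is the lowest slice.
  cup p := LinearMap.funLeft K K (Pattern.cup p)
  cap p := LinearMap.pi fun r =>
    (if r p (p + 1) then d else 1) • LinearMap.proj (Pattern.cap p r)
  loop p := by
    ext F r
    have h : Pattern.cup p r p (p + 1) := by simp [Pattern.cup_apply]
    simp [LinearMap.funLeft, Pattern.cap_cup, h]
  zig p := by
    ext F r
    have h : ¬ Pattern.cup p r (p + 1) (p + 1 + 1) := by
      simp [Pattern.cup_apply]; omega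
    simp [LinearMap.funLeft, Pattern.cap_succ_cup, h]
  zag p := by
    ext F r
    have h : ¬ Pattern.cup (p + 1) r p (p + 1) := by
      simp [Pattern.cup_apply]; omega
    simp [LinearMap.funLeft, Pattern.cap_cup_succ, h]
  cup_cup p q h := by
    ext F r
    simp [LinearMap.funLeft, Pattern.cup_cup h]
  cap_cap p q h := by
    ext F r
    simp only [Module.End.mul_apply, LinearMap.pi_apply, LinearMap.smul_apply,
      LinearMap.proj_apply, smul_eq_mul, Pattern.cap_cap h, ← mul_assoc]
    congr 1
    -- In each of the listed cases the number of factors `d` is the same on both sides.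
    have := Pattern.cap_cap_loop h r
    grind
  cup_cap_right p q h := by
    ext F r
    have h1 : Pattern.cup p r (q + 2) (q + 2 + 1) ↔ r q (q + 1) := by
      have h5 : Pattern.lower p (q + 2) = q := by grind [Pattern.lower]
      have h6 : Pattern.lower p (q + 2 + 1) = q + 1 := by grind [Pattern.lower]
      rw [Pattern.cup_apply, h5, h6]
      grind
    simp only [LinearMap.funLeft_apply, Module.End.mul_apply, LinearMap.pi_apply,
      LinearMap.smul_apply, LinearMap.proj_apply, h1, Pattern.cap_cup_right h]
  cup_cap_left p q h := by
    ext F r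
    have h1 : Pattern.cup (q + 2) r p (p + 1) ↔ r p (p + 1) := by
      have h5 : Pattern.lower (q + 2) p = p := by grind [Pattern.lower]
      have h6 : Pattern.lower (q + 2) (p + 1) = p + 1 := by grind [Pattern.lower]
      rw [Pattern.cup_apply, h5, h6]
      grind
    simp only [LinearMap.funLeft_apply, Module.End.mul_apply, LinearMap.pi_apply,
      LinearMap.smul_apply, LinearMap.proj_apply, h1, Pattern.cap_cup_left h]

end ThetaCurve

namespace ThetaCurve

/-! ### Words of slices as operators -/

/-- The word `w` is a tangle diagram with `n` strands below and `m` strands above. -/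
def Valid : ℕ → List Slice → ℕ → Prop
  | n, [], m => n = m
  | n, ⟨p, .cup⟩ :: w, m => p ≤ n ∧ Valid (n + 2) w m
  | n, ⟨p, .cap⟩ :: w, m => p + 2 ≤ n ∧ Valid (n - 2) w m
  | n, ⟨p, .cross _⟩ :: w, m => p + 2 ≤ n ∧ Valid n w m

theorem Valid.append {n m l : ℕ} {u v : List Slice} (hu : Valid n u m) (hv : Valid m v l) :
    Valid n (u ++ v) l := by
  induction u generalizing n with
  | nil => exact (show n = m from hu) ▸ hv
  | cons x u ih =>
    obtain ⟨p, _ | _ | _⟩ := x <;> exact ⟨hu.1, ih hu.2⟩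

namespace CupCap

variable {K : Type*} {E : Type*} [Field K] [Ring E] [Algebra K E] {d : K} (T : CupCap K E d)

/-- The operator of a slice. -/
def slice (A : K) : Slice → E
  | ⟨p, .cup⟩ => T.cup p
  | ⟨p, .cap⟩ => T.cap p
  | ⟨p, .cross true⟩ => T.crossing A p
  | ⟨p, .cross false⟩ => T.crossing A⁻¹ p

/-- The operator of a word of slices. -/
def word (A : K) (w : List Slice) : E := (w.map (T.slice A)).prod

@[simp] theorem word_nil (A : K) : T.word A [] = 1 := rfl

@[simp] theorem word_cons (A : K) (x : Slice) (w : List Slice) :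
    T.word A (x :: w) = T.slice A x * T.word A w := by simp [word]

@[simp] theorem word_append (A : K) (u v : List Slice) :
    T.word A (u ++ v) = T.word A u * T.word A v := by simp [word]

end CupCap

/-! ### The bracket as a matrix coefficient -/

/-- The pattern `r` records which ends belong to the same arc of `s`. -/
structure Records (r : Setoid ℕ) (s : ArcState) : Prop where
  rel : ∀ i j, r i j ↔ i = j ∨ ∃ a, s.ends[i]? = some a ∧ s.ends[j]? = some a
  lt_fresh : ∀ a ∈ s.ends, a < s.fresh

theorem Records.cup {r : Setoid ℕ} {s : ArcState} (h : Records r s) {p : ℕ}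
    (hp : p ≤ s.ends.length) : Records (Pattern.cup p r) (s.cup p) := by
  constructor
  · intro i j
    have key : ∀ i, (s.cup p).ends[i]? =
        if i = p ∨ i = p + 1 then some s.fresh else s.ends[Pattern.lower p i]? := by
      intro i
      simp only [ArcState.cup, Pattern.lower]
      grind
    have hf : ∀ i, s.ends[i]? ≠ some s.fresh := fun i hi =>
      (h.lt_fresh _ (List.mem_of_getElem? hi)).ne rfl
    have inj : ∀ i j, ¬ (i = p ∨ i = p + 1) → ¬ (j = p ∨ j = p + 1) →
        Pattern.lower p i = Pattern.lower p j → i = j := by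
      grind [Pattern.lower]
    rw [Pattern.cup_apply, h.rel, key, key]
    by_cases hi : i = p ∨ i = p + 1 <;> by_cases hj : j = p ∨ j = p + 1
    · simp [hi, hj]
    · simp only [hi, hj, if_true, if_false]
      grind
    · simp only [hi, hj, if_true, if_false]
      grind
    · simp only [hi, hj, if_false]
      grind
  · intro a ha
    simp only [ArcState.cup, List.mem_append, List.mem_cons] at ha ⊢
    have := h.lt_fresh a
    have h1 := @List.mem_of_mem_take _ a p s.ends
    have h2 := @List.mem_of_mem_drop _ a p s.ends
    grind

/-- Renaming the arc `b` to `a` joins the two classes, as `Pattern.cap` does. A loop is closed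
exactly when the two ends already belonged to one arc, which is when the operator contributes the
factor `d`. -/
theorem Records.cap {r : Setoid ℕ} {s : ArcState} (h : Records r s) {p : ℕ}
    (hp : p + 2 ≤ s.ends.length) : Records (Pattern.cap p r) (s.cap p) ∧
      (s.cap p).loops = s.loops + (open Classical in if r p (p + 1) then 1 else 0) ∧
      (s.cap p).ends.length = s.ends.length - 2 := by
  obtain ⟨l, a, b, t, hl, he⟩ : ∃ l a b t, l.length = p ∧ s.ends = l ++ a :: b :: t :=
    ⟨s.ends.take p, s.ends[p], s.ends[p + 1], s.ends.drop (p + 2), by grind, by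
      rw [List.getElem_cons_drop, List.getElem_cons_drop, List.take_append_drop]⟩
  have hd : s.ends.drop p = a :: b :: t := by rw [he, ← hl, List.drop_left]
  have ht : s.ends.take p = l := by rw [he, ← hl, List.take_left]
  have key : ∀ i, (l ++ t)[i]? = s.ends[Pattern.lift p i]? := by
    intro i
    rw [he, Pattern.lift]
    by_cases hi : i < p
    · rw [if_pos hi, List.getElem?_append_left (by omega), List.getElem?_append_left (by omega)]
    · rw [if_neg hi, List.getElem?_append_right (by omega), List.getElem?_append_right (by omega),
        show i + 2 - l.length = i - l.length + 2 by omega]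
      rfl
  have ha : s.ends[p]? = some a := by grind
  have hb : s.ends[p + 1]? = some b := by grind
  have inj : ∀ i j, Pattern.lift p i = Pattern.lift p j → i = j := by grind [Pattern.lift]
  have ne : ∀ i, Pattern.lift p i ≠ p ∧ Pattern.lift p i ≠ p + 1 := by grind [Pattern.lift]
  have hr : r p (p + 1) ↔ a = b := by rw [h.rel, ha, hb]; grind
  have lt := h.lt_fresh
  simp only [ArcState.cap, hd, ht]
  by_cases hab : a = b
  · rw [if_pos hab, if_pos (hr.2 hab)]
    refine ⟨⟨fun i j => ?_, ?_⟩, rfl, by simp [he]; omega⟩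
    · rw [Pattern.cap_apply]
      simp only [h.rel, key, ha, hb]
      have := ne i
      have := ne j
      have := inj i j
      grind
    · simp only [he] at lt
      grind
  · rw [if_neg hab, if_neg (fun h => hab (hr.1 h))]
    refine ⟨⟨fun i j => ?_, ?_⟩, rfl, by simp [he]; omega⟩
    · rw [Pattern.cap_apply]
      simp only [h.rel, List.getElem?_map, key, ha, hb]
      have := ne i
      have := ne j
      have := inj i j
      grind
    · simp only [he] at lt
      grind

theorem patternCupCap_cup_apply {K : Type*} [Field K] (d : K) (p : ℕ) (F : Setoid ℕ → K)
    (r : Setoid ℕ) : (patternCupCap d).cup p F r = F (Pattern.cup p r) := rfl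

open Classical in
theorem patternCupCap_cap_apply {K : Type*} [Field K] (d : K) (p : ℕ) (F : Setoid ℕ → K)
    (r : Setoid ℕ) : (patternCupCap d).cap p F r =
      (if r p (p + 1) then d else 1) * F (Pattern.cap p r) := rfl

/-- The state sum and the operators expand crossings in the same way. They differ only in the
bookkeeping of loops: each closed loop is counted in `loops` on the left and appears as a factor `d`
of `cap` on the right. -/
theorem bracketFrom_eq {K : Type*} [Field K] {A d : K} (hd : d = -A ^ 2 - (A ^ 2)⁻¹)
    (hd0 : d ≠ 0) (w : List Slice) (s : ArcState) (r : Setoid ℕ) (h : Records r s)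
    (hv : Valid s.ends.length w 0) :
    bracketFrom A s w = d ^ ((s.loops : ℤ) - 1) * (patternCupCap d).word A w (fun _ => 1) r := by
  have hcup : ∀ (s : ArcState) p, p ≤ s.ends.length → (s.cup p).ends.length = s.ends.length + 2 := by
    intro s p hp
    simp [ArcState.cup]
    omega
  induction w generalizing s r with
  | nil => simp [bracketFrom, hd]
  | cons x w ih =>
    obtain ⟨p, _ | _ | o⟩ := x
    · rw [bracketFrom, ih _ _ (h.cup hv.1) (by rw [hcup s p hv.1]; exact hv.2)]
      rfl
    · obtain ⟨h1, h2, h3⟩ := h.cap hv.1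
      rw [bracketFrom, ih _ _ h1 (by rw [h3]; exact hv.2), h2]
      simp only [CupCap.word_cons, CupCap.slice, Module.End.mul_apply, patternCupCap_cap_apply]
      split_ifs
      · simp only [Nat.cast_add, Nat.cast_one, zpow_add₀ hd0, zpow_sub₀ hd0, zpow_one]
        field_simp
      · simp
    · obtain ⟨h1, h2, h3⟩ := h.cap hv.1
      have h4 : p ≤ (s.cap p).ends.length := by rw [h3]; have := hv.1; omega
      have e1 := ih _ _ h hv.2
      have e2 := ih _ _ (h1.cup h4) (by
        rw [hcup _ _ h4, h3, Nat.sub_add_cancel (by have := hv.1; omega)]; exact hv.2)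
      -- In the smoothing that turns back, only the maximum can close a loop.
      have e3 : ((s.cap p).cup p).loops = (s.cap p).loops := rfl
      rw [e3, h2] at e2
      cases o <;>
      · simp only [bracketFrom, CupCap.word_cons, CupCap.slice, Module.End.mul_apply, e1, e2]
        simp only [CupCap.crossing, CupCap.hook, LinearMap.add_apply, LinearMap.smul_apply,
          Pi.add_apply, Pi.smul_apply, Module.End.one_apply, Module.End.mul_apply, smul_eq_mul,
          inv_inv, patternCupCap_cup_apply, patternCupCap_cap_apply]
        split_ifs
        · simp only [Nat.cast_add, Nat.cast_one, zpow_add₀ hd0, zpow_sub₀ hd0, zpow_one]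
          field_simp
        · simp only [Nat.cast_add, Nat.cast_zero, add_zero]
          ring

end ThetaCurve

namespace ThetaCurve

/-! ### Colourings of the strands of a diagram -/

namespace ThetaPiece

/-- The colours `b` below and `t` above a piece agree along the edges, and vanish at `v₁`. -/
def Colouring (b t : List Bool) : ThetaPiece → Prop
  | cup _ _ => b = [] ∧ ∃ v, t = [v, v]
  | cap _ _ => (∃ v, b = [v, v]) ∧ t = []
  | cross _ _ _ => ∃ v v', b = [v, v'] ∧ t = [v', v]
  | source m _ => b = List.replicate (3 - m) false ∧ t = List.replicate m false
  | sink m _ => b.length = 3 - m ∧ t.length = m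

/-- The colours `b` below and `t` above a piece agree along the edges, and vanish at `v₁`, `v₂`. -/
def StrictColouring (b t : List Bool) : ThetaPiece → Prop
  | sink m _ => b = List.replicate (3 - m) false ∧ t = List.replicate m false
  | p => p.Colouring b t

end ThetaPiece

/-- The rows of colours `cs` satisfy the condition `P` at each piece of `w`. -/
def ColouredBy (P : ThetaPiece → List Bool → List Bool → Prop) :
    (ℕ → List Bool) → List ThetaSlice → Prop
  | _, [] => True
  | cs, x :: w => (∃ l b t r, l.length = x.left.length ∧ cs 0 = l ++ b ++ r ∧
      cs 1 = l ++ t ++ r ∧ P x.piece b t) ∧ ColouredBy P (fun k => cs (k + 1)) w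

/-- The number of coloured strands that run upwards minus the number of those that run
downwards. -/
def flux (s : List Strand) (c : List Bool) : ℤ :=
  ((s.zip c).map fun q => if q.2 then (if q.1.up then 1 else -1) else 0).sum

theorem flux_append {s : List Strand} {c : List Bool} (s' : List Strand) (c' : List Bool)
    (h : s.length = c.length) : flux (s ++ s') (c ++ c') = flux s c + flux s' c' := by
  simp [flux, List.zip_append h]

theorem ThetaPiece.Colouring.length_bot {p : ThetaPiece} {b t : List Bool}
    (h : p.Colouring b t) : p.bot.length = b.length ∧ p.top.length = t.length := by
  cases p with
  | cup => obtain ⟨rfl, v, rfl⟩ := h; simp [bot, top]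
  | cap => obtain ⟨⟨v, rfl⟩, rfl⟩ := h; simp [bot, top]
  | cross => obtain ⟨v, v', rfl, rfl⟩ := h; simp [bot, top]
  | source m k => obtain ⟨rfl, rfl⟩ := h; simp [bot, top]; omega
  | sink m k => obtain ⟨h1, h2⟩ := h; simp [bot, top, h1, h2]; omega

theorem flux_up (s : List Strand) (c : List Bool) (hs : ∀ x ∈ s, x.up = true)
    (h : s.length = c.length) : flux s c = c.count true := by
  induction s generalizing c with
  | nil => cases c <;> simp_all [flux]
  | cons x s ih =>
    cases c with
    | nil => simp at h
    | cons v c =>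
      have := ih c (fun y hy => hs y (List.mem_cons_of_mem _ hy)) (by simpa using h)
      have hx := hs x List.mem_cons_self
      cases v <;> simp_all [flux, List.count_cons]
      omega

theorem flux_down (s : List Strand) (c : List Bool) (hs : ∀ x ∈ s, x.up = false)
    (h : s.length = c.length) : flux s c = - c.count true := by
  induction s generalizing c with
  | nil => cases c <;> simp_all [flux]
  | cons x s ih =>
    cases c with
    | nil => simp at h
    | cons v c =>
      have := ih c (fun y hy => hs y (List.mem_cons_of_mem _ hy)) (by simpa using h)
      have hx := hs x List.mem_cons_self
      cases v <;> simp_all [flux, List.count_cons]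

theorem flux_replicate_false (s : List Strand) (n : ℕ) :
    flux s (List.replicate n false) = 0 := by
  induction n generalizing s with
  | zero => cases s <;> simp [flux]
  | succ n ih =>
    cases s with
    | nil => simp [flux]
    | cons x s => simpa [flux, List.replicate_succ] using ih s

/-- The flux is conserved at minima, maxima and crossings, and it is zero at the uncoloured `v₁`. At
`v₂` all lower legs run upwards and all upper legs run downwards, so the flux drops by the number of
coloured legs. -/
theorem ThetaPiece.Colouring.flux_le {p : ThetaPiece} {b t : List Bool} (h : p.Colouring b t) :
    flux p.top t ≤ flux p.bot b ∧ (flux p.top t = flux p.bot b → p.StrictColouring b t) := by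
  have hl := h.length_bot
  cases p with
  | cup i u =>
    obtain ⟨rfl, v, rfl⟩ := id h
    refine ⟨?_, fun _ => h⟩
    cases v <;> cases u <;> simp [flux, bot, top]
  | cap i u =>
    obtain ⟨⟨v, rfl⟩, rfl⟩ := id h
    refine ⟨?_, fun _ => h⟩
    cases v <;> cases u <;> simp [flux, bot, top]
  | cross o x y =>
    obtain ⟨v, v', rfl, rfl⟩ := id h
    refine ⟨?_, fun _ => h⟩
    simp [flux, bot, top, add_comm]
  | source m k =>
    obtain ⟨rfl, rfl⟩ := id h
    refine ⟨?_, fun _ => h⟩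
    rw [flux_replicate_false, flux_replicate_false]
  | sink m k =>
    rw [flux_down _ t (by grind [top]) hl.2, flux_up _ b (by grind [bot]) hl.1]
    refine ⟨by omega, fun e => ?_⟩
    have hb : b.count true = 0 := by omega
    have ht : t.count true = 0 := by omega
    rw [List.count_eq_zero] at hb ht
    refine ⟨List.eq_replicate_iff.2 ⟨h.1, ?_⟩, List.eq_replicate_iff.2 ⟨h.2, ?_⟩⟩
    · intro v hv
      cases v
      · rfl
      · exact absurd hv hb
    · intro v hv
      cases v
      · rfl
      · exact absurd hv ht

/-- A colouring that vanishes at `v₁` vanishes at `v₂`. -/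
theorem ColouredBy.strict {w : List ThetaSlice} {s : List Strand} {cs : ℕ → List Bool}
    (hw : Fits s w []) (h : ColouredBy (fun p b t => p.Colouring b t) cs w) :
    0 ≤ flux s (cs 0) ∧
      (flux s (cs 0) = 0 → ColouredBy (fun p b t => p.StrictColouring b t) cs w) := by
  induction w generalizing s cs with
  | nil =>
    obtain rfl : s = [] := hw
    exact ⟨by simp [flux], fun _ => trivial⟩
  | cons x w ih =>
    obtain ⟨⟨l, b, t, r, hl, h0, h1, hp⟩, h⟩ := h
    obtain ⟨rfl, hw⟩ := hw
    have := ih hw h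
    rw [zero_add, h1] at this
    have hlen := hp.length_bot
    have hf := hp.flux_le
    rw [flux_append _ _ (by simp [hl, hlen.2]), flux_append _ _ hl.symm] at this
    rw [h0, flux_append _ _ (by simp [hl, hlen.1]), flux_append _ _ hl.symm]
    -- The flux is nonincreasing upwards and ends at zero; if it also starts at zero, it drops
    -- nowhere.
    refine ⟨by omega, fun e => ⟨⟨l, b, t, r, hl, h0, h1, hf.2 (by omega)⟩, this.2 (by omega)⟩⟩

/-- Each end is labelled by an arc and a colour: the colour is constant on the arcs, and the
coloured arcs have two ends. -/
structure Tracks (s : ArcState) (z : List (ℕ × Bool)) : Prop where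
  ends : s.ends = z.map Prod.fst
  const : ∀ x ∈ z, ∀ y ∈ z, x.1 = y.1 → x.2 = y.2
  two : ∀ x ∈ z, x.2 = true → (z.map Prod.fst).count x.1 = 2
  lt_fresh : ∀ x ∈ z, x.1 < s.fresh

theorem count_rename {a b : ℕ} (hab : a ≠ b) (y : ℕ) (l : List ℕ) :
    (l.map fun c => if c = b then a else c).count y =
      if y = a then l.count a + l.count b else if y = b then 0 else l.count y := by
  induction l with
  | nil => simp
  | cons c l ih =>
    rw [List.map_cons, List.count_cons, ih]
    simp only [List.count_cons, beq_iff_eq]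
    split_ifs <;> omega

/-- A coloured arc has two ends and cannot stop at a vertex, because the legs there are uncoloured.
The only way to lose its last ends is a maximum joining them to each other, and this closes a loop.
-/
theorem Tracks.step {s : ArcState} {zl zb zr : List (ℕ × Bool)} {x : ThetaSlice} {t : List Bool}
    (h : Tracks s (zl ++ zb ++ zr)) (hl : zl.length = x.left.length)
    (hp : x.piece.StrictColouring (zb.map Prod.snd) t) :
    (x.trace s).loops = s.loops + 1 ∨ ((x.trace s).loops = s.loops ∧
      ∃ z, z.map Prod.snd = zl.map Prod.snd ++ t ++ zr.map Prod.snd ∧ Tracks (x.trace s) z ∧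
      (true ∈ (zl ++ zb ++ zr).map Prod.snd → true ∈ z.map Prod.snd)) := by
  obtain ⟨left, piece, right⟩ := x
  have hd : s.ends.drop left.length = (zb ++ zr).map Prod.fst := by
    simp only at hl
    rw [h.ends, List.append_assoc, List.map_append, List.drop_left' (by simp [hl])]
  have ht : s.ends.take left.length = zl.map Prod.fst := by
    simp only at hl
    rw [h.ends, List.append_assoc, List.map_append, List.take_left' (by simp [hl])]
  -- Both vertices are treated alike: the arcs that end there are uncoloured, and the new ones get
  -- the colour `false`.
  have vertex : ∀ m : Fin 4, zb.map Prod.snd = List.replicate (3 - m) false →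
      t = List.replicate m false →
      ∃ z, z.map Prod.snd = zl.map Prod.snd ++ t ++ zr.map Prod.snd ∧
      Tracks (s.vertex left.length (3 - m) m) z ∧
      (true ∈ (zl ++ zb ++ zr).map Prod.snd → true ∈ z.map Prod.snd) := by
    rintro m hb rfl
    have hbf : ∀ y ∈ zb, y.2 = false := fun y hy =>
      (List.mem_replicate.1 (hb ▸ List.mem_map_of_mem hy)).2
    have hbl : zb.length = 3 - m := by simpa using congrArg List.length hb
    refine ⟨zl ++ ((List.range m).map fun j => (s.fresh + j, false)) ++ zr, ?_, ⟨?_, ?_, ?_, ?_⟩, ?_⟩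
    · simp [List.map_const', Function.comp_def]
    · simp only [ArcState.vertex, ht]
      rw [← List.drop_drop, hd, List.map_append, List.drop_left' (by simp [hbl])]
      simp [Function.comp_def]
    · have h1 := h.const
      have h2 := h.lt_fresh
      simp only [List.mem_append, List.mem_map, List.mem_range] at h1 h2 ⊢
      grind
    · rintro y hy hyt
      have hyz : y ∈ zl ++ zb ++ zr := by
        simp only [List.mem_append, List.mem_map, List.mem_range] at hy ⊢
        grind
      have h1 := h.two y hyz hyt
      -- Colours are constant on arcs, so no uncoloured leg of the vertex belongs to the coloured
      -- arc of `y`.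
      have h2 : (zb.map Prod.fst).count y.1 = 0 := by
        rw [List.count_eq_zero, List.mem_map]
        rintro ⟨u, hu, e⟩
        have := h.const u (by simp [hu]) y hyz e
        rw [hbf u hu, hyt] at this
        simp at this
      have h3 : (((List.range m).map fun j => ((s.fresh + j, false) : ℕ × Bool)).map
          Prod.fst).count y.1 = 0 := by
        have := h.lt_fresh y hyz
        rw [List.count_eq_zero]
        simp only [List.mem_map, List.mem_range]
        grind
      simp only [List.map_append, List.count_append] at h1 h3 ⊢
      omega
    · have h2 := h.lt_fresh
      simp only [List.mem_append, List.mem_map, List.mem_range, ArcState.vertex] at h2 ⊢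
      grind
    · simp only [List.mem_append, List.mem_map, List.mem_range]
      grind
  cases piece with
  | cup i u =>
    obtain ⟨hb, v, rfl⟩ := hp
    obtain rfl : zb = [] := by simpa using hb
    refine Or.inr ⟨rfl, zl ++ [(s.fresh, v), (s.fresh, v)] ++ zr, by simp, ⟨?_, ?_, ?_, ?_⟩, ?_⟩
    · simp [ThetaSlice.trace, ArcState.cup, hd, ht]
    · have h1 := h.const
      have h2 := h.lt_fresh
      simp only [List.mem_append, List.mem_cons, List.not_mem_nil] at h1 h2 ⊢
      grind
    · rintro y hy hyt
      have hn : (zl.map Prod.fst).count s.fresh = 0 ∧ (zr.map Prod.fst).count s.fresh = 0 := by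
        have h2 := h.lt_fresh
        simp only [List.count_eq_zero, List.mem_map, List.mem_append, List.not_mem_nil] at h2 ⊢
        grind
      by_cases hyf : y.1 = s.fresh
      · simp [hyf, hn, List.count_cons]
      · have hyz : y ∈ zl ++ [] ++ zr := by
          simp only [List.mem_append, List.mem_cons, List.not_mem_nil] at hy ⊢
          grind
        have h1 := h.two y hyz hyt
        simp only [List.map_append, List.count_append, List.map_cons, List.count_cons,
          List.map_nil, List.count_nil, beq_iff_eq] at h1 ⊢
        rw [if_neg (Ne.symm hyf)]
        omega
    · have h2 := h.lt_fresh
      simp only [List.mem_append, List.mem_cons, List.not_mem_nil, ThetaSlice.trace,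
        ArcState.cup] at h2 ⊢
      grind
    · simp only [List.mem_append, List.mem_map, List.mem_cons]
      grind
  | cap i u =>
    obtain ⟨⟨v, hb⟩, rfl⟩ := hp
    obtain ⟨a, b, rfl⟩ : ∃ a b, zb = [(a, v), (b, v)] := by
      match zb, hb with
      | [(a, _), (b, _)], hb => exact ⟨a, b, by simpa using hb⟩
    simp only [ThetaSlice.trace, ArcState.cap, hd, ht]
    by_cases hab : a = b
    · left
      simp [hab]
    right
    simp only [List.cons_append, List.nil_append, List.map_cons, if_neg hab, true_and]
    -- If two different coloured arcs meet at the maximum, each has exactly one more end elsewhere.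
    -- These are the two ends of the joined arc, and the colour survives.
    have hv : v = true → (∃ x ∈ zl ++ zr, x.2 = true) ∧
        ((zl ++ zr).map Prod.fst).count a = 1 ∧ ((zl ++ zr).map Prod.fst).count b = 1 := by
      intro hv
      have h1 := h.two (a, v) (by simp) hv
      have h2 := h.two (b, v) (by simp) hv
      simp only [List.map_append, List.count_append, List.map_cons, List.count_cons,
        List.map_nil, List.count_nil, beq_iff_eq] at h1 h2 ⊢
      rw [if_neg (Ne.symm hab)] at h1
      rw [if_neg hab] at h2
      simp only [if_true] at h1 h2
      refine ⟨?_, by omega, by omega⟩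
      have : a ∈ (zl ++ zr).map Prod.fst := by
        rw [← List.count_pos_iff, List.map_append, List.count_append]
        omega
      obtain ⟨y, hy, e⟩ := List.mem_map.1 this
      refine ⟨y, hy, ?_⟩
      rw [← hv]
      refine h.const y ?_ (a, v) (by simp) e
      simp only [List.mem_append] at hy ⊢
      tauto
    refine ⟨(zl ++ zr).map fun q => (if q.1 = b then a else q.1, q.2), ?_, ⟨?_, ?_, ?_, ?_⟩, ?_⟩
    · simp [Function.comp_def]
    · simp [Function.comp_def]
    · intro x hx y hy e
      obtain ⟨q, hq, rfl⟩ := List.mem_map.1 hx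
      obtain ⟨q', hq', rfl⟩ := List.mem_map.1 hy
      have mem : ∀ q ∈ zl ++ zr, q ∈ zl ++ [(a, v), (b, v)] ++ zr := by
        intro q hq
        simp only [List.mem_append] at hq ⊢
        tauto
      have c1 := h.const q (mem q hq) q' (mem q' hq')
      have c2 := h.const q (mem q hq) (a, v) (by simp)
      have c3 := h.const q (mem q hq) (b, v) (by simp)
      have c4 := h.const q' (mem q' hq') (a, v) (by simp)
      have c5 := h.const q' (mem q' hq') (b, v) (by simp)
      simp only at e c1 c2 c3 c4 c5 ⊢
      split_ifs at e <;> simp_all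
    · intro y hy hyt
      obtain ⟨q, hq, rfl⟩ := List.mem_map.1 hy
      have hqz : q ∈ zl ++ [(a, v), (b, v)] ++ zr := by
        simp only [List.mem_append] at hq ⊢
        tauto
      have h2 := h.two q hqz hyt
      have e : (((zl ++ zr).map fun q : ℕ × Bool => (if q.1 = b then a else q.1, q.2)).map
          Prod.fst) = ((zl ++ zr).map Prod.fst).map fun c => if c = b then a else c := by
        simp [Function.comp_def]
      rw [e, count_rename hab]
      have ha : q.1 = a → v = true := fun e =>
        (h.const q hqz (a, v) (by simp) e).symm.trans hyt
      have hb : q.1 = b → v = true := fun e =>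
        (h.const q hqz (b, v) (by simp) e).symm.trans hyt
      simp only [List.map_append, List.count_append, List.map_cons, List.count_cons,
        List.map_nil, List.count_nil, beq_iff_eq] at h2 hv ⊢
      grind
    · intro y hy
      obtain ⟨q, hq, rfl⟩ := List.mem_map.1 hy
      have h1 := h.lt_fresh (a, v) (by simp)
      have h2 := h.lt_fresh q (by simp only [List.mem_append] at hq ⊢; tauto)
      simp only at h1 h2 ⊢
      split_ifs <;> assumption
    · simp only [List.mem_append, List.mem_map, List.mem_cons, List.not_mem_nil] at hv ⊢
      rintro ⟨q, hq, hqt⟩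
      obtain ⟨y, hy, hyt⟩ : ∃ y, (y ∈ zl ∨ y ∈ zr) ∧ y.2 = true := by
        rcases hq with (hq | rfl | rfl | hq) | hq
        · exact ⟨q, Or.inl hq, hqt⟩
        · exact (hv hqt).1
        · exact (hv hqt).1
        · exact hq.elim
        · exact ⟨q, Or.inr hq, hqt⟩
      exact ⟨_, ⟨y, hy, rfl⟩, hyt⟩
  | cross o y z =>
    obtain ⟨v, v', hb, rfl⟩ := hp
    obtain ⟨a, b, rfl⟩ : ∃ a b, zb = [(a, v), (b, v')] := by
      match zb, hb with
      | [(a, _), (b, _)], hb => exact ⟨a, b, by simpa using hb⟩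
    right
    have hs : s.swap left.length = ⟨zl.map Prod.fst ++ b :: a :: zr.map Prod.fst, s.fresh,
        s.loops⟩ := by
      simp [ArcState.swap, hd, ht]
    simp only [ThetaSlice.trace, hs, true_and]
    have hm : ∀ q, q ∈ zl ++ [(b, v'), (a, v)] ++ zr ↔ q ∈ zl ++ [(a, v), (b, v')] ++ zr := by
      simp only [List.mem_append, List.mem_cons, List.not_mem_nil]
      tauto
    refine ⟨zl ++ [(b, v'), (a, v)] ++ zr, by simp, ⟨by simp, ?_, ?_, ?_⟩, ?_⟩
    · intro p hp q hq
      exact h.const p ((hm p).1 hp) q ((hm q).1 hq)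
    · intro p hp ht
      have := h.two p ((hm p).1 hp) ht
      simp only [List.map_append, List.count_append, List.map_cons, List.count_cons,
        List.map_nil, List.count_nil] at this ⊢
      omega
    · intro p hp
      exact h.lt_fresh p ((hm p).1 hp)
    · simp only [List.mem_map, hm]
      exact id
  | source m k =>
    exact Or.inr ⟨rfl, vertex m hp.1 hp.2⟩
  | sink m k =>
    exact Or.inr ⟨rfl, vertex m hp.1 hp.2⟩

theorem ThetaSlice.loops_le_trace (s : ArcState) (x : ThetaSlice) :
    s.loops ≤ (x.trace s).loops := by
  obtain ⟨l, _ | _ | _ | _ | _, r⟩ := x <;>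
    simp only [trace, ArcState.cup, ArcState.cap, ArcState.swap, ArcState.vertex] <;>
    repeat' split
  all_goals simp

theorem loops_le_foldl (w : List ThetaSlice) (s : ArcState) :
    s.loops ≤ (w.foldl ThetaSlice.trace s).loops := by
  induction w generalizing s with
  | nil => exact le_rfl
  | cons x w ih => exact (x.loops_le_trace s).trans (ih _)

/-- In a diagram without closed components, a colouring that vanishes at the vertices vanishes. -/
theorem ColouredBy.not_mem {w : List ThetaSlice} {cs : ℕ → List Bool} {s : ArcState}
    {z : List (ℕ × Bool)} (h : ColouredBy (fun p b t => p.StrictColouring b t) cs w)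
    (hz : Tracks s z) (hc : cs 0 = z.map Prod.snd)
    (hl : (w.foldl ThetaSlice.trace s).loops = s.loops) (hend : true ∉ cs w.length) :
    ∀ k ≤ w.length, true ∉ cs k := by
  induction w generalizing cs s z with
  | nil =>
    intro k hk
    obtain rfl : k = 0 := by simpa using hk
    exact hend
  | cons x w ih =>
    obtain ⟨⟨l, b, t, r, hlen, h0, h1, hp⟩, h⟩ := h
    rw [hc] at h0
    obtain ⟨zlb, zr, rfl, hlb, rfl⟩ := List.map_eq_append_iff.1 h0
    obtain ⟨zl, zb, rfl, rfl, rfl⟩ := List.map_eq_append_iff.1 hlb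
    have hmono := loops_le_foldl w (x.trace s)
    rw [List.foldl_cons] at hl
    rcases hz.step (by simpa using hlen) hp with h2 | ⟨h2, z', hz', ht, himp⟩
    · omega
    have := ih h ht (by rw [zero_add, h1, hz']) (by rw [hl, h2]) hend
    rintro (_ | k) hk
    · rw [hc]
      intro hm
      have h3 := this 0 (Nat.zero_le _)
      rw [zero_add, h1, ← hz'] at h3
      exact h3 (himp hm)
    · exact this k (by simpa using hk)

end ThetaCurve

namespace ThetaCurve

namespace CupCap

variable {K : Type*} {E : Type*} [Field K] [Ring E] [Algebra K E] {d : K} (T : CupCap K E d)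

/-! ### Operators of the pieces of a theta-curve -/

/-- The boundary of the thickened vertex with `m` legs above and `3 - m` legs below. -/
def vertex (m : Fin 4) (b : ℕ) : E :=
  match m with
  | 0 => T.cap (b + 1) * (T.cap (b + 1) * T.cap b)
  | 1 => T.cap (b + 1)
  | 2 => T.cup (b + 1)
  | 3 => T.cup b * (T.cup (b + 1) * T.cup (b + 3))

/-- The band of a piece. -/
def bandOp (A : K) : ThetaPiece → ℕ → E
  | .cup _ _ => T.bandCup
  | .cap _ _ => T.bandCap
  | .cross true _ _ => T.bandCrossing A
  | .cross false _ _ => T.bandCrossing A⁻¹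
  | .source m _ => T.vertex m
  | .sink m _ => T.vertex m

theorem Loc.vertex (m : Fin 4) : T.Loc (2 * (3 - m)) (2 * m) (T.vertex m) := by
  have c0 := Loc.cap T
  have c1 := (Loc.cap T).pad_left 1
  have u1 := (Loc.cup T).pad_left 1
  match m with
  | 0 => exact (c1.pad_right 3).mul ((c1.pad_right 1).mul c0)
  | 1 => exact c1.pad_right 1
  | 2 => exact u1.pad_right 1
  | 3 => exact (Loc.cup T).mul ((u1.pad_right 1).mul (((Loc.cup T).pad_left 3).pad_right 1))

theorem Loc.bandOp (A : K) (p : ThetaPiece) :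
    T.Loc (2 * p.bot.length) (2 * p.top.length) (T.bandOp A p) := by
  cases p with
  | cup => exact Loc.bandCup T
  | cap => exact Loc.bandCap T
  | cross o => cases o <;> exact Loc.bandCrossing T _
  | source m k =>
    have h1 : (ThetaPiece.source m k).bot.length = 3 - m := by simp [ThetaPiece.bot]
    have h2 : (ThetaPiece.source m k).top.length = m := by simp [ThetaPiece.top]; omega
    rw [h1, h2]
    exact Loc.vertex T m
  | sink m k =>
    have h1 : (ThetaPiece.sink m k).bot.length = 3 - m := by simp [ThetaPiece.bot]
    have h2 : (ThetaPiece.sink m k).top.length = m := by simp [ThetaPiece.top]; omega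
    rw [h1, h2]
    exact Loc.vertex T m

theorem length_sides (s : List Strand) : (sides s).length = 2 * s.length := by
  induction s with
  | nil => rfl
  | cons x s ih => simp [sides] at ih ⊢; omega

theorem word_band (A : K) (x : ThetaSlice) :
    T.word A (x.band.map LabelledSlice.forget) = T.bandOp A x.piece (2 * x.left.length) := by
  obtain ⟨l, p, r⟩ := x
  cases p with
  | cup i u =>
    simp [ThetaSlice.band, LabelledSlice.forget, slice, length_sides, bandOp, bandCup]
  | cap i u =>
    simp [ThetaSlice.band, LabelledSlice.forget, slice, length_sides, bandOp, bandCap]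
  | cross o y z =>
    cases o <;>
      simp [ThetaSlice.band, LabelledSlice.forget, slice, length_sides, bandOp, bandCrossing]
  | source m k =>
    fin_cases m <;>
      simp [ThetaSlice.band, LabelledSlice.forget, slice, length_sides, bandOp, vertex,
        vertexBand, ThetaPiece.bot, ThetaPiece.top]
  | sink m k =>
    fin_cases m <;>
      simp [ThetaSlice.band, LabelledSlice.forget, slice, length_sides, bandOp, vertex,
        vertexBand, ThetaPiece.bot, ThetaPiece.top]

/-! ### Marked diagrams -/

/-- The product of the projections of a list of coloured strands. -/
def marks (l : List (Bool × ℕ)) : E := (l.map fun q => T.proj q.1 q.2).prod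

/-- The operator of the thickened diagram with the projections `μ k` inserted below the slice
number `k`. -/
def marked (A : K) : (ℕ → List (Bool × ℕ)) → List ThetaSlice → E
  | μ, [] => T.marks (μ 0)
  | μ, x :: w => T.marks (μ 0) *
      (T.bandOp A x.piece (2 * x.left.length) * marked A (fun k => μ (k + 1)) w)

@[simp] theorem marks_nil : T.marks [] = 1 := rfl

@[simp] theorem marks_cons (q : Bool × ℕ) (l : List (Bool × ℕ)) :
    T.marks (q :: l) = T.proj q.1 q.2 * T.marks l := by simp [marks]

@[simp] theorem marks_append (l l' : List (Bool × ℕ)) :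
    T.marks (l ++ l') = T.marks l * T.marks l' := by simp [marks]

theorem proj_marks_comm (c : Bool) (j : ℕ) (l : List (Bool × ℕ)) :
    T.proj c j * T.marks l = T.marks l * T.proj c j := by
  induction l with
  | nil => simp
  | cons q l ih => rw [marks_cons, ← mul_assoc, proj_comm, mul_assoc, ih, mul_assoc]

theorem marks_comm (l l' : List (Bool × ℕ)) : T.marks l * T.marks l' = T.marks l' * T.marks l := by
  induction l with
  | nil => simp
  | cons q l ih => rw [marks_cons, mul_assoc, ih, ← mul_assoc, proj_marks_comm, mul_assoc]

theorem proj_mul_marks (hd : d ≠ 0) {q : Bool × ℕ} {l : List (Bool × ℕ)} (h : q ∈ l) :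
    T.proj q.1 q.2 * T.marks l = T.marks l := by
  induction l with
  | nil => simp at h
  | cons q' l ih =>
    rcases List.mem_cons.1 h with rfl | h
    · rw [marks_cons, ← mul_assoc, T.proj_sq hd]
    · rw [marks_cons, ← mul_assoc, proj_comm, mul_assoc, ih h]

theorem marked_update_zero (A : K) (μ : ℕ → List (Bool × ℕ)) (w : List ThetaSlice)
    (l : List (Bool × ℕ)) :
    T.marked A (Function.update μ 0 (l ++ μ 0)) w = T.marks l * T.marked A μ w := by
  cases w <;> simp [marked, mul_assoc]

theorem marked_update_succ (A : K) (μ : ℕ → List (Bool × ℕ)) (x : ThetaSlice)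
    (w : List ThetaSlice) (k : ℕ) (l : List (Bool × ℕ)) :
    T.marked A (Function.update μ (k + 1) l) (x :: w) = T.marks (μ 0) *
      (T.bandOp A x.piece (2 * x.left.length) *
        T.marked A (Function.update (fun k => μ (k + 1)) k l) w) := by
  have h : (fun j => Function.update μ (k + 1) l (j + 1)) =
      Function.update (fun k => μ (k + 1)) k l := by
    funext j
    by_cases h : j = k <;> simp [Function.update_apply, h]
  rw [marked, h, Function.update_of_ne (Nat.succ_ne_zero k).symm]

theorem marked_congr (A : K) {μ μ' : ℕ → List (Bool × ℕ)} {w : List ThetaSlice}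
    (h : ∀ k ≤ w.length, T.marks (μ k) = T.marks (μ' k)) : T.marked A μ w = T.marked A μ' w := by
  induction w generalizing μ μ' with
  | nil => exact h 0 le_rfl
  | cons x w ih =>
    rw [marked, marked, h 0 (Nat.zero_le _), ih fun k hk => h (k + 1) (by simpa using hk)]

end CupCap

/-! ### Absorption of marks along an edge. -/

/-- The strands below the slice number `k`, if the strands `s` are below the first one. -/
def rowAt : List Strand → List ThetaSlice → ℕ → List Strand
  | s, _, 0 => s
  | _, [], _ + 1 => []
  | _, x :: w, k + 1 => rowAt (x.left ++ x.piece.top ++ x.right) w k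

theorem rowAt_length {s : List Strand} {w : List ThetaSlice} {t : List Strand}
    (h : Fits s w t) : rowAt s w w.length = t := by
  induction w generalizing s with
  | nil => exact h
  | cons x w ih => exact ih h.2

/-- The legs of the edge `i` at the vertex `v₁` are among the marks, with the colour `c`. -/
def MarksSource (c : Bool) (i : Fin 3) : (ℕ → List (Bool × ℕ)) → List ThetaSlice → Prop
  | _, [] => True
  | μ, x :: w => (x.piece.isSource = true →
      (∀ j y, x.piece.bot[j]? = some y → y.edge = i → (c, j + x.left.length) ∈ μ 0) ∧
      (∀ j y, x.piece.top[j]? = some y → y.edge = i → (c, j + x.left.length) ∈ μ 1)) ∧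
    MarksSource c i (fun k => μ (k + 1)) w

theorem MarksSource.mono {c : Bool} {i : Fin 3} {μ μ' : ℕ → List (Bool × ℕ)}
    {w : List ThetaSlice} (h : MarksSource c i μ w) (hμ : ∀ k, μ k ⊆ μ' k) :
    MarksSource c i μ' w := by
  induction w generalizing μ μ' with
  | nil => trivial
  | cons x w ih =>
    exact ⟨fun hx => ⟨fun j y hj hy => hμ 0 ((h.1 hx).1 j y hj hy),
      fun j y hj hy => hμ 1 ((h.1 hx).2 j y hj hy)⟩, ih h.2 fun k => hμ (k + 1)⟩

namespace CupCap

variable {K : Type*} {E : Type*} [Field K] [Ring E] [Algebra K E] {d : K} (T : CupCap K E d)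

open Classical in
/-- The strands of the edge `i` for which a mark of the colour `c` changes the value. -/
noncomputable def visible (A : K) (c : Bool) (i : Fin 3) (a X : E) (μ : ℕ → List (Bool × ℕ))
    (s : List Strand) (w : List ThetaSlice) (k : ℕ) : List Bool :=
  (rowAt s w k).mapIdx fun j y => decide (y.edge = i ∧
    a * T.marked A (Function.update μ k ([(c, j)] ++ μ k)) w ≠ X)

/-- At each piece a mark can be moved from one end of a strand to the other without changing the
value, so visibility is the same at both ends. At `v₁` the legs of the edge already carry this mark
and idempotence makes a second one invisible. Nothing is claimed at `v₂`. The factor `a` collects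
the slices already passed, and `X` is the fixed total value. -/
theorem visible_colouring {A : K} (hA : A ≠ 0) (hA' : d = -A ^ 2 - (A ^ 2)⁻¹) (hd : d ≠ 0)
    {c : Bool} {i : Fin 3} {a X : E} {μ : ℕ → List (Bool × ℕ)} {s : List Strand}
    {w : List ThetaSlice} {t : List Strand} (hw : Fits s w t) (hX : a * T.marked A μ w = X)
    (hs : MarksSource c i μ w) :
    ColouredBy (fun p b t => p.Colouring b t) (T.visible A c i a X μ s w) w := by
  classical
  induction w generalizing s μ a with
  | nil => trivial
  | cons x w ih =>
    obtain ⟨rfl, hw⟩ := hw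
    obtain ⟨hs0, hs⟩ := hs
    obtain ⟨left, piece, right⟩ := x
    simp only at hs0 hw
    set Y := a * T.marks (μ 0) with hY
    set O := T.bandOp A piece (2 * left.length) with hO
    set Z := T.marked A (fun k => μ (k + 1)) w with hZ
    have hX' : Y * O * Z = X := by rw [← hX, hY, hO, hZ, marked]; simp only [mul_assoc]
    have e0 : ∀ j, a * T.marked A (Function.update μ 0 ([(c, j)] ++ μ 0))
        (⟨left, piece, right⟩ :: w) = Y * (T.proj c j * O) * Z := by
      intro j
      rw [marked_update_zero, marked, hY, mul_assoc a (T.marks (μ 0)),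
        ← mul_assoc (T.marks (μ 0)) (T.proj c j), ← proj_marks_comm]
      simp [mul_assoc]
      rfl
    have e1 : ∀ j, a * T.marked A (Function.update μ 1 ([(c, j)] ++ μ 1))
        (⟨left, piece, right⟩ :: w) = Y * (O * T.proj c j) * Z := by
      intro j
      rw [show 1 = 0 + 1 from rfl, marked_update_succ]
      rw [show μ (0 + 1) = (fun k => μ (k + 1)) 0 from rfl, marked_update_zero]
      simp [mul_assoc, hY, hO, hZ]
    have f0 : T.visible A c i a X μ (left ++ piece.bot ++ right) (⟨left, piece, right⟩ :: w) 0 =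
        (left ++ piece.bot ++ right).mapIdx fun j y => decide (y.edge = i ∧
          Y * (T.proj c j * O) * Z ≠ X) := by
      simp only [visible, rowAt, e0]
    have f1 : T.visible A c i a X μ (left ++ piece.bot ++ right) (⟨left, piece, right⟩ :: w) 1 =
        (left ++ piece.top ++ right).mapIdx fun j y => decide (y.edge = i ∧
          Y * (O * T.proj c j) * Z ≠ X) := by
      simp only [visible, rowAt, e1]
    have hloc := Loc.bandOp T A piece
    refine ⟨⟨left.mapIdx fun j y => decide (y.edge = i ∧ Y * (T.proj c j * O) * Z ≠ X),
      piece.bot.mapIdx fun j y => decide (y.edge = i ∧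
        Y * (T.proj c (j + left.length) * O) * Z ≠ X),
      piece.top.mapIdx fun j y => decide (y.edge = i ∧
        Y * (O * T.proj c (j + left.length)) * Z ≠ X),
      right.mapIdx fun j y => decide (y.edge = i ∧
        Y * (T.proj c (j + (left ++ piece.bot).length) * O) * Z ≠ X), ?_, ?_, ?_, ?_⟩, ?_⟩
    · simp
    · rw [f0, List.mapIdx_append, List.mapIdx_append]
    · rw [f1, List.mapIdx_append, List.mapIdx_append]
      congr 1
      · congr 1
        refine List.ext_getElem (by simp) fun j h1 h2 => ?_
        simp only [List.getElem_mapIdx]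
        rw [T.proj_intertwine (hloc.hook_left (p := 2 * j) (by simp at h1; omega))]
      · refine List.ext_getElem (by simp) fun j h1 h2 => ?_
        simp only [List.getElem_mapIdx]
        -- To the right of the piece a strand changes its number, since the piece may have different
        -- numbers of lower and upper legs.
        rw [T.proj_intertwine (j := j + (left ++ piece.top).length)]
        have := hloc.hook_right (2 * left.length) (2 * j)
        convert this using 2 <;> congr 1 <;> simp only [List.length_append] <;> ring
    · simp only
      cases piece with
      | cup e u =>
        refine ⟨rfl, decide (e = i ∧ Y * (O * T.proj c (1 + left.length)) * Z ≠ X), ?_⟩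
        have : O * T.proj c (0 + left.length) = O * T.proj c (1 + left.length) := by
          have h := (T.bandCup_hook (2 * left.length)).trans
            (T.bandCup_hook' (2 * left.length)).symm
          have h2 : 2 * left.length + 2 = 2 * (1 + left.length) := by ring
          rw [h2] at h
          cases c <;> simp [proj, mul_sub, hO, bandOp, h]
        simp only [ThetaPiece.top, List.mapIdx_cons, List.mapIdx_nil, zero_add] at this ⊢
        rw [this]
      | cap e u =>
        refine ⟨⟨decide (e = i ∧ Y * (T.proj c (1 + left.length) * O) * Z ≠ X), ?_⟩, rfl⟩
        have : T.proj c (0 + left.length) * O = T.proj c (1 + left.length) * O := by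
          have h := (T.hook_bandCap (2 * left.length)).trans
            (T.hook_bandCap' (2 * left.length)).symm
          have h2 : 2 * left.length + 2 = 2 * (1 + left.length) := by ring
          rw [h2] at h
          cases c <;> simp [proj, sub_mul, hO, bandOp, h]
        simp only [ThetaPiece.bot, List.mapIdx_cons, List.mapIdx_nil, zero_add] at this ⊢
        rw [this]
      | cross o y z =>
        -- The opposite crossing is the same expression in `A⁻¹`, and `d` is invariant under `A ↦
        -- A⁻¹`; both kinds are handled at once.
        have key : ∃ α : K, α ≠ 0 ∧ d = -α ^ 2 - (α ^ 2)⁻¹ ∧ O = T.bandCrossing α (2 * left.length)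
            := by
          cases o
          · exact ⟨A⁻¹, inv_ne_zero hA, by rw [hA']; simp; ring, rfl⟩
          · exact ⟨A, hA, hA', rfl⟩
        obtain ⟨α, hα, hα', hOα⟩ := key
        have h2 : 2 * left.length + 2 = 2 * (1 + left.length) := by ring
        have h3 : T.proj c (0 + left.length) * O = O * T.proj c (1 + left.length) := by
          rw [hOα]
          refine T.proj_intertwine ?_
          rw [zero_add, ← h2]
          exact T.hook_bandCrossing hα hα' _
        have h4 : T.proj c (1 + left.length) * O = O * T.proj c (0 + left.length) := by
          rw [hOα]
          refine T.proj_intertwine ?_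
          rw [zero_add, ← h2]
          exact T.hook_bandCrossing' hα hα' _
        refine ⟨decide (y.edge = i ∧ Y * (T.proj c (0 + left.length) * O) * Z ≠ X),
          decide (z.edge = i ∧ Y * (T.proj c (1 + left.length) * O) * Z ≠ X), ?_, ?_⟩
        · simp only [ThetaPiece.bot, List.mapIdx_cons, List.mapIdx_nil, zero_add]
        · simp only [ThetaPiece.top, List.mapIdx_cons, List.mapIdx_nil, zero_add] at h3 h4 ⊢
          rw [h3, h4]
      | source m e =>
        have hs0 := hs0 rfl
        refine ⟨List.eq_replicate_iff.2 ⟨?_, ?_⟩, List.eq_replicate_iff.2 ⟨?_, ?_⟩⟩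
        · simp [ThetaPiece.bot]
        · intro v hv
          obtain ⟨j, hj, rfl⟩ := List.mem_mapIdx.1 hv
          rw [decide_eq_false_iff_not]
          rintro ⟨he, hne⟩
          refine hne ?_
          rw [← e0, marked_update_zero, ← hX]
          congr 1
          have hm := hs0.1 j _ (List.getElem?_eq_getElem hj) he
          rw [marked, ← mul_assoc]
          congr 1
          simpa using T.proj_mul_marks hd hm
        · simp [ThetaPiece.top]; omega
        · intro v hv
          obtain ⟨j, hj, rfl⟩ := List.mem_mapIdx.1 hv
          rw [decide_eq_false_iff_not]
          rintro ⟨he, hne⟩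
          refine hne ?_
          have hm := hs0.2 j _ (List.getElem?_eq_getElem hj) he
          have hm' : T.proj c (j + left.length) * Z = Z := by
            rw [hZ]
            have := T.proj_mul_marks hd hm
            cases w <;> simp only [marked] <;> [exact this; rw [← mul_assoc, this]]
          rw [← hX', mul_assoc Y, mul_assoc O, hm', ← mul_assoc]
      | sink m e =>
        refine ⟨?_, ?_⟩
        · simp [ThetaPiece.bot]
        · simp [ThetaPiece.top]; omega
    -- The slice just treated moves into the prefix; the total value `X` stays the same.
    · have := ih (a := Y * O) hw (by rw [hX']) hs
      convert this using 1
      funext k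
      simp only [visible, rowAt]
      congr 1
      funext j y
      rw [marked_update_succ, hY, hO]
      simp only [mul_assoc]

variable {A : K} (hA : A ≠ 0) (hA' : d = -A ^ 2 - (A ^ 2)⁻¹) (hd : d ≠ 0) (D : ThetaDiagram)
include hA hA' hd

/-- Once the legs of an edge at `v₁` are marked, further marks on the edge change nothing. -/
theorem marked_absorb {c : Bool} {i : Fin 3} {μ : ℕ → List (Bool × ℕ)}
    (hs : MarksSource c i μ D.slices) {k : ℕ} (hk : k ≤ D.slices.length) {j : ℕ} {y : Strand}
    (hj : (rowAt [] D.slices k)[j]? = some y) (hy : y.edge = i) :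
    T.marked A (Function.update μ k ([(c, j)] ++ μ k)) D.slices = T.marked A μ D.slices := by
  classical
  have h := T.visible_colouring hA hA' hd D.fits (one_mul (T.marked A μ D.slices)) hs
  have h0 : T.visible A c i 1 (T.marked A μ D.slices) μ [] D.slices 0 = [] := by
    simp [visible, rowAt]
  -- The lowest row is empty, so the flux starts at zero and the colouring vanishes at `v₂` too.
  have h1 := (h.strict D.fits).2 (by rw [h0]; rfl)
  have h2 := h1.not_mem (s := ArcState.empty) (z := [])
    ⟨rfl, by simp, by simp, by simp⟩ h0 D.no_loop
    (by simp [visible, rowAt_length D.fits]) k hk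
  by_contra hne
  refine h2 (List.mem_mapIdx.2 ⟨j, (List.getElem?_eq_some_iff.1 hj).1, ?_⟩)
  rw [(List.getElem?_eq_some_iff.1 hj).2]
  simpa [hy] using hne

/-- The marks at the rows of the diagram `D` agree with the colours `χ` of the edges. -/
def _root_.ThetaCurve.AgreesWith (D : ThetaDiagram) (χ : Fin 3 → Option Bool)
    (μ : ℕ → List (Bool × ℕ)) : Prop :=
  ∀ k, ∀ q ∈ μ k, ∃ y, (rowAt [] D.slices k)[q.2]? = some y ∧ χ y.edge = some q.1

/-- Marks are added one at a time; the marks at `v₁` needed for `marked_absorb` persist because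
marks are only added. -/
theorem marked_absorb_row {χ : Fin 3 → Option Bool} {μ : ℕ → List (Bool × ℕ)}
    (hs : ∀ i c, χ i = some c → MarksSource c i μ D.slices) {k : ℕ} (hk : k ≤ D.slices.length)
    (l : List (Bool × ℕ))
    (hl : ∀ q ∈ l, ∃ y, (rowAt [] D.slices k)[q.2]? = some y ∧ χ y.edge = some q.1) :
    T.marked A (Function.update μ k (l ++ μ k)) D.slices = T.marked A μ D.slices := by
  induction l with
  | nil => simp
  | cons q l ih =>
    rw [← ih fun q hq => hl q (List.mem_cons_of_mem _ hq)]
    obtain ⟨y, hy, hc⟩ := hl q List.mem_cons_self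
    have hsub : ∀ k', μ k' ⊆ Function.update μ k (l ++ μ k) k' := by
      intro k'
      by_cases h : k' = k
      · subst h; simp
      · simp [Function.update_of_ne h]
    have := T.marked_absorb hA hA' hd D ((hs _ _ hc).mono hsub) hk hy rfl
    simpa using this

theorem marked_absorb_all {χ : Fin 3 → Option Bool} {μ μ' : ℕ → List (Bool × ℕ)}
    (hs : ∀ i c, χ i = some c → MarksSource c i μ D.slices) (h' : AgreesWith D χ μ') :
    T.marked A (fun k => μ' k ++ μ k) D.slices = T.marked A μ D.slices := by
  -- The rows with number less than `K` have received the additional marks; one row is added at a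
  -- time.
  have key : ∀ K ≤ D.slices.length + 1,
      T.marked A (fun k => if k < K then μ' k ++ μ k else μ k) D.slices =
        T.marked A μ D.slices := by
    intro K hK
    induction K with
    | zero => simp
    | succ K ih =>
      rw [← ih (by omega)]
      set ν : ℕ → List (Bool × ℕ) := fun k => if k < K then μ' k ++ μ k else μ k with hν
      have e : (fun k => if k < K + 1 then μ' k ++ μ k else μ k) =
          Function.update ν K (μ' K ++ ν K) := by
        funext k
        rcases lt_trichotomy k K with h | rfl | h
        · simp [hν, Function.update_of_ne h.ne, h, h.trans (Nat.lt_succ_self K)]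
        · simp [hν]
        · have h1 : ¬ k < K := by omega
          have h2 : ¬ k < K + 1 := by omega
          simp [hν, Function.update_of_ne h.ne', h1, h2]
      rw [e]
      refine T.marked_absorb_row hA hA' hd D (χ := χ) (fun i c h => (hs i c h).mono ?_)
        (by omega) _ (h' K)
      intro k
      simp only [hν]
      split_ifs <;> simp
  rw [← key _ le_rfl]
  refine T.marked_congr A fun k hk => ?_
  rw [if_pos (by omega)]

/-- The value depends only on the colours of the edges. -/
theorem marked_eq {χ : Fin 3 → Option Bool} {μ μ' : ℕ → List (Bool × ℕ)}
    (hs : ∀ i c, χ i = some c → MarksSource c i μ D.slices) (h : AgreesWith D χ μ)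
    (hs' : ∀ i c, χ i = some c → MarksSource c i μ' D.slices) (h' : AgreesWith D χ μ') :
    T.marked A μ D.slices = T.marked A μ' D.slices := by
  -- Both sides equal the value with the two families of marks together, each family absorbing the
  -- other.
  rw [← T.marked_absorb_all hA hA' hd D hs h', ← T.marked_absorb_all hA hA' hd D hs' h]
  refine T.marked_congr A fun k _ => ?_
  rw [marks_append, marks_append, marks_comm]

end CupCap
end ThetaCurve

namespace ThetaCurve

/-! ### Marks at the pieces -/

/-- The marks of the strands `s`, of which the first has the number `n`, with the colours `g`. -/
def legMarks (g : Strand → Option Bool) : ℕ → List Strand → List (Bool × ℕ)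
  | _, [] => []
  | n, y :: s => (match g y with
    | some c => [(c, n)]
    | none => []) ++ legMarks g (n + 1) s

theorem mem_legMarks {g : Strand → Option Bool} {s : List Strand} {n : ℕ} {q : Bool × ℕ} :
    q ∈ legMarks g n s ↔ ∃ j y, s[j]? = some y ∧ g y = some q.1 ∧ q.2 = j + n := by
  induction s generalizing n with
  | nil => simp [legMarks]
  | cons y s ih =>
    rw [legMarks, List.mem_append, ih]
    constructor
    · rintro (h | ⟨j, y', h1, h2, h3⟩)
      · refine ⟨0, y, rfl, ?_⟩
        cases hg : g y with
        | none => simp [hg] at h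
        | some c =>
          obtain rfl : q = (c, n) := by simpa [hg] using h
          simp
      · exact ⟨j + 1, y', by simpa using h1, h2, by omega⟩
    · rintro ⟨_ | j, y', h1, h2, h3⟩
      · left
        obtain rfl : y = y' := by simpa using h1
        rw [h2]
        simp only [List.mem_singleton]
        ext
        · rfl
        · simpa using h3
      · exact Or.inr ⟨j, y', by simpa using h1, h2, by omega⟩

/-- Marks `m` on the first row, and marks `bot x` below and `top x` above each slice `x`. -/
def nodeMarks (bot top : ThetaSlice → List (Bool × ℕ)) :
    List (Bool × ℕ) → List ThetaSlice → ℕ → List (Bool × ℕ)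
  | m, [], 0 => m
  | _, [], _ + 1 => []
  | m, x :: _, 0 => m ++ bot x
  | _, x :: w, k + 1 => nodeMarks bot top (top x) w k

/-- The marks of the lower legs of a slice. -/
def botMarks (g : Strand → Option Bool) (x : ThetaSlice) : List (Bool × ℕ) :=
  legMarks g x.left.length x.piece.bot

/-- The marks of the upper legs of a slice. -/
def topMarks (g : Strand → Option Bool) (x : ThetaSlice) : List (Bool × ℕ) :=
  legMarks g x.left.length x.piece.top

theorem nodeMarks_mem {P : Bool → Strand → Prop} {bot top : ThetaSlice → List (Bool × ℕ)}
    (hbot : ∀ x, ∀ q ∈ bot x, ∃ y, (x.left ++ x.piece.bot ++ x.right)[q.2]? = some y ∧ P q.1 y)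
    (htop : ∀ x, ∀ q ∈ top x, ∃ y, (x.left ++ x.piece.top ++ x.right)[q.2]? = some y ∧ P q.1 y)
    {s t : List Strand} {w : List ThetaSlice} (hw : Fits s w t) {m : List (Bool × ℕ)}
    (hm : ∀ q ∈ m, ∃ y, s[q.2]? = some y ∧ P q.1 y) (k : ℕ) :
    ∀ q ∈ nodeMarks bot top m w k, ∃ y, (rowAt s w k)[q.2]? = some y ∧ P q.1 y := by
  induction w generalizing s m k with
  | nil =>
    cases k with
    | zero => exact hm
    | succ k => simp [nodeMarks]
  | cons x w ih =>
    obtain ⟨rfl, hw⟩ := hw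
    cases k with
    | zero =>
      intro q hq
      rcases List.mem_append.1 hq with h | h
      · exact hm q h
      · exact hbot x q h
    | succ k => exact ih hw (htop x) k

theorem nodeMarks_source {bot top : ThetaSlice → List (Bool × ℕ)} {c : Bool} {i : Fin 3}
    {g : Strand → Option Bool} (hbot : ∀ x, x.piece.isSource = true → botMarks g x ⊆ bot x)
    (htop : ∀ x, x.piece.isSource = true → topMarks g x ⊆ top x)
    (hgb : ∀ x : ThetaSlice, x.piece.isSource = true → ∀ y ∈ x.piece.bot,
      y.edge = i → g y = some c)
    (hgt : ∀ x : ThetaSlice, x.piece.isSource = true → ∀ y ∈ x.piece.top,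
      y.edge = i → g y = some c)
    (m : List (Bool × ℕ)) (w : List ThetaSlice) : MarksSource c i (nodeMarks bot top m w) w := by
  induction w generalizing m with
  | nil => trivial
  | cons x w ih =>
    refine ⟨fun hx => ⟨fun j y hj hy => ?_, fun j y hj hy => ?_⟩, ih (top x)⟩
    · exact List.mem_append_right _ (hbot x hx (mem_legMarks.2
        ⟨j, y, hj, hgb x hx y (List.mem_of_getElem? hj) hy, rfl⟩))
    · have h : (c, j + x.left.length) ∈ top x := htop x hx (mem_legMarks.2
        ⟨j, y, hj, hgt x hx y (List.mem_of_getElem? hj) hy, rfl⟩)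
      cases w with
      | nil => exact h
      | cons x' w => exact List.mem_append_left _ h

theorem botMarks_mem {P : Bool → Strand → Prop} {g : Strand → Option Bool} {x : ThetaSlice}
    (h : ∀ y c, g y = some c → P c y) : ∀ q ∈ botMarks g x,
      ∃ y, (x.left ++ x.piece.bot ++ x.right)[q.2]? = some y ∧ P q.1 y := by
  intro q hq
  obtain ⟨j, y, h1, h2, h3⟩ := mem_legMarks.1 hq
  refine ⟨y, ?_, h y _ h2⟩
  have := (List.getElem?_eq_some_iff.1 h1).1
  rw [h3, List.append_assoc, List.getElem?_append_right (by omega),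
    List.getElem?_append_left (by omega), Nat.add_sub_cancel, h1]

theorem topMarks_mem {P : Bool → Strand → Prop} {g : Strand → Option Bool} {x : ThetaSlice}
    (h : ∀ y c, g y = some c → P c y) : ∀ q ∈ topMarks g x,
      ∃ y, (x.left ++ x.piece.top ++ x.right)[q.2]? = some y ∧ P q.1 y := by
  intro q hq
  obtain ⟨j, y, h1, h2, h3⟩ := mem_legMarks.1 hq
  refine ⟨y, ?_, h y _ h2⟩
  have := (List.getElem?_eq_some_iff.1 h1).1
  rw [h3, List.append_assoc, List.getElem?_append_right (by omega),
    List.getElem?_append_left (by omega), Nat.add_sub_cancel, h1]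

/-- The colours of the outgoing strands with the given direction, all being nontrivial. -/
def barColour (u : Bool) (y : Strand) : Option Bool := if y.up = u then some true else none

namespace CupCap

variable {K : Type*} {E : Type*} [Field K] [Ring E] [Algebra K E] {d : K} (T : CupCap K E d)

/-- The operator of a slice with marks of the colours `g` on its legs. -/
def markedSlice (A : K) (bot top : ThetaSlice → List (Bool × ℕ)) (x : ThetaSlice) : E :=
  T.marks (bot x) * (T.bandOp A x.piece (2 * x.left.length) * T.marks (top x))

theorem marked_nodeMarks (A : K) (bot top : ThetaSlice → List (Bool × ℕ)) (m : List (Bool × ℕ))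
    (w : List ThetaSlice) : T.marked A (nodeMarks bot top m w) w =
      T.marks m * (w.map (T.markedSlice A bot top)).prod := by
  induction w generalizing m with
  | nil => simp [marked, nodeMarks]
  | cons x w ih =>
    rw [marked, show (fun k => nodeMarks bot top m (x :: w) (k + 1)) = nodeMarks bot top (top x) w
      from rfl, ih]
    simp [nodeMarks, markedSlice, mul_assoc]

/-- The diagram with all legs at `v₁` marked by the colours `χ` of the edges. -/
def sourceMarked (A : K) (χ : Fin 3 → Option Bool) (w : List ThetaSlice) : E :=
  (w.map (T.markedSlice A
    (fun x => if x.piece.isSource then botMarks (fun y => χ y.edge) x else [])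
    (fun x => if x.piece.isSource then topMarks (fun y => χ y.edge) x else []))).prod

/-- The diagram with all legs of all pieces marked by the colours `χ` of the edges. -/
def fullyMarked (A : K) (χ : Fin 3 → Option Bool) (w : List ThetaSlice) : E :=
  (w.map (T.markedSlice A (botMarks fun y => χ y.edge) (topMarks fun y => χ y.edge))).prod

/-- The diagram with the outgoing legs at the crossings and vertices marked. -/
def barMarked (A : K) (w : List ThetaSlice) : E :=
  (w.map (T.markedSlice A
    (fun x => if x.isNode then botMarks (barColour false) x else [])
    (fun x => if x.isNode then topMarks (barColour true) x else []))).prod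

section

variable {A : K} (hA : A ≠ 0) (hA' : d = -A ^ 2 - (A ^ 2)⁻¹) (hd : d ≠ 0) (D : ThetaDiagram)
include hA hA' hd

theorem nodeMarked_eq {χ : Fin 3 → Option Bool} {bot top bot' top' : ThetaSlice → List (Bool × ℕ)}
    (hbot : ∀ x, ∀ q ∈ bot x, ∃ y, (x.left ++ x.piece.bot ++ x.right)[q.2]? = some y ∧
      χ y.edge = some q.1)
    (htop : ∀ x, ∀ q ∈ top x, ∃ y, (x.left ++ x.piece.top ++ x.right)[q.2]? = some y ∧
      χ y.edge = some q.1)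
    (hbot' : ∀ x, ∀ q ∈ bot' x, ∃ y, (x.left ++ x.piece.bot ++ x.right)[q.2]? = some y ∧
      χ y.edge = some q.1)
    (htop' : ∀ x, ∀ q ∈ top' x, ∃ y, (x.left ++ x.piece.top ++ x.right)[q.2]? = some y ∧
      χ y.edge = some q.1)
    (hs : ∀ i c, χ i = some c → MarksSource c i (nodeMarks bot top [] D.slices) D.slices)
    (hs' : ∀ i c, χ i = some c → MarksSource c i (nodeMarks bot' top' [] D.slices) D.slices) :
    (D.slices.map (T.markedSlice A bot top)).prod =
      (D.slices.map (T.markedSlice A bot' top')).prod := by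
  have h := T.marked_eq hA hA' hd D hs
    (nodeMarks_mem (P := fun c y => χ y.edge = some c) hbot htop D.fits (by simp)) hs'
    (nodeMarks_mem (P := fun c y => χ y.edge = some c) hbot' htop' D.fits (by simp))
  simpa [marked_nodeMarks] using h

/-- Marks at `v₁` suffice for the expansion of the idempotents, but a cut edge is removed slice by
slice, which needs a mark on it at every piece. -/
theorem sourceMarked_eq_fullyMarked (χ : Fin 3 → Option Bool) :
    T.sourceMarked A χ D.slices = T.fullyMarked A χ D.slices := by
  refine T.nodeMarked_eq hA hA' hd D (χ := χ) (fun x q hq => ?_) (fun x q hq => ?_)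
    (fun x => botMarks_mem (P := fun c y => χ y.edge = some c) fun _ _ => id)
    (fun x => topMarks_mem (P := fun c y => χ y.edge = some c) fun _ _ => id)
    (fun i c h => nodeMarks_source (g := fun y => χ y.edge) (fun x hx => by simp [hx])
      (fun x hx => by simp [hx]) (fun _ _ y _ hy => hy ▸ h) (fun _ _ y _ hy => hy ▸ h) _ _)
    (fun i c h => nodeMarks_source (g := fun y => χ y.edge) (fun x hx => by simp)
      (fun x hx => by simp) (fun _ _ y _ hy => hy ▸ h) (fun _ _ y _ hy => hy ▸ h) _ _)
  · split_ifs at hq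
    · exact botMarks_mem (P := fun c y => χ y.edge = some c) (fun _ _ => id) q hq
    · simp at hq
  · split_ifs at hq
    · exact topMarks_mem (P := fun c y => χ y.edge = some c) (fun _ _ => id) q hq
    · simp at hq

/-- Every edge leaves `v₁`, so all legs at `v₁` are outgoing and carry a bar. These bars absorb all
the others. -/
theorem barMarked_eq_sourceMarked :
    T.barMarked A D.slices = T.sourceMarked A (fun _ => some true) D.slices := by
  have hb : ∀ u y c, barColour u y = some c → (fun _ => some true : Fin 3 → _) y.edge = some c := by
    intro u y c h
    unfold barColour at h
    split_ifs at h
    exact h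
  have hn : ∀ x : ThetaSlice, x.piece.isSource = true → x.isNode = true := by
    rintro ⟨l, _ | _ | _ | _ | _, r⟩ h <;> simp_all [ThetaPiece.isSource, ThetaSlice.isNode]
  have hbot : ∀ x : ThetaSlice, x.piece.isSource = true → ∀ y ∈ x.piece.bot, y.up = false := by
    rintro ⟨l, _ | _ | _ | _ | _, r⟩ h <;> simp [ThetaPiece.isSource] at h
    rintro y hy
    simp only [ThetaPiece.bot, List.mem_map] at hy
    obtain ⟨_, _, rfl⟩ := hy
    rfl
  have htop : ∀ x : ThetaSlice, x.piece.isSource = true → ∀ y ∈ x.piece.top, y.up = true := by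
    rintro ⟨l, _ | _ | _ | _ | _, r⟩ h <;> simp [ThetaPiece.isSource] at h
    rintro y hy
    simp only [ThetaPiece.top, List.mem_map] at hy
    obtain ⟨_, _, rfl⟩ := hy
    rfl
  have legs : ∀ u n s, (∀ y ∈ s, y.up = u) →
      legMarks (barColour u) n s = legMarks (fun _ => some true) n s := by
    intro u n s hs
    induction s generalizing n with
    | nil => rfl
    | cons y s ih =>
      rw [legMarks, legMarks, ih _ fun y hy => hs y (List.mem_cons_of_mem _ hy), barColour,
        if_pos (hs y List.mem_cons_self)]
  refine T.nodeMarked_eq hA hA' hd D (χ := fun _ => some true) (fun x q hq => ?_)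
    (fun x q hq => ?_) (fun x q hq => ?_) (fun x q hq => ?_)
    (fun i c h => nodeMarks_source (g := fun _ => some true) (fun x hx => ?_)
      (fun x hx => ?_) (fun _ _ y _ hy => h) (fun _ _ y _ hy => h) _ _)
    (fun i c h => nodeMarks_source (g := fun _ => some true) (fun x hx => by simp [hx])
      (fun x hx => by simp [hx]) (fun _ _ y _ hy => h) (fun _ _ y _ hy => h) _ _)
  · split_ifs at hq
    · exact botMarks_mem (P := fun c _ => some true = some c) (hb _) q hq
    · simp at hq
  · split_ifs at hq
    · exact topMarks_mem (P := fun c _ => some true = some c) (hb _) q hq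
    · simp at hq
  · split_ifs at hq
    · exact botMarks_mem (P := fun c _ => some true = some c) (fun _ _ => id) q hq
    · simp at hq
  · split_ifs at hq
    · exact topMarks_mem (P := fun c _ => some true = some c) (fun _ _ => id) q hq
    · simp at hq
  · rw [if_pos (hn x hx), botMarks, botMarks, legs _ _ _ (hbot x hx)]
    exact List.Subset.refl _
  · rw [if_pos (hn x hx), topMarks, topMarks, legs _ _ _ (htop x hx)]
    exact List.Subset.refl _

end

/-! ### Resolution of the vertex -/

theorem cup_mul_hook (b q : ℕ) (h : b ≤ q) : T.cup b * T.hook (q + 2) = T.hook q * T.cup b :=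
  (Loc.hook T).cup_left b q h

theorem cup_hook_self (b : ℕ) : T.cup b * T.hook b = d • T.cup b := by
  rw [hook, loop_assoc]

theorem vertex_two_hook (b : ℕ) : T.vertex 2 b * T.hook b = T.cup b := by
  rw [vertex, hook, zag_assoc]

theorem vertex_two_hook' (b : ℕ) : T.vertex 2 b * T.hook (b + 2) = T.cup (b + 2) := by
  rw [vertex, hook, T.zig_assoc (b + 1)]

theorem vertex_three_hook (b : ℕ) : T.vertex 3 b * T.hook b = T.bandCup b * T.cup b := by
  have h : T.cup (b + 3) * T.hook b = T.hook b * T.cup (b + 3) :=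
    (Loc.hook T).cup_right b 1
  rw [vertex, mul_assoc, mul_assoc, h, ← mul_assoc (T.cup (b + 1)), hook,
    ← mul_assoc (T.cup (b + 1)), T.zag, one_mul, ← T.cup_cup b (b + 1) (by omega), bandCup,
    mul_assoc]

theorem vertex_three_hook' (b : ℕ) :
    T.vertex 3 b * T.hook (b + 2) = T.bandCup b * T.cup (b + 2) := by
  rw [vertex, hook, mul_assoc, mul_assoc, T.zag_assoc (b + 2), bandCup, mul_assoc]

theorem vertex_three_hook'' (b : ℕ) :
    T.vertex 3 b * T.hook (b + 4) = T.bandCup b * T.cup (b + 4) := by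
  rw [vertex, hook, mul_assoc, mul_assoc, T.zig_assoc (b + 3), bandCup, mul_assoc]

theorem cup_vertex_zero (b : ℕ) : T.cup b * T.vertex 0 b = T.bandCap b := by
  rw [vertex, T.zig_assoc, bandCap]

theorem cup_vertex_zero' (b : ℕ) : T.cup (b + 2) * T.vertex 0 b = T.bandCap b := by
  rw [vertex, T.zag_assoc (b + 1), bandCap]

theorem cup_vertex_zero'' (b : ℕ) : T.cup (b + 4) * T.vertex 0 b = T.bandCap b := by
  have h : T.cup (b + 4) * T.cap (b + 1) = T.cap (b + 1) * T.cup (b + 2) :=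
    T.cup_cap_left (b + 1) (b + 2) (by omega)
  rw [vertex, ← mul_assoc, h, mul_assoc, T.zag_assoc (b + 1), bandCap]

theorem cup_vertex_one (b : ℕ) : T.cup b * T.vertex 1 b = 1 := T.zig b

theorem cup_vertex_one' (b : ℕ) : T.cup (b + 2) * T.vertex 1 b = 1 := T.zag (b + 1)

end CupCap
end ThetaCurve

namespace ThetaCurve
namespace CupCap

variable {K : Type*} {E : Type*} [Field K] [Ring E] [Algebra K E] {d : K} (T : CupCap K E d)

theorem proj_false_eq (n j : ℕ) : T.proj false (n + j) = d⁻¹ • T.hook (2 * n + 2 * j) := by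
  simp [proj, mul_add]

theorem proj_true (j : ℕ) : T.proj true j = 1 - T.proj false j := by simp [proj]

theorem cup_three_hook (b : ℕ) :
    T.cup b * (T.cup b * (T.cup b * T.hook (b + 4))) = d • (T.cup b * (T.cup b * T.cup b)) := by
  rw [T.cup_mul_hook b (b + 2) (by omega), ← mul_assoc (T.cup b) (T.hook (b + 2)),
    T.cup_mul_hook b b le_rfl, ← mul_assoc, ← mul_assoc, cup_hook_self]
  simp [mul_assoc]

theorem cup_cup_self (b : ℕ) : T.cup b * T.cup (b + 2) = T.cup b * T.cup b :=
  (T.cup_cup b b le_rfl).symm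

theorem cup_two_hook (b : ℕ) :
    T.cup b * (T.cup b * T.hook (b + 2)) = d • (T.cup b * T.cup b) := by
  rw [T.cup_mul_hook b b le_rfl, ← mul_assoc, cup_hook_self, smul_mul_assoc]

/-- With the two statements below: cutting any two of the three bands at a vertex leaves three
separate ends, so the third band is cut as well. -/
theorem vertex_three_pair (b : ℕ) :
    T.vertex 3 b * T.hook b * T.hook (b + 2) = T.cup b * (T.cup b * T.cup b) := by
  rw [vertex_three_hook, mul_assoc, T.cup_mul_hook b b le_rfl, ← mul_assoc, bandCup_hook,
    mul_assoc]

theorem vertex_three_pair' (b : ℕ) :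
    T.vertex 3 b * T.hook b * T.hook (b + 4) = T.cup b * (T.cup b * T.cup b) := by
  rw [vertex_three_hook, mul_assoc, T.cup_mul_hook b (b + 2) (by omega), ← mul_assoc,
    bandCup_hook', mul_assoc]

theorem vertex_three_pair'' (b : ℕ) :
    T.vertex 3 b * T.hook (b + 2) * T.hook (b + 4) = T.cup b * (T.cup b * T.cup b) := by
  rw [vertex_three_hook', mul_assoc, T.cup_mul_hook (b + 2) (b + 2) le_rfl, ← mul_assoc,
    bandCup_hook', mul_assoc, cup_cup_self]

theorem hook_vertex_two (b : ℕ) : T.hook b * T.vertex 2 b = T.cap b * T.bandCup b := by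
  rw [hook, mul_assoc]; rfl

theorem hook_vertex_one (b : ℕ) : T.hook b * T.vertex 1 b = T.cap b := by
  rw [hook, mul_assoc, cup_vertex_one, mul_one]

theorem hook_vertex_one' (b : ℕ) : T.hook (b + 2) * T.vertex 1 b = T.cap (b + 2) := by
  rw [hook, mul_assoc, cup_vertex_one', mul_one]

theorem hook_vertex_zero' (b : ℕ) :
    T.hook (b + 2) * T.vertex 0 b = T.cap (b + 2) * T.bandCap b := by
  rw [hook, mul_assoc, cup_vertex_zero']

theorem hook_vertex_zero'' (b : ℕ) :
    T.hook (b + 4) * T.vertex 0 b = T.cap (b + 4) * T.bandCap b := by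
  rw [hook, mul_assoc, cup_vertex_zero'']

theorem cap_cap_self (b : ℕ) : T.cap (b + 2) * T.cap b = T.cap b * T.cap b :=
  T.cap_cap b b le_rfl

theorem hook_cap_self (b : ℕ) : T.hook b * T.cap b = d • T.cap b := by
  rw [hook, mul_assoc, T.loop, mul_smul_comm, mul_one]

theorem hook_cap_succ (b : ℕ) : T.hook b * T.cap (b + 2) = T.cap b * (T.cap b * T.cup b) := by
  rw [hook, mul_assoc, T.cup_cap_right b b le_rfl]

theorem cup_bandCap (b : ℕ) : T.cup b * T.bandCap b = T.cap b := by
  rw [bandCap, zig_assoc]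

section

variable (hd : d ≠ 0)
include hd

/-- The three products of two cuts and the product of all three have the same effect on the vertex,
namely `d⁻²` times the diagram of separate ends. In the expansion they enter with signs `3 - 1 = 2`.
-/
theorem resolve_vertex_three (n : ℕ) :
    T.vertex 3 (2 * n) * (T.proj true n * (T.proj true (n + 1) * T.proj true (n + 2))) =
      T.vertex 3 (2 * n) - (T.vertex 3 (2 * n) * T.proj false n +
        T.vertex 3 (2 * n) * T.proj false (n + 1) + T.vertex 3 (2 * n) * T.proj false (n + 2)) +
      2 * (T.vertex 3 (2 * n) * (T.proj false n * (T.proj false (n + 1) * T.proj false (n + 2)))) :=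
    by
  have e0 := T.proj_false_eq n 0
  have e1 := T.proj_false_eq n 1
  have e2 := T.proj_false_eq n 2
  norm_num at e0 e1 e2
  rw [proj_true, proj_true, proj_true]
  generalize T.proj false n = g0 at *
  generalize T.proj false (n + 1) = g1 at *
  generalize T.proj false (n + 2) = g2 at *
  set b := 2 * n
  set C := T.cup b * (T.cup b * T.cup b) with hC
  have p1 : T.vertex 3 b * g0 * g1 = (d⁻¹ * d⁻¹) • C := by
    rw [e0, e1, hC, ← vertex_three_pair]; simp [smul_smul]
  have p2 : T.vertex 3 b * g0 * g2 = (d⁻¹ * d⁻¹) • C := by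
    rw [e0, e2, hC, ← vertex_three_pair']; simp [smul_smul]
  have p3 : T.vertex 3 b * g1 * g2 = (d⁻¹ * d⁻¹) • C := by
    rw [e1, e2, hC, ← vertex_three_pair'']; simp [smul_smul]
  -- The third cut splits off one loop, which its factor `d⁻¹` cancels.
  have p4 : T.vertex 3 b * g0 * g1 * g2 = (d⁻¹ * d⁻¹) • C := by
    rw [p1, e2, mul_smul_comm, smul_mul_assoc, hC, mul_assoc, mul_assoc, cup_three_hook, smul_smul,
      smul_smul]
    congr 1
    field_simp
  calc _ = T.vertex 3 b - (T.vertex 3 b * g0 + T.vertex 3 b * g1 + T.vertex 3 b * g2) +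
      (T.vertex 3 b * g0 * g1 + T.vertex 3 b * g0 * g2 + T.vertex 3 b * g1 * g2 -
        T.vertex 3 b * g0 * g1 * g2) := by noncomm_ring
    _ = T.vertex 3 b - (T.vertex 3 b * g0 + T.vertex 3 b * g1 + T.vertex 3 b * g2) +
      2 * (T.vertex 3 b * g0 * g1 * g2) := by rw [p4, p1, p2, p3]; noncomm_ring
    _ = _ := by simp only [mul_assoc]

theorem resolve_vertex_two (n : ℕ) :
    T.proj true n * (T.vertex 2 (2 * n) * (T.proj true n * T.proj true (n + 1))) =
      T.vertex 2 (2 * n) - (T.proj false n * T.vertex 2 (2 * n) +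
        T.vertex 2 (2 * n) * T.proj false n + T.vertex 2 (2 * n) * T.proj false (n + 1)) +
      2 * (T.proj false n * (T.vertex 2 (2 * n) * (T.proj false n * T.proj false (n + 1)))) := by
  have e0 := T.proj_false_eq n 0
  have e1 := T.proj_false_eq n 1
  norm_num at e0 e1
  rw [proj_true, proj_true]
  generalize T.proj false n = g0 at *
  generalize T.proj false (n + 1) = g1 at *
  set b := 2 * n
  set C := T.cap b * (T.cup b * T.cup b) with hC
  have p1 : g0 * T.vertex 2 b * g0 = (d⁻¹ * d⁻¹) • C := by
    rw [e0, smul_mul_assoc, hook_vertex_two, smul_mul_assoc, mul_smul_comm, mul_assoc,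
      bandCup_hook, smul_smul]
  have p2 : g0 * T.vertex 2 b * g1 = (d⁻¹ * d⁻¹) • C := by
    rw [e0, e1, smul_mul_assoc, hook_vertex_two, smul_mul_assoc, mul_smul_comm, mul_assoc,
      bandCup_hook', smul_smul]
  have p3 : T.vertex 2 b * g0 * g1 = (d⁻¹ * d⁻¹) • C := by
    rw [e0, e1, mul_smul_comm, mul_smul_comm, smul_mul_assoc, vertex_two_hook,
      T.cup_mul_hook b b le_rfl, hook, mul_assoc, smul_smul]
  have p4 : g0 * T.vertex 2 b * g0 * g1 = (d⁻¹ * d⁻¹) • C := by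
    rw [p1, e1, mul_smul_comm, smul_mul_assoc, hC, mul_assoc, mul_assoc, cup_two_hook, smul_smul,
      mul_smul_comm, smul_smul]
    congr 1
    field_simp
  calc _ = T.vertex 2 b - (g0 * T.vertex 2 b + T.vertex 2 b * g0 + T.vertex 2 b * g1) +
      (g0 * T.vertex 2 b * g0 + g0 * T.vertex 2 b * g1 + T.vertex 2 b * g0 * g1 -
        g0 * T.vertex 2 b * g0 * g1) := by noncomm_ring
    _ = T.vertex 2 b - (g0 * T.vertex 2 b + T.vertex 2 b * g0 + T.vertex 2 b * g1) +
      2 * (g0 * T.vertex 2 b * g0 * g1) := by rw [p4, p1, p2, p3]; noncomm_ring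
    _ = _ := by simp only [mul_assoc]

theorem resolve_vertex_one (n : ℕ) :
    T.proj true n * T.proj true (n + 1) * (T.vertex 1 (2 * n) * T.proj true n) =
      T.vertex 1 (2 * n) - (T.proj false n * T.vertex 1 (2 * n) +
        T.proj false (n + 1) * T.vertex 1 (2 * n) + T.vertex 1 (2 * n) * T.proj false n) +
      2 * (T.proj false n * T.proj false (n + 1) * (T.vertex 1 (2 * n) * T.proj false n)) := by
  have e0 := T.proj_false_eq n 0
  have e1 := T.proj_false_eq n 1
  norm_num at e0 e1
  rw [proj_true, proj_true]
  generalize T.proj false n = g0 at *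
  generalize T.proj false (n + 1) = g1 at *
  set b := 2 * n
  set C := T.cap b * (T.cap b * T.cup b) with hC
  have p1 : g0 * T.vertex 1 b * g0 = (d⁻¹ * d⁻¹) • C := by
    rw [e0, smul_mul_assoc, hook_vertex_one, smul_mul_assoc, mul_smul_comm, hook, smul_smul]
  have p2 : g1 * T.vertex 1 b * g0 = (d⁻¹ * d⁻¹) • C := by
    rw [e0, e1, smul_mul_assoc, hook_vertex_one', smul_mul_assoc, mul_smul_comm, hook,
      ← mul_assoc, cap_cap_self, mul_assoc, smul_smul]
  have p3 : g0 * g1 * T.vertex 1 b = (d⁻¹ * d⁻¹) • C := by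
    rw [mul_assoc, e0, e1, smul_mul_assoc, smul_mul_assoc, mul_smul_comm, hook_vertex_one',
      hook_cap_succ, smul_smul]
  have p4 : g0 * g1 * T.vertex 1 b * g0 = (d⁻¹ * d⁻¹) • C := by
    rw [p3, e0, mul_smul_comm, smul_mul_assoc, hC, mul_assoc, mul_assoc, cup_hook_self, smul_smul,
      mul_smul_comm, mul_smul_comm, smul_smul]
    congr 1
    field_simp
  calc _ = T.vertex 1 b - (g0 * T.vertex 1 b + g1 * T.vertex 1 b + T.vertex 1 b * g0) +
      (g0 * T.vertex 1 b * g0 + g1 * T.vertex 1 b * g0 + g0 * g1 * T.vertex 1 b -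
        g0 * g1 * T.vertex 1 b * g0) := by noncomm_ring
    _ = T.vertex 1 b - (g0 * T.vertex 1 b + g1 * T.vertex 1 b + T.vertex 1 b * g0) +
      2 * (g0 * g1 * T.vertex 1 b * g0) := by rw [p4, p1, p2, p3]; noncomm_ring
    _ = _ := by simp only [mul_assoc]

theorem resolve_vertex_zero (n : ℕ) :
    T.proj true n * (T.proj true (n + 1) * T.proj true (n + 2)) * T.vertex 0 (2 * n) =
      T.vertex 0 (2 * n) - (T.proj false n * T.vertex 0 (2 * n) +
        T.proj false (n + 1) * T.vertex 0 (2 * n) + T.proj false (n + 2) * T.vertex 0 (2 * n)) +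
      2 * (T.proj false n * (T.proj false (n + 1) * T.proj false (n + 2)) * T.vertex 0 (2 * n)) :=
    by
  have e0 := T.proj_false_eq n 0
  have e1 := T.proj_false_eq n 1
  have e2 := T.proj_false_eq n 2
  norm_num at e0 e1 e2
  rw [proj_true, proj_true, proj_true]
  generalize T.proj false n = g0 at *
  generalize T.proj false (n + 1) = g1 at *
  generalize T.proj false (n + 2) = g2 at *
  set b := 2 * n
  set C := T.cap b * (T.cap b * T.cap b) with hC
  have p1 : g0 * g1 * T.vertex 0 b = (d⁻¹ * d⁻¹) • C := by
    rw [mul_assoc, e0, e1, smul_mul_assoc, smul_mul_assoc, mul_smul_comm, hook_vertex_zero',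
      ← mul_assoc, hook_cap_succ, mul_assoc, mul_assoc, cup_bandCap, smul_smul]
  have p2 : g0 * g2 * T.vertex 0 b = (d⁻¹ * d⁻¹) • C := by
    rw [mul_assoc, e0, e2, smul_mul_assoc, smul_mul_assoc, mul_smul_comm, hook_vertex_zero'',
      ← mul_assoc, hook, mul_assoc (T.cap b), T.cup_cap_right b (b + 2) (by omega), mul_assoc,
      mul_assoc, cup_bandCap, cap_cap_self, smul_smul]
  have p3 : g1 * g2 * T.vertex 0 b = (d⁻¹ * d⁻¹) • C := by
    rw [mul_assoc, e1, e2, smul_mul_assoc, smul_mul_assoc, mul_smul_comm, hook_vertex_zero'',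
      ← mul_assoc, T.hook_cap_succ (b + 2), mul_assoc, mul_assoc, hC]
    have h : T.cup (b + 2) * T.bandCap b = T.cap b := by rw [bandCap, T.zag_assoc (b + 1)]
    rw [h, cap_cap_self, ← mul_assoc, cap_cap_self, mul_assoc, smul_smul]
  have p4 : g0 * g1 * g2 * T.vertex 0 b = (d⁻¹ * d⁻¹) • C := by
    rw [mul_assoc, mul_assoc, ← mul_assoc g1, p3, e0, mul_smul_comm, smul_mul_assoc, hC,
      ← mul_assoc (T.hook b), hook_cap_self, smul_mul_assoc, smul_smul, smul_smul]
    congr 1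
    field_simp
  calc _ = T.vertex 0 b - (g0 * T.vertex 0 b + g1 * T.vertex 0 b + g2 * T.vertex 0 b) +
      (g0 * g1 * T.vertex 0 b + g0 * g2 * T.vertex 0 b + g1 * g2 * T.vertex 0 b -
        g0 * g1 * g2 * T.vertex 0 b) := by noncomm_ring
    _ = T.vertex 0 b - (g0 * T.vertex 0 b + g1 * T.vertex 0 b + g2 * T.vertex 0 b) +
      2 * (g0 * g1 * g2 * T.vertex 0 b) := by rw [p4, p1, p2, p3]; noncomm_ring
    _ = _ := by simp only [mul_assoc]

/-- The colour of the edges that cuts the edge `i` and leaves the others. -/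
def _root_.ThetaCurve.cutEdge (i j : Fin 3) : Option Bool := if j = i then some false else none

/-- The index `k` only permutes the edges among the legs, so the four shapes of the vertex suffice;
the sum over `i` is reordered accordingly. -/
theorem resolve_source (A : K) {x : ThetaSlice} (hx : x.piece.isSource = true) :
    T.markedSlice A (botMarks fun _ => some true) (topMarks fun _ => some true) x =
      T.bandOp A x.piece (2 * x.left.length) -
        ∑ i, T.markedSlice A (botMarks fun y => cutEdge i y.edge)
          (topMarks fun y => cutEdge i y.edge) x +
        2 * T.markedSlice A (botMarks fun _ => some false) (topMarks fun _ => some false) x := by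
  obtain ⟨l, _ | _ | _ | ⟨m, k⟩ | _, r⟩ := x <;> simp [ThetaPiece.isSource] at hx
  have h3 := T.resolve_vertex_three hd l.length
  have h2 := T.resolve_vertex_two hd l.length
  have h1 := T.resolve_vertex_one hd l.length
  have h0 := T.resolve_vertex_zero hd l.length
  have e : l.length + 1 + 1 = l.length + 2 := rfl
  fin_cases m
  · fin_cases k <;>
    · simp [markedSlice, botMarks, topMarks, ThetaPiece.bot, ThetaPiece.top, legMarks, bandOp,
        Fin.sum_univ_three, cutEdge, e]
      exact h0.trans (by abel)
  · fin_cases k <;>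
    · simp [markedSlice, botMarks, topMarks, ThetaPiece.bot, ThetaPiece.top, legMarks, bandOp,
        Fin.sum_univ_three, cutEdge, e]
      exact h1.trans (by abel)
  · fin_cases k <;>
    · simp [markedSlice, botMarks, topMarks, ThetaPiece.bot, ThetaPiece.top, legMarks, bandOp,
        Fin.sum_univ_three, cutEdge, e]
      exact h2.trans (by abel)
  · fin_cases k <;>
    · simp [markedSlice, botMarks, topMarks, ThetaPiece.bot, ThetaPiece.top, legMarks, bandOp,
        Fin.sum_univ_three, cutEdge, e]
      exact h3.trans (by abel)

end
end CupCap
end ThetaCurve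

/-! ### Removal of cut edges, row by row. -/

namespace ThetaCurve

/-- The number of strands whose edge is not in `S`. -/
def remaining (S : Fin 3 → Bool) (s : List Strand) : ℕ := s.countP fun y => !S y.edge

namespace CupCap

variable {K : Type*} {E : Type*} [Field K] [Ring E] [Algebra K E] {d : K} (T : CupCap K E d)

/-- The weight of a cut band: `1` if the strand runs upwards and `d⁻¹` otherwise. -/
def _root_.ThetaCurve.cutWeight (d : K) (y : Strand) : K := if y.up then 1 else d⁻¹

/-- Insert the cut bands of the strands of `s` whose edges are in `S`. -/
def insertCut (S : Fin 3 → Bool) : ℕ → List Strand → E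
  | _, [] => 1
  | p, y :: s => (if S y.edge then cutWeight d y • T.cup p else 1) * insertCut S (p + 2) s

theorem insertCut_append (S : Fin 3 → Bool) (p : ℕ) (s t : List Strand) :
    T.insertCut S p (s ++ t) = T.insertCut S p s * T.insertCut S (p + 2 * s.length) t := by
  induction s generalizing p with
  | nil => simp [insertCut]
  | cons y s ih =>
    rw [List.cons_append, insertCut, ih, insertCut, mul_assoc, List.length_cons,
      show p + 2 + 2 * s.length = p + 2 * (s.length + 1) by ring]

variable {T}

theorem Loc.insertCut_right {n m : ℕ} {X : ℕ → E} (hX : T.Loc n m X) (S : Fin 3 → Bool) (b q : ℕ)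
    (s : List Strand) :
    T.insertCut S (b + n + q) s * X b = X b * T.insertCut S (b + m + q) s := by
  induction s generalizing q with
  | nil => simp [insertCut]
  | cons y s ih =>
    have := ih (q + 2)
    rw [insertCut, insertCut, mul_assoc, add_assoc _ q 2, this, add_assoc _ q 2]
    split_ifs
    · rw [smul_mul_assoc, smul_mul_assoc, mul_smul_comm, ← mul_assoc, hX.cup_right, mul_assoc]
    · simp

/-- Without the cut bands, a piece has only the remaining bands to its left, and its position
changes accordingly. -/
theorem Loc.insertCut_left {n m : ℕ} {X : ℕ → E} (hX : T.Loc n m X) (S : Fin 3 → Bool) (p : ℕ)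
    (s : List Strand) :
    T.insertCut S p s * X (p + 2 * s.length) = X (p + 2 * remaining S s) * T.insertCut S p s := by
  induction s generalizing p with
  | nil => simp [insertCut, remaining]
  | cons y s ih =>
    have := ih (p + 2)
    rw [insertCut, mul_assoc, List.length_cons,
      show p + 2 * (s.length + 1) = p + 2 + 2 * s.length by ring, this]
    by_cases hy : S y.edge = true
    · rw [if_pos hy, show remaining S (y :: s) = remaining S s by simp [remaining, hy],
        show p + 2 + 2 * remaining S s = p + 2 * remaining S s + 2 by ring, smul_mul_assoc,
        ← mul_assoc, hX.cup_left p _ (by omega), smul_mul_assoc, mul_smul_comm, mul_assoc]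
    · rw [if_neg hy, show remaining S (y :: s) = remaining S s + 1 by simp [remaining, hy],
        show p + 2 + 2 * remaining S s = p + 2 * (remaining S s + 1) by ring, one_mul, one_mul]

variable (T)

theorem insertCut_hook (S : Fin 3 → Bool) {p q : ℕ} (h : p + 2 ≤ q) (s : List Strand) :
    T.insertCut S q s * T.hook p = T.hook p * T.insertCut S q s := by
  obtain ⟨q, rfl⟩ := Nat.exists_eq_add_of_le h
  exact (Loc.hook T).insertCut_right S p q s

theorem insertCut_legMarks (S : Fin 3 → Bool) {g : Strand → Option Bool} (n q : ℕ)
    (t s : List Strand) (h : 2 * (n + t.length) ≤ q) (hg : ∀ y, g y ≠ some true) :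
    T.insertCut S q s * T.marks (legMarks g n t) = T.marks (legMarks g n t) * T.insertCut S q s := by
  induction t generalizing n with
  | nil => simp [legMarks]
  | cons y t ih =>
    rw [legMarks, marks_append, ← mul_assoc, mul_assoc (T.marks _) (T.marks _) (T.insertCut S q s),
      ← ih (n + 1) (by simp at h; omega), ← mul_assoc]
    congr 1
    match hy : g y with
    | none => simp
    | some true => exact absurd hy (hg y)
    | some false =>
      simp only [marks_cons, marks_nil, mul_one, proj, Bool.false_eq_true, if_false,
        mul_smul_comm, smul_mul_assoc]
      rw [T.insertCut_hook S (by simp at h; omega)]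

/-- A cut end below a cut produces `cup * hook = d • cup`, which the weight `d⁻¹` of the mark
cancels. So the lower marks of a piece disappear. -/
theorem insertCut_absorb (hd : d ≠ 0) (S : Fin 3 → Bool) {g : Strand → Option Bool}
    (hg : ∀ y, g y = if S y.edge then some false else none) (n : ℕ) (s : List Strand) :
    T.insertCut S (2 * n) s * T.marks (legMarks g n s) = T.insertCut S (2 * n) s := by
  induction s generalizing n with
  | nil => simp [insertCut, legMarks]
  | cons y s ih =>
    rw [insertCut, legMarks, marks_append, hg]
    by_cases hy : S y.edge = true
    · have k1 := T.insertCut_hook S (le_refl (2 * n + 2)) s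
      have k2 := ih (n + 1)
      rw [show 2 * (n + 1) = 2 * n + 2 by ring] at k2
      rw [if_pos hy, if_pos hy]
      simp only [marks_cons, marks_nil, mul_one, proj, Bool.false_eq_true, if_false]
      calc _ = (cutWeight d y * d⁻¹) • (T.cup (2 * n) *
            (T.insertCut S (2 * n + 2) s * T.hook (2 * n) * T.marks (legMarks g (n + 1) s))) := by
            simp only [smul_mul_assoc, mul_smul_comm, mul_assoc, smul_smul, mul_comm]
        _ = (cutWeight d y * d⁻¹) • (T.cup (2 * n) * T.hook (2 * n) *
            (T.insertCut S (2 * n + 2) s * T.marks (legMarks g (n + 1) s))) := by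
            rw [k1]; simp only [mul_assoc]
        _ = _ := by
            rw [k2, cup_hook_self, smul_mul_assoc, smul_smul, mul_assoc, inv_mul_cancel₀ hd,
              mul_one, smul_mul_assoc]
    · rw [if_neg hy, if_neg hy]
      simp only [marks_nil, one_mul]
      rw [show 2 * n + 2 = 2 * (n + 1) by ring, ih]

/-- Cut bands can be moved up through a slice. -/
theorem insertCut_markedSlice (hd : d ≠ 0) {A : K} {S : Fin 3 → Bool} {g : Strand → Option Bool}
    (hg : ∀ y, g y = if S y.edge then some false else none) {x : ThetaSlice} {n m : ℕ} {X : ℕ → E}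
    (hX : T.Loc n m X) {c : K}
    (h : T.insertCut S (2 * x.left.length) x.piece.bot *
        (T.bandOp A x.piece (2 * x.left.length) * T.marks (topMarks g x)) =
      c • (X (2 * x.left.length) * T.insertCut S (2 * x.left.length) x.piece.top)) :
    T.insertCut S 0 (x.left ++ x.piece.bot ++ x.right) *
        T.markedSlice A (botMarks g) (topMarks g) x =
      c • (X (2 * remaining S x.left) *
        T.insertCut S 0 (x.left ++ x.piece.top ++ x.right)) := by
  have hgt : ∀ y, g y ≠ some true := by
    intro y
    rw [hg]
    split_ifs <;> simp
  have h1 := (Loc.bandOp T A x.piece).insertCut_right S (2 * x.left.length) 0 x.right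
  have h2 := hX.insertCut_left S 0 x.left
  have h3 := T.insertCut_absorb hd S hg x.left.length x.piece.bot
  have h4 := T.insertCut_legMarks S (g := g) x.left.length
    (2 * x.left.length + 2 * x.piece.bot.length) x.piece.bot x.right (by omega) hgt
  have h5 := T.insertCut_legMarks S (g := g) x.left.length
    (2 * x.left.length + 2 * x.piece.top.length) x.piece.top x.right (by omega) hgt
  rw [zero_add, zero_add] at h2
  rw [add_zero, add_zero] at h1
  rw [markedSlice, insertCut_append, insertCut_append, insertCut_append, insertCut_append,
    List.length_append, List.length_append, mul_add, zero_add, mul_add, zero_add, zero_add]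
  -- The cuts on the right pass the lower marks, these are absorbed by the cuts on the lower legs,
  -- and the cuts on the right then pass the band and the upper marks. Only the cuts on the lower
  -- legs meet the piece, where `h` applies; the left ones pass the residue by `h2`.
  rw [mul_assoc (T.insertCut S 0 x.left * _), ← mul_assoc (T.insertCut S _ x.right), botMarks, h4,
    mul_assoc (T.marks _), ← mul_assoc (T.insertCut S 0 x.left * _),
    mul_assoc (T.insertCut S 0 x.left), h3, ← mul_assoc (T.insertCut S _ x.right), h1,
    mul_assoc (T.bandOp A _ _), topMarks, h5, mul_assoc (T.insertCut S 0 x.left),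
    ← mul_assoc (T.bandOp A _ _), ← mul_assoc (T.insertCut S _ x.piece.bot)]
  rw [topMarks] at h
  rw [h, smul_mul_assoc, mul_smul_comm, mul_assoc, ← mul_assoc (T.insertCut S 0 x.left), h2]
  simp only [mul_assoc]

/-- What remains of a piece after the edges in `S` have been cut. -/
def residue (A : K) (S : Fin 3 → Bool) : ThetaPiece → ℕ → E
  | .cup i _ => if S i then fun _ => 1 else T.bandCup
  | .cap i _ => if S i then fun _ => 1 else T.bandCap
  | .cross o y z => if S y.edge || S z.edge then fun _ => 1 else T.bandOp A (.cross o y z)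
  | .source m k =>
      if remaining S (ThetaPiece.source m k).top = 2 then T.bandCup
      else if remaining S (ThetaPiece.source m k).bot = 2 then T.bandCap else fun _ => 1
  | .sink m k =>
      if remaining S (ThetaPiece.sink m k).top = 2 then T.bandCup
      else if remaining S (ThetaPiece.sink m k).bot = 2 then T.bandCap else fun _ => 1

theorem Loc.residue (A : K) (S : Fin 3 → Bool) (p : ThetaPiece) :
    ∃ n m, T.Loc n m (T.residue A S p) := by
  cases p <;> simp only [CupCap.residue] <;> split_ifs
  all_goals first
    | exact ⟨_, _, Loc.one 0⟩
    | exact ⟨_, _, Loc.bandCup T⟩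
    | exact ⟨_, _, Loc.bandCap T⟩
    | exact ⟨_, _, Loc.bandOp T _ _⟩

/-- The factor that a vertex contributes when one edge (`all = false`) or all edges are cut. -/
def _root_.ThetaCurve.cutFactor (d : K) (all : Bool) : ThetaPiece → K
  | .source _ _ => if all then d⁻¹ * d⁻¹ else d⁻¹
  | .sink _ _ => if all then d else 1
  | _ => 1

/-- The weights are chosen so that no factor appears. At a minimum the two marks give `d⁻²` and one
loop `d`, which agrees with the weights `1` and `d⁻¹` of the two new ends. At a maximum the weight
`d⁻¹` cancels the loop that closes. At a crossing the cut band slides off the other one. -/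
theorem insertCut_nonvertex {A : K} (hA : A ≠ 0) (hA' : d = -A ^ 2 - (A ^ 2)⁻¹) (hd : d ≠ 0)
    {S : Fin 3 → Bool} {g : Strand → Option Bool}
    (hg : ∀ y, g y = if S y.edge then some false else none) {p : ThetaPiece}
    (h1 : p.isSource = false) (h2 : p.isSink = false) (n : ℕ) :
    T.insertCut S (2 * n) p.bot * (T.bandOp A p (2 * n) * T.marks (legMarks g n p.top)) =
      T.residue A S p (2 * n) * T.insertCut S (2 * n) p.top := by
  have hs : ∀ i u u', g ⟨i, u⟩ = g ⟨i, u'⟩ := fun i u u' => by rw [hg, hg]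
  cases p with
  | cup i u =>
    by_cases hi : S i = true
    · have h := T.bandCup_hook (2 * n)
      have e := T.proj_false_eq n 1
      have e' := T.proj_false_eq n 0
      have h3 := T.cup_two_hook (2 * n)
      have h4 := T.cup_cup_self (2 * n)
      norm_num at e e'
      cases u <;>
      · simp [ThetaPiece.bot, ThetaPiece.top, insertCut, legMarks, hg, hi, residue, bandOp,
          cutWeight, e, e']
        rw [← mul_assoc, h, mul_assoc, h3, h4]
        simp [hd]
    · simp [ThetaPiece.bot, ThetaPiece.top, insertCut, legMarks, hg, hi, residue, bandOp]
  | cap i u =>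
    by_cases hi : S i = true
    · have h : T.cup (2 * n) * (T.cup (2 * n + 2) * T.bandCap (2 * n)) = d • 1 := by
        rw [bandCap, T.zag_assoc (2 * n + 1), T.loop]
      cases u <;>
      · simp [ThetaPiece.bot, ThetaPiece.top, insertCut, legMarks, hi, residue, bandOp,
          cutWeight, mul_assoc, h, hd]
    · simp [ThetaPiece.bot, ThetaPiece.top, insertCut, legMarks, hi, residue, bandOp]
  | cross o y z =>
    obtain ⟨α, hα, hα', hO⟩ : ∃ α : K, α ≠ 0 ∧ d = -α ^ 2 - (α ^ 2)⁻¹ ∧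
        T.bandOp A (.cross o y z) = T.bandCrossing α := by
      cases o
      · exact ⟨A⁻¹, inv_ne_zero hA, by rw [hA']; simp; ring, rfl⟩
      · exact ⟨A, hA, hA', rfl⟩
    have c1 := T.cup_bandCrossing hα hα' (2 * n)
    have c2 := T.cup_bandCrossing' hα hα' (2 * n)
    have c3 := T.cup_cup_self (2 * n)
    have e := T.proj_false_eq n 1
    have e' := T.proj_false_eq n 0
    have h3 := T.cup_two_hook (2 * n)
    have h5 := T.cup_hook_self (2 * n)
    have h6 := T.cup_hook_self (2 * n + 2)
    have h7 := T.cup_mul_hook (2 * n) (2 * n) le_rfl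
    norm_num at e e'
    by_cases hy : S y.edge = true <;> by_cases hz : S z.edge = true
    · simp [ThetaPiece.bot, ThetaPiece.top, insertCut, legMarks, hg, hy, hz, residue, hO, e, e']
      rw [mul_assoc, ← mul_assoc (T.cup (2 * n + 2)), c2, ← mul_assoc (T.cup (2 * n)), c3,
        T.hook_comm (le_refl (2 * n + 2)), ← mul_assoc, mul_assoc (T.cup (2 * n)), h3,
        smul_mul_assoc, mul_assoc, h5]
      simp only [smul_smul, mul_smul_comm]
      congr 1
      field_simp
    · simp [ThetaPiece.bot, ThetaPiece.top, insertCut, legMarks, hg, hy, hz, residue, hO, e, e']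
      rw [← mul_assoc, c1, h6]
      simp only [smul_smul]
      congr 1
      field_simp
    · simp [ThetaPiece.bot, ThetaPiece.top, insertCut, legMarks, hg, hy, hz, residue, hO, e, e']
      rw [← mul_assoc, c2, h5]
      simp only [smul_smul]
      congr 1
      field_simp
    · simp [ThetaPiece.bot, ThetaPiece.top, insertCut, legMarks, hg, hy, hz, residue, hO]
  | source => simp [ThetaPiece.isSource] at h1
  | sink => simp [ThetaPiece.isSink] at h2

/-- A cut leg at `v₁` contributes `d⁻¹`: if it is an upper leg, from its mark, the new end having
weight `1`; if it is a lower leg, from the weight of a downward strand. At `v₂` the weight of a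
lower leg is `1`, and for an upper leg the mark and the weight agree. -/
theorem insertCut_edge {A : K}
    {S : Fin 3 → Bool} {g : Strand → Option Bool}
    (hg : ∀ y, g y = if S y.edge then some false else none) {p : ThetaPiece}
    (h : p.isSource = true ∨ p.isSink = true) (n : ℕ)
    (hS : ∀ k, (S k = true ∧ S (k + 1) = false ∧ S (k + 2) = false) ∨
      (S k = false ∧ S (k + 1) = true ∧ S (k + 2) = false) ∨
      (S k = false ∧ S (k + 1) = false ∧ S (k + 2) = true)) :
    T.insertCut S (2 * n) p.bot * (T.bandOp A p (2 * n) * T.marks (legMarks g n p.top)) =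
      cutFactor d false p • (T.residue A S p (2 * n) * T.insertCut S (2 * n) p.top) := by
  have e0 : T.proj false n = d⁻¹ • T.hook (2 * n) := by simpa using T.proj_false_eq n 0
  have e1 : T.proj false (n + 1) = d⁻¹ • T.hook (2 * n + 2) := by simpa using T.proj_false_eq n 1
  have e2 : T.proj false (n + 1 + 1) = d⁻¹ • T.hook (2 * n + 4) := by
    simpa using T.proj_false_eq n 2
  have v3 := T.vertex_three_hook (2 * n)
  have v3' := T.vertex_three_hook' (2 * n)
  have v3'' := T.vertex_three_hook'' (2 * n)
  have v2 := T.vertex_two_hook (2 * n)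
  have v2' := T.vertex_two_hook' (2 * n)
  have v2'' : T.cup (2 * n) * T.vertex 2 (2 * n) = T.bandCup (2 * n) := rfl
  have v1 := T.cup_vertex_one (2 * n)
  have v1' := T.cup_vertex_one' (2 * n)
  have v1'' : T.vertex 1 (2 * n) * T.hook (2 * n) = T.bandCap (2 * n) * T.cup (2 * n) := by
    rw [vertex, hook, bandCap, mul_assoc]
  have v0 := T.cup_vertex_zero (2 * n)
  have v0' := T.cup_vertex_zero' (2 * n)
  have v0'' := T.cup_vertex_zero'' (2 * n)
  have a4 : 2 * n + 2 + 2 = 2 * n + 4 := rfl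
  cases p with
  | source m k =>
    rcases hS k with ⟨s0, s1, s2⟩ | ⟨s0, s1, s2⟩ | ⟨s0, s1, s2⟩ <;> fin_cases m <;>
      simp [ThetaPiece.bot, ThetaPiece.top, insertCut, legMarks, hg, residue, bandOp, cutFactor,
        cutWeight, remaining, s0, s1, s2, e0, e1, e2, a4, v3, v3', v3'', v2, v2', v2'', v1, v1',
        v1'', v0, v0', v0'', List.countP_cons]
  | sink m k =>
    rcases hS k with ⟨s0, s1, s2⟩ | ⟨s0, s1, s2⟩ | ⟨s0, s1, s2⟩ <;> fin_cases m <;>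
      simp [ThetaPiece.bot, ThetaPiece.top, insertCut, legMarks, hg, residue, bandOp, cutFactor,
        cutWeight, remaining, s0, s1, s2, e0, e1, e2, a4, v3, v3', v3'', v2, v2', v2'', v1, v1',
        v1'', v0, v0', v0'', List.countP_cons]
  | _ => simp [ThetaPiece.isSource, ThetaPiece.isSink] at h

/-- At `v₁` the marks and weights give `d⁻³` and the ends of the cut vertex leave one extra loop
`d`. At `v₂` marks and weights balance, and only the loop remains. -/
theorem insertCut_all {A : K} (hd : d ≠ 0)
    {S : Fin 3 → Bool} {g : Strand → Option Bool}
    (hg : ∀ y, g y = if S y.edge then some false else none) {p : ThetaPiece}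
    (h : p.isSource = true ∨ p.isSink = true) (n : ℕ) (hS : ∀ k, S k = true) :
    T.insertCut S (2 * n) p.bot * (T.bandOp A p (2 * n) * T.marks (legMarks g n p.top)) =
      cutFactor d true p • (T.residue A S p (2 * n) * T.insertCut S (2 * n) p.top) := by
  have e0 : T.proj false n = d⁻¹ • T.hook (2 * n) := by simpa using T.proj_false_eq n 0
  have e1 : T.proj false (n + 1) = d⁻¹ • T.hook (2 * n + 2) := by simpa using T.proj_false_eq n 1
  have e2 : T.proj false (n + 1 + 1) = d⁻¹ • T.hook (2 * n + 4) := by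
    simpa using T.proj_false_eq n 2
  have c2 : T.cup (2 * n) * T.cup (2 * n + 2) = T.cup (2 * n) * T.cup (2 * n) :=
    T.cup_cup_self _
  have c3 : T.cup (2 * n) * (T.cup (2 * n + 2) * T.cup (2 * n + 4)) =
      T.cup (2 * n) * (T.cup (2 * n) * T.cup (2 * n)) := by
    have := T.cup_cup_self (2 * n + 2)
    rw [this, ← mul_assoc, c2, mul_assoc, c2]
  have v3 : T.vertex 3 (2 * n) * (T.hook (2 * n) * (T.hook (2 * n + 2) * T.hook (2 * n + 4))) =
      d • (T.cup (2 * n) * (T.cup (2 * n) * T.cup (2 * n))) := by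
    rw [← mul_assoc, ← mul_assoc, vertex_three_pair, mul_assoc, mul_assoc, cup_three_hook]
  have v2 : T.cup (2 * n) * (T.vertex 2 (2 * n) * (T.hook (2 * n) * T.hook (2 * n + 2))) =
      d • (T.cup (2 * n) * T.cup (2 * n)) := by
    rw [← mul_assoc, ← mul_assoc, show T.cup (2 * n) * T.vertex 2 (2 * n) = T.bandCup (2 * n)
      from rfl, bandCup_hook, mul_assoc, cup_two_hook]
  have v1 : T.cup (2 * n) * (T.cup (2 * n + 2) * (T.vertex 1 (2 * n) * T.hook (2 * n))) =
      d • T.cup (2 * n) := by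
    rw [← mul_assoc (T.cup (2 * n + 2)), cup_vertex_one', one_mul, cup_hook_self]
  have v0 : T.cup (2 * n) * (T.cup (2 * n + 2) * (T.cup (2 * n + 4) * T.vertex 0 (2 * n))) =
      d • 1 := by
    rw [cup_vertex_zero'', bandCap, T.zag_assoc (2 * n + 1), T.loop]
  rw [← mul_assoc, c2, mul_assoc] at v1
  rw [← mul_assoc (T.cup (2 * n + 2)), ← mul_assoc, c3, mul_assoc, mul_assoc] at v0
  have a4 : 2 * n + 2 + 2 = 2 * n + 4 := rfl
  cases p with
  | source m k =>
    fin_cases m <;>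
    · simp [ThetaPiece.bot, ThetaPiece.top, insertCut, legMarks, hg, residue, bandOp, cutFactor,
        cutWeight, remaining, hS, e0, e1, e2, a4, c2, c3, v3, v2, v1, v0, mul_assoc, smul_smul, hd]
  | sink m k =>
    fin_cases m <;>
    · simp [ThetaPiece.bot, ThetaPiece.top, insertCut, legMarks, hg, residue, bandOp, cutFactor,
        cutWeight, remaining, hS, e0, e1, e2, a4, c2, c3, v3, v2, v1, v0, mul_assoc, smul_smul, hd]
  | _ => simp [ThetaPiece.isSource, ThetaPiece.isSink] at h

end CupCap
end ThetaCurve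

/-! ### The remaining bands as the 2-parallel of a boundary component. -/

namespace ThetaCurve

/-- The part of the 2-parallel of the component `i` that belongs to a slice. -/
def ThetaSlice.parallelPart (i : Fin 3) (x : ThetaSlice) : List Slice :=
  parallel (x.band.filterMap (LabelledSlice.restrict i))

/-- The edge of a strand and the components on its two sides are the three different indices. -/
theorem Strand.side_cases (i : Fin 3) (y : Strand) :
    (y.edge = i ∧ y.lft ≠ i ∧ y.rgt ≠ i) ∨ (y.edge ≠ i ∧ y.lft = i ∧ y.rgt ≠ i) ∨
      (y.edge ≠ i ∧ y.lft ≠ i ∧ y.rgt = i) := by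
  obtain ⟨e, u⟩ := y
  revert e u i
  decide

theorem remaining_append (S : Fin 3 → Bool) (s t : List Strand) :
    remaining S (s ++ t) = remaining S s + remaining S t := by
  simp [remaining]

/-- Each band of an edge other than `i` has exactly one boundary strand in the component `i`, and
the bands of `i` have none. Doubling that strand therefore gives back exactly the remaining bands.
-/
theorem count_sides (i : Fin 3) (s : List Strand) :
    (sides s).count i = remaining (fun j => decide (j = i)) s := by
  induction s with
  | nil => rfl
  | cons y s ih =>
    have e : sides (y :: s) = [y.lft, y.rgt] ++ sides s := rfl
    rw [e, List.count_append, ih]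
    rcases y.side_cases i with ⟨h1, h2, h3⟩ | ⟨h1, h2, h3⟩ | ⟨h1, h2, h3⟩ <;>
      simp [remaining, h1, h2, h3, List.count_cons, add_comm]

theorem valid_band (x : ThetaSlice) :
    Valid (2 * (x.left ++ x.piece.bot ++ x.right).length) (x.band.map LabelledSlice.forget)
      (2 * (x.left ++ x.piece.top ++ x.right).length) := by
  obtain ⟨l, p, r⟩ := x
  cases p with
  | cup | cap | cross =>
    simp [ThetaSlice.band, ThetaPiece.bot, ThetaPiece.top, LabelledSlice.forget, Valid,
      CupCap.length_sides]
    try omega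
  | source m k =>
    fin_cases m <;> simp [ThetaSlice.band, ThetaPiece.bot, ThetaPiece.top, vertexBand,
      LabelledSlice.forget, Valid, CupCap.length_sides] <;> omega
  | sink m k =>
    fin_cases m <;> simp [ThetaSlice.band, ThetaPiece.bot, ThetaPiece.top, vertexBand,
      LabelledSlice.forget, Valid, CupCap.length_sides] <;> omega

theorem valid_parallelPart (i : Fin 3) (x : ThetaSlice) :
    Valid (2 * remaining (fun j => decide (j = i)) (x.left ++ x.piece.bot ++ x.right))
      (x.parallelPart i)
      (2 * remaining (fun j => decide (j = i)) (x.left ++ x.piece.top ++ x.right)) := by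
  obtain ⟨l, p, r⟩ := x
  simp only [remaining_append]
  generalize hr : remaining (fun j => decide (j = i)) r = c
  cases p with
  | cup e u | cap e u =>
    rcases (Strand.mk e u).side_cases i with ⟨h1, h2, h3⟩ | ⟨h1, h2, h3⟩ | ⟨h1, h2, h3⟩ <;>
    · have g1 := h1
      try obtain rfl : e = i := h1
      simp [ThetaSlice.parallelPart, ThetaSlice.band, ThetaPiece.bot, ThetaPiece.top,
        LabelledSlice.restrict, parallel, Valid, count_sides, g1, h2, h3, remaining]
      try omega
  | cross o y z =>
    rcases y.side_cases i with ⟨h1, h2, h3⟩ | ⟨h1, h2, h3⟩ | ⟨h1, h2, h3⟩ <;>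
    rcases z.side_cases i with ⟨g1, g2, g3⟩ | ⟨g1, g2, g3⟩ | ⟨g1, g2, g3⟩ <;>
    · simp [ThetaSlice.parallelPart, ThetaSlice.band, ThetaPiece.bot, ThetaPiece.top,
        LabelledSlice.restrict, parallel, Valid, count_sides, h1, h2, h3, g1, g2, g3, remaining]
      try omega
  | source m k =>
    fin_cases m <;> fin_cases k <;> fin_cases i <;>
    · simp [ThetaSlice.parallelPart, ThetaSlice.band, ThetaPiece.bot, ThetaPiece.top, vertexBand,
        LabelledSlice.restrict, parallel, Valid, count_sides, Strand.lft, Strand.rgt, remaining]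
      try omega
  | sink m k =>
    fin_cases m <;> fin_cases k <;> fin_cases i <;>
    · simp [ThetaSlice.parallelPart, ThetaSlice.band, ThetaPiece.bot, ThetaPiece.top, vertexBand,
        LabelledSlice.restrict, parallel, Valid, count_sides, Strand.lft, Strand.rgt, remaining]
      try omega

namespace CupCap

variable {K : Type*} {E : Type*} [Field K] [Ring E] [Algebra K E] {d : K} (T : CupCap K E d)

theorem word_parallelPart (A : K) (i : Fin 3) (x : ThetaSlice) :
    T.word A (x.parallelPart i) = T.residue A (fun j => decide (j = i)) x.piece
      (2 * remaining (fun j => decide (j = i)) x.left) := by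
  obtain ⟨l, p, r⟩ := x
  cases p with
  | cup e u | cap e u =>
    rcases (Strand.mk e u).side_cases i with ⟨h1, h2, h3⟩ | ⟨h1, h2, h3⟩ | ⟨h1, h2, h3⟩ <;>
    · have g1 := h1
      try obtain rfl : e = i := h1
      simp [ThetaSlice.parallelPart, ThetaSlice.band, slice, residue, bandCup, bandCap,
        LabelledSlice.restrict, parallel, count_sides, g1, h2, h3, List.count_cons]
  | cross o y z =>
    rcases y.side_cases i with ⟨h1, h2, h3⟩ | ⟨h1, h2, h3⟩ | ⟨h1, h2, h3⟩ <;>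
    rcases z.side_cases i with ⟨g1, g2, g3⟩ | ⟨g1, g2, g3⟩ | ⟨g1, g2, g3⟩ <;> cases o <;>
    · simp [ThetaSlice.parallelPart, ThetaSlice.band, slice, residue, bandOp, bandCrossing,
        LabelledSlice.restrict, parallel, count_sides, h1, h2, h3, g1, g2, g3, List.count_cons]
  | source m k =>
    fin_cases m <;> fin_cases k <;> fin_cases i <;>
    · simp [ThetaSlice.parallelPart, ThetaSlice.band, ThetaPiece.bot, ThetaPiece.top, vertexBand,
        LabelledSlice.restrict, parallel, count_sides, Strand.lft, Strand.rgt, remaining,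
        residue, slice, bandCup, bandCap, List.countP_cons, List.count_cons]
  | sink m k =>
    fin_cases m <;> fin_cases k <;> fin_cases i <;>
    · simp [ThetaSlice.parallelPart, ThetaSlice.band, ThetaPiece.bot, ThetaPiece.top, vertexBand,
        LabelledSlice.restrict, parallel, count_sides, Strand.lft, Strand.rgt, remaining,
        residue, slice, bandCup, bandCap, List.countP_cons, List.count_cons]

end CupCap
end ThetaCurve

/-! ### Values of the resolved diagrams. -/

namespace ThetaCurve

theorem valid_flatMap {f : ThetaSlice → List Slice} {N : List Strand → ℕ}
    (h : ∀ x : ThetaSlice, Valid (N (x.left ++ x.piece.bot ++ x.right)) (f x)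
      (N (x.left ++ x.piece.top ++ x.right)))
    {s t : List Strand} {w : List ThetaSlice} (hw : Fits s w t) :
    Valid (N s) (w.flatMap f) (N t) := by
  induction w generalizing s with
  | nil =>
    obtain rfl : s = t := hw
    exact rfl
  | cons x w ih =>
    obtain ⟨rfl, hw⟩ := hw
    exact (h x).append (ih hw)

namespace ThetaDiagram

variable (D : ThetaDiagram)

theorem L_eq_flatMap : D.L = D.slices.flatMap fun x => x.band.map LabelledSlice.forget := by
  rw [L, boundary, List.map_flatMap]

theorem parallel_l_eq_flatMap (i : Fin 3) :
    parallel (D.l i) = D.slices.flatMap (ThetaSlice.parallelPart i) := by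
  rw [l, boundary, List.filterMap_flatMap, parallel, List.flatMap_assoc]
  rfl

theorem valid_L : Valid 0 D.L 0 := by
  rw [L_eq_flatMap]
  exact valid_flatMap (N := fun s => 2 * s.length) valid_band D.fits

theorem valid_parallel_l (i : Fin 3) : Valid 0 (parallel (D.l i)) 0 := by
  rw [parallel_l_eq_flatMap]
  exact valid_flatMap (N := fun s => 2 * remaining (fun j => decide (j = i)) s)
    (valid_parallelPart i) D.fits

end ThetaDiagram

theorem prod_cutFactor {K : Type*} [Field K] (d : K) (all : Bool) (w : List ThetaSlice) :
    (w.map fun x => cutFactor d all x.piece).prod =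
      (if all then d⁻¹ * d⁻¹ else d⁻¹) ^ w.countP (fun x => x.piece.isSource) *
        (if all then d else 1) ^ w.countP (fun x => x.piece.isSink) := by
  induction w with
  | nil => simp
  | cons x w ih =>
    obtain ⟨l, p, r⟩ := x
    rw [List.map_cons, List.prod_cons, ih, List.countP_cons, List.countP_cons]
    generalize List.countP _ w = a
    generalize List.countP _ w = b
    cases all <;> cases p <;>
    · simp only [cutFactor, ThetaPiece.isSource, ThetaPiece.isSink, if_true, if_false,
        Bool.false_eq_true]
      ring

namespace CupCap

variable {K : Type*} {E : Type*} [Field K] [Ring E] [Algebra K E] {d : K} (T : CupCap K E d)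

theorem word_flatMap (A : K) (f : ThetaSlice → List Slice) (w : List ThetaSlice) :
    T.word A (w.flatMap f) = (w.map fun x => T.word A (f x)).prod := by
  induction w with
  | nil => rfl
  | cons x w ih => simp [ih]

/-- Induction along the word: the cuts of the lower row are pushed through each slice and leave its
residue and its factor. For a closed diagram both extreme rows are empty and no cuts are left over.
-/
theorem insertCut_fullyMarked (hd : d ≠ 0) {A : K} {S : Fin 3 → Bool} {g : Strand → Option Bool}
    (hg : ∀ y, g y = if S y.edge then some false else none) {c : ThetaPiece → K}
    (h : ∀ p n, T.insertCut S (2 * n) p.bot *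
        (T.bandOp A p (2 * n) * T.marks (legMarks g n p.top)) =
      c p • (T.residue A S p (2 * n) * T.insertCut S (2 * n) p.top))
    {s t : List Strand} {w : List ThetaSlice} (hw : Fits s w t) :
    T.insertCut S 0 s * (w.map (T.markedSlice A (botMarks g) (topMarks g))).prod =
      (w.map fun x => c x.piece).prod •
        ((w.map fun x => T.residue A S x.piece (2 * remaining S x.left)).prod *
          T.insertCut S 0 t) := by
  induction w generalizing s with
  | nil =>
    obtain rfl : s = t := hw
    simp
  | cons x w ih =>
    obtain ⟨rfl, hw⟩ := hw
    obtain ⟨n, m, hX⟩ := Loc.residue T A S x.piece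
    simp only [List.map_cons, List.prod_cons]
    rw [← mul_assoc, T.insertCut_markedSlice hd hg hX (h _ _), smul_mul_assoc, mul_assoc, ih hw,
      mul_smul_comm, smul_smul, mul_assoc]

variable {A : K} (hA : A ≠ 0) (hA' : d = -A ^ 2 - (A ^ 2)⁻¹) (hd : d ≠ 0)

include hA hA' hd in
theorem insertCut_piece {S : Fin 3 → Bool} {g : Strand → Option Bool}
    (hg : ∀ y, g y = if S y.edge then some false else none) {all : Bool}
    (h : ∀ p : ThetaPiece, p.isSource = true ∨ p.isSink = true → ∀ n,
      T.insertCut S (2 * n) p.bot * (T.bandOp A p (2 * n) * T.marks (legMarks g n p.top)) =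
      cutFactor d all p • (T.residue A S p (2 * n) * T.insertCut S (2 * n) p.top))
    (p : ThetaPiece) (n : ℕ) :
    T.insertCut S (2 * n) p.bot * (T.bandOp A p (2 * n) * T.marks (legMarks g n p.top)) =
      cutFactor d all p • (T.residue A S p (2 * n) * T.insertCut S (2 * n) p.top) := by
  cases p with
  | cup | cap | cross =>
    rw [T.insertCut_nonvertex hA hA' hd hg rfl rfl, cutFactor, one_smul]
    all_goals simp
  | source => exact h _ (Or.inl rfl) n
  | sink => exact h _ (Or.inr rfl) n

include hA hA' hd in
/-- Cutting the edge `i` leaves the 2-parallel of the component `i`. -/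
theorem fullyMarked_cutEdge (D : ThetaDiagram) (i : Fin 3) :
    T.fullyMarked A (cutEdge i) D.slices = d⁻¹ • T.word A (parallel (D.l i)) := by
  have hg : ∀ y : Strand, cutEdge i y.edge =
      if decide (y.edge = i) = true then some false else none := by simp [cutEdge]
  have hS : ∀ k : Fin 3,
      (decide (k = i) = true ∧ decide (k + 1 = i) = false ∧ decide (k + 2 = i) = false) ∨
      (decide (k = i) = false ∧ decide (k + 1 = i) = true ∧ decide (k + 2 = i) = false) ∨
      (decide (k = i) = false ∧ decide (k + 1 = i) = false ∧ decide (k + 2 = i) = true) := by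
    clear hg
    revert i
    decide
  have key := T.insertCut_fullyMarked hd (S := fun j => decide (j = i)) hg
    (T.insertCut_piece hA hA' hd hg
      fun p hp n => T.insertCut_edge (S := fun j => decide (j = i)) hg hp n hS) D.fits
  -- The vertex factors are `d⁻¹` at `v₁` and `1` at `v₂`.
  rw [prod_cutFactor, D.one_source, D.one_sink] at key
  simpa [insertCut, fullyMarked, D.parallel_l_eq_flatMap, word_flatMap, word_parallelPart]
    using key

include hA hA' hd in
/-- Nothing remains if all edges are cut. -/
theorem fullyMarked_false (D : ThetaDiagram) :
    T.fullyMarked A (fun _ => some false) D.slices = d⁻¹ • 1 := by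
  have hg : ∀ y : Strand, (fun _ => some false : Strand → Option Bool) y =
      if (fun _ => true : Fin 3 → Bool) y.edge = true then some false else none := by simp
  have key := T.insertCut_fullyMarked hd hg
    (T.insertCut_piece hA hA' hd hg
      fun p hp n => T.insertCut_all hd hg hp n fun _ => rfl) D.fits
  have hr : ∀ (p : ThetaPiece) (n : ℕ), T.residue A (fun _ => true) p n = 1 := by
    intro p n
    cases p <;> simp [residue, remaining]
  -- The vertex factors are `d⁻²` at `v₁` and `d` at `v₂`.
  rw [prod_cutFactor, D.one_source, D.one_sink] at key
  simpa [insertCut, fullyMarked, hr, hd] using key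

theorem sourceMarked_none (χ : Fin 3 → Option Bool) {w : List ThetaSlice}
    (h : w.countP (fun x => x.piece.isSource) = 0) :
    T.sourceMarked A χ w = (w.map fun x => T.bandOp A x.piece (2 * x.left.length)).prod := by
  rw [sourceMarked]
  congr 1
  refine List.map_congr_left fun x hx => ?_
  have := List.countP_eq_zero.1 h x hx
  simp [markedSlice, this]

include hd in
-- The product is linear in its only slice that contains `v₁`, so the relation of `resolve_source`
-- extends to the whole diagram.
theorem resolve_sourceMarked {w : List ThetaSlice}
    (h : w.countP (fun x => x.piece.isSource) = 1) :
    T.sourceMarked A (fun _ => some true) w =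
      (w.map fun x => T.bandOp A x.piece (2 * x.left.length)).prod -
        ∑ i, T.sourceMarked A (cutEdge i) w + 2 * T.sourceMarked A (fun _ => some false) w := by
  have cons : ∀ χ x w, T.sourceMarked A χ (x :: w) =
      T.markedSlice A (fun x => if x.piece.isSource then botMarks (fun y => χ y.edge) x else [])
        (fun x => if x.piece.isSource then topMarks (fun y => χ y.edge) x else []) x *
        T.sourceMarked A χ w := fun χ x w => by rw [sourceMarked, List.map_cons, List.prod_cons]; rfl
  induction w with
  | nil => simp at h
  | cons x w ih =>
    rw [List.countP_cons] at h
    by_cases hx : x.piece.isSource = true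
    · rw [if_pos hx] at h
      have hw : w.countP (fun x => x.piece.isSource) = 0 := by omega
      have key := T.resolve_source hd A hx
      simp only [markedSlice] at key
      simp only [cons, T.sourceMarked_none _ hw, markedSlice, hx, if_true, List.map_cons,
        List.prod_cons, key, ← Finset.sum_mul]
      noncomm_ring
    · rw [if_neg hx] at h
      simp only [cons, ih h, markedSlice, hx, if_false, List.map_cons, List.prod_cons, marks_nil,
        one_mul, mul_one, ← Finset.mul_sum, Bool.false_eq_true]
      noncomm_ring

include hA hA' hd in
theorem barMarked_eq (D : ThetaDiagram) :
    T.barMarked A D.slices = T.word A D.L - d⁻¹ • ∑ i, T.word A (parallel (D.l i)) +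
      (2 * d⁻¹) • 1 := by
  rw [T.barMarked_eq_sourceMarked hA hA' hd, T.resolve_sourceMarked hd D.one_source]
  simp only [T.sourceMarked_eq_fullyMarked hA hA' hd, T.fullyMarked_cutEdge hA hA' hd,
    T.fullyMarked_false hA hA' hd, D.L_eq_flatMap, word_flatMap, word_band, ← Finset.smul_sum]
  rw [mul_smul, two_smul K, two_mul]

end CupCap

/-! ### The expansion of the bars -/

/-- The word `b` is a band diagram with bars with `n` boundary strands below and `m` above. -/
def ValidBar : ℕ → List BarSlice → ℕ → Prop
  | n, [], m => n = m
  | n, .piece s :: b, m => ∃ k, Valid n [s] k ∧ ValidBar k b m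
  | n, .bar p :: b, m => p + 2 ≤ n ∧ ValidBar n b m

theorem ValidBar.append {n m l : ℕ} {u v : List BarSlice} (hu : ValidBar n u m)
    (hv : ValidBar m v l) : ValidBar n (u ++ v) l := by
  induction u generalizing n with
  | nil => exact (show n = m from hu) ▸ hv
  | cons x u ih =>
    cases x with
    | piece s =>
      obtain ⟨k, h1, h2⟩ := hu
      exact ⟨k, h1, ih h2⟩
    | bar p => exact ⟨hu.1, ih hu.2⟩

theorem Valid.validBar {n m : ℕ} {w : List Slice} (h : Valid n w m) :
    ValidBar n (w.map BarSlice.piece) m := by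
  induction w generalizing n with
  | nil => exact h
  | cons s w ih => obtain ⟨p, _ | _ | _⟩ := s <;> exact ⟨_, ⟨h.1, rfl⟩, ih h.2⟩

theorem validBar_barPlaces (u : Bool) (k n : ℕ) (s : List Strand) (h : 2 * (n + s.length) ≤ k) :
    ValidBar k ((barPlaces u n s).map BarSlice.bar) k := by
  induction s generalizing n with
  | nil => exact rfl
  | cons y s ih =>
    rw [List.length_cons] at h
    rw [barPlaces]
    split_ifs
    · exact ⟨by omega, ih _ (by omega)⟩
    · exact ih _ (by omega)

theorem validBar_barBand (x : ThetaSlice) :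
    ValidBar (2 * (x.left ++ x.piece.bot ++ x.right).length) x.barBand
      (2 * (x.left ++ x.piece.top ++ x.right).length) := by
  have h := (valid_band x).validBar
  rw [List.map_map] at h
  rw [ThetaSlice.barBand]
  split_ifs
  · exact ((validBar_barPlaces _ _ _ _ (by simp)).append h).append
      (validBar_barPlaces _ _ _ _ (by simp))
  · exact h

theorem validBar_flatMap {s t : List Strand} {w : List ThetaSlice} (hw : Fits s w t) :
    ValidBar (2 * s.length) (w.flatMap ThetaSlice.barBand) (2 * t.length) := by
  induction w generalizing s with
  | nil =>
    obtain rfl : s = t := hw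
    exact rfl
  | cons x w ih =>
    obtain ⟨rfl, hw⟩ := hw
    exact (validBar_barBand x).append (ih hw)

namespace CupCap

variable {K : Type*} {E : Type*} [Field K] [Ring E] [Algebra K E] {d : K} (T : CupCap K E d)

/-- The operator of a slice of a band diagram, a bar being the projection to the nontrivial part
of the band. -/
def barSlice (A : K) : BarSlice → E
  | .piece s => T.slice A s
  | .bar p => 1 - d⁻¹ • T.hook p

/-- The operator of a band diagram with bars. -/
def barWord (A : K) (b : List BarSlice) : E := (b.map (T.barSlice A)).prod

theorem barWord_append (A : K) (u v : List BarSlice) :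
    T.barWord A (u ++ v) = T.barWord A u * T.barWord A v := by simp [barWord]

theorem barWord_piece (A : K) (w : List Slice) :
    T.barWord A (w.map BarSlice.piece) = T.word A w := by
  rw [barWord, word, List.map_map]
  rfl

theorem barWord_barPlaces (A : K) (u : Bool) (n : ℕ) (s : List Strand) :
    T.barWord A ((barPlaces u n s).map BarSlice.bar) = T.marks (legMarks (barColour u) n s) := by
  induction s generalizing n with
  | nil => rfl
  | cons y s ih =>
    have ih' := ih (n + 1)
    rw [barWord] at ih' ⊢
    rw [legMarks, barPlaces, barColour]
    by_cases h : y.up = u <;> simp [h, barSlice, proj, ← ih']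

theorem barWord_barBand (A : K) (x : ThetaSlice) :
    T.barWord A x.barBand = T.markedSlice A
      (fun x => if x.isNode then botMarks (barColour false) x else [])
      (fun x => if x.isNode then topMarks (barColour true) x else []) x := by
  have h := T.word_band A x
  rw [← barWord_piece, List.map_map] at h
  rw [ThetaSlice.barBand, markedSlice]
  split_ifs
  · rw [barWord_append, barWord_append, barWord_barPlaces, barWord_barPlaces, mul_assoc]
    exact congrArg (_ * ·) (congrArg (· * _) h)
  · rw [marks_nil, one_mul, mul_one]
    exact h

theorem barWord_barDiagram (A : K) (D : ThetaDiagram) :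
    T.barWord A D.barDiagram = T.barMarked A D.slices := by
  rw [ThetaDiagram.barDiagram, barMarked]
  induction D.slices with
  | nil => rfl
  | cons x w ih =>
    rw [List.flatMap_cons, barWord_append, ih, barWord_barBand, List.map_cons, List.prod_cons]

/-- The half twist contributes `A + A⁻¹ h`. With the two other terms the coefficient of `1` becomes
`(A + A⁻¹)/(A + A⁻¹) = 1`, and that of `h` becomes `A²/(1 + A⁴) = -d⁻¹`. Any evaluation that is
linear in the operators thus sees a bar as the projection. -/
theorem barExpand_eq {A : K} (hA : A ≠ 0) (hA' : d = -A ^ 2 - (A ^ 2)⁻¹) (hd : d ≠ 0)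
    (hA2 : A ^ 2 + 1 ≠ 0) {ev : List Slice → K} {Φ : E →ₗ[K] K}
    (hev : ∀ w, Valid 0 w 0 → ev w = Φ (T.word A w)) (b : List BarSlice) (n : ℕ)
    (w : List Slice) (hw : Valid 0 w n) (hb : ValidBar n b 0) :
    barExpand ev (-A ^ 3) A w b = Φ (T.word A w * T.barWord A b) := by
  induction b generalizing n w with
  | nil =>
    obtain rfl : n = 0 := hb
    rw [barExpand, hev w hw, barWord, List.map_nil, List.prod_nil, mul_one]
  | cons x b ih =>
    cases x with
    | piece s =>
      obtain ⟨k, h1, h2⟩ := hb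
      rw [barExpand, ih k _ (hw.append h1) h2]
      simp [barWord, barSlice, mul_assoc]
    | bar p =>
      have h4 : 1 + A ^ 4 ≠ 0 := by
        intro h
        apply hd
        rw [hA']
        field_simp
        linear_combination -h
      have e : d⁻¹ = -(A ^ 2 / (1 + A ^ 4)) := by
        rw [inv_eq_iff_eq_inv, hA', ← neg_inv, inv_div]
        field_simp
        ring
      have h6 : A + A⁻¹ ≠ 0 := by
        rw [show A + A⁻¹ = (A ^ 2 + 1) / A by field_simp]
        exact div_ne_zero hA2 hA
      have v1 : Valid n [⟨p, .cross true⟩] n := ⟨hb.1, rfl⟩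
      have v2 : Valid n [⟨p, .cap⟩, ⟨p, .cup⟩] n := by
        have := hb.1
        exact ⟨this, by omega, by simp only [Valid]; omega⟩
      rw [barExpand, ih n _ (hw.append v1) hb.2, ih n _ hw hb.2, ih n _ (hw.append v2) hb.2]
      simp only [barWord, barSlice, word_append, word_cons, word_nil, mul_one, slice, crossing,
        List.map_cons, List.prod_cons, mul_add, add_mul, mul_sub, sub_mul, mul_smul_comm,
        smul_mul_assoc, map_add, map_sub, map_smul, smul_eq_mul, one_mul, e]
      rw [← hook, show 1 - -A ^ 3 * A = 1 + A ^ 4 by ring]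
      simp only [mul_assoc]
      generalize Φ _ = x
      generalize Φ _ = y
      field_simp
      ring

end CupCap
end ThetaCurve

/-! ### Evaluation of the operators and the formula. -/

namespace ThetaCurve

/-- Below the diagram there are no arcs, which the discrete relation `⊥` records; `d⁻¹` comes from
the normalization of the circle to `1`. -/
theorem bracket_eq {K : Type*} [Field K] {A d : K} (hA' : d = -A ^ 2 - (A ^ 2)⁻¹) (hd : d ≠ 0)
    {w : List Slice} (hw : Valid 0 w 0) :
    bracket A w = d⁻¹ * (patternCupCap d).word A w (fun _ => 1) ⊥ := by
  have h : Records ⊥ ArcState.empty := ⟨fun i j => by simp [ArcState.empty], by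
    simp [ArcState.empty]⟩
  rw [bracket, bracketFrom_eq hA' hd w _ _ h hw]
  simp [ArcState.empty, zpow_neg]

theorem ThetaDiagram.jaeger_eq {K : Type*} [Field K] (D : ThetaDiagram) {A d : K} (hA : A ≠ 0)
    (hA' : d = -A ^ 2 - (A ^ 2)⁻¹) (hd : d ≠ 0) (hA2 : A ^ 2 + 1 ≠ 0) :
    D.jaeger A = bracket A D.L - d⁻¹ * ∑ i, bracket A (parallel (D.l i)) + 2 / d ^ 2 := by
  let Φ : Module.End K (Setoid ℕ → K) →ₗ[K] K :=
    d⁻¹ • (LinearMap.proj (⊥ : Setoid ℕ) ∘ₗ LinearMap.applyₗ (fun _ => 1))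
  have hev : ∀ w, Valid 0 w 0 → bracket A w = Φ ((patternCupCap d).word A w) :=
    fun w hw => bracket_eq hA' hd hw
  -- The empty diagram has the value `d⁻¹`; this turns the constant `2 d⁻¹` into `2 / d ^ 2`.
  have hone : Φ 1 = d⁻¹ := mul_one _
  rw [jaeger, R, (patternCupCap d).barExpand_eq hA hA' hd hA2 hev D.barDiagram 0 [] rfl
      (validBar_flatMap D.fits), CupCap.word_nil, one_mul, CupCap.barWord_barDiagram,
    CupCap.barMarked_eq _ hA hA' hd, map_add, map_sub, map_smul, map_smul, map_sum, hone,
    hev _ D.valid_L, Finset.sum_congr rfl fun i _ => (hev _ (D.valid_parallel_l i)).symm]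
  simp only [smul_eq_mul]
  field_simp

end ThetaCurve

theorem proposition3 (D : ThetaCurve.ThetaDiagram) (A φ : RatFunc ℚ) (hA : A = RatFunc.X)
    (hφ : φ = A ^ 2 + (A ^ 2)⁻¹) :
    D.normalizedJaeger A =
      (-A ^ 4) ^ (∑ i, D.twiceN i) *
        (ThetaCurve.bracket A D.L
          + 1 / φ * ∑ i, ThetaCurve.bracket A (ThetaCurve.parallel (D.l i))
          + 2 / φ ^ 2) := by
  -- Used for `n = 4`, where it gives `φ ≠ 0`, and for `n = 2`, where it gives `A + A⁻¹ ≠ 0`, the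
  -- denominator in the replacement of a bar.
  have hX : ∀ n : ℕ, n ≠ 0 → A ^ n + 1 ≠ 0 := by
    intro n hn h
    have h1 : algebraMap (Polynomial ℚ) (RatFunc ℚ) (Polynomial.X ^ n + 1) = 0 := by
      simpa [hA, RatFunc.algebraMap_X] using h
    rw [map_eq_zero_iff _ (RatFunc.algebraMap_injective ℚ)] at h1
    exact (Polynomial.monic_X_pow_add_C (1 : ℚ) hn).ne_zero (by simpa using h1)
  have hA0 : A ≠ 0 := hA ▸ RatFunc.X_ne_zero
  have hφ0 : φ ≠ 0 := by
    rw [hφ, show A ^ 2 + (A ^ 2)⁻¹ = (A ^ 4 + 1) / A ^ 2 by field_simp]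
    exact div_ne_zero (hX 4 (by norm_num)) (pow_ne_zero 2 hA0)
  rw [ThetaCurve.ThetaDiagram.normalizedJaeger,
    -- With loop value `-φ` the coefficient `-d⁻¹` becomes `1 / φ`.
    D.jaeger_eq (d := -φ) hA0 (by rw [hφ]; ring) (neg_ne_zero.2 hφ0) (hX 2 (by norm_num))]
  congr 1
  rw [neg_sq, inv_neg, one_div]
  ring
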